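/- **Conventions.** An *open chord diagram* $E$ is a finite uni-trivalent graph with a cyclic order of the edges at each trivalent (internal) vertex; its univalent vertices are called legs and its *degree* is half the number of its vertices. A *skeleton* $\Gamma$ is a uni-trivalent graph with oriented (distinguishable) edges and a cyclic order of the edges at each trivalent vertex; circle components without vertices are allowed. A *chord diagram of degree $i$ with support $\Gamma$* is an open chord diagram of degree $i$ without self-loops all of whose legs are glued to distinct interior points of the edges of $\Gamma$; such diagrams are considered up to homeomorphism, the homeomorphism preserving each edge of $\Gamma$ with its orientation. Let $\mathcal D^i(\Gamma)$ be the $\mathbb Q$-vector space freely generated by the homeomorphism classes of these diagrams, and let $\mathcal R^i(\Gamma)\subset\mathcal D^i(\Gamma)$ be the subspace spanned by the following relations between diagrams that agree outside the described part: * AS: $D+D'=0$ if $D'$ arises from $D$ by reversing the cyclic order at one internal vertex. * IHX: $D_1+D_2+D_3=0$ if an edge of the dashed graph joins two different internal vertices with cyclic orders $(h,a,b)$, $(k,d,e)$ in $D_1$; $(h,b,d)$, $(k,a,e)$ in $D_2$; $(h,d,a)$, $(k,b,e)$ in $D_3$, where $h,k$ are the two halves of that edge. * STU: $S=T-U$ if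 in $T$ the dashed edges $a,b$ end at neighbouring points of an edge of $\Gamma$, $a$ before $b$ with respect to its orientation, in $U$ these two points are interchanged, and in $S$ the edges $a,b$ end instead at an internal vertex with cyclic order $(s,b,a)$, where the third edge $s$ ends at a leg on $\Gamma$ at the same place. * Branching: if $v$ is a trivalent vertex of $\Gamma$, then $\varepsilon_1D_1+\varepsilon_2D_2+\varepsilon_3D_3=0$, where $D_k$ has one given leg glued to the $k$-th edge end at $v$, closer to $v$ than all other legs on that edge, the rest of the diagram being the same, and $\varepsilon_k=1$ if this edge end leaves $v$ and $\varepsilon_k=-1$ if it arrives at $v$. Put $\mathcal A^i(\Gamma)=\mathcal D^i(\Gamma)/\mathcal R^i(\Gamma)$ and let $\mathcal A(\Gamma)=\prod_{i\ge 0}\mathcal A^i(\Gamma)$, the space of formal series of chord diagrams modulo relations. For $g\ge 0$ let $\uparrow_{[g]}$ be the disjoint union of $g$ oriented intervals labelled $1,\dots,g$, and let $\Gamma^g$ be the chain graph: $g$ circles in a row, oriented counterclockwise, consecutive circles being joined by a horizontal segment oriented from left to right, with the cyclic orders at the $2(g-1)$ vertices given by the plane (so $\Gamma^1$ is an oriented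 circle without vertices; $\Gamma^0$ is a point, on which no leg can be placed). Let $\phi:\uparrow_{[g]}\to\Gamma^g$ be the orientation preserving embedding that sends the arrow labelled $i$ onto the upper half of the $i$-th circle, and let $\phi:\mathcal D^i(\uparrow_{[g]})\to\mathcal D^i(\Gamma^g)$ also denote the induced linear maps. **Proposition 2.3.** For every $g\ge 0$ the map $\phi$ induces an isomorphism of $\mathbb Q$-vector spaces $$\phi_*:\mathcal A(\uparrow_{[g]})\to\mathcal A(\Gamma^g),\qquad \phi_*\big(([x_i])_{i\ge 0}\big)=([\phi(x_i)])_{i\ge 0}\quad\text{for all } x_i\in\mathcal D^i(\uparrow_{[g]});$$ that is, $\phi_*$ is well defined by this formula, linear and bijective. -/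

import Mathlib

namespace ChordDiagrams

open Classical in
/-- The cyclic permutation `x ↦ y ↦ z ↦ x` (for pairwise distinct `x`, `y`, `z`). -/
noncomputable def cyc {H : Type} (x y z : H) : Equiv.Perm H :=
  Equiv.swap x y * Equiv.swap y z

/-! ### Skeletons -/

/-- The two ends of an oriented interval. -/
inductive Side
  | start
  | finish

/-- A skeleton: a uni-trivalent graph with oriented edges and vertex orientations, circle
components being allowed. It has interval edges `Arc`, circle components `Circ`, and trivalent
vertices `Vert`; `half v 0, half v 1, half v 2` are the three ends of arcs that meet at `v`, in
their cyclic order. The ends of arcs that are not of the form `half v k` are the univalent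
vertices. Edges are distinguishable, so a homeomorphism of skeletons that respects the labels fixes
every edge together with its orientation. -/
structure Skeleton where
  Arc : Type
  Circ : Type
  Vert : Type
  half : Vert → Fin 3 → Arc × Side
  half_injective : Function.Injective (fun p : Vert × Fin 3 => half p.1 p.2)

/-- The edges of a skeleton: its intervals and its circles. -/
abbrev Skeleton.Edge (Γ : Skeleton) : Type := Γ.Arc ⊕ Γ.Circ

/-! ### Chord diagrams -/

/-- The combinatorial data of a chord diagram with support `Γ`, whose set of dashed half-edges is
`H`. The vertices of the dashed graph are the cycles of `rot` (the next half-edge in the cyclic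
order at the same vertex), its edges are the cycles of `opp` (the other half of the same edge), and
`pos e` is the sequence of the legs glued to the edge `e` of `Γ`, in the order given by the
orientation of `e`. If `e` is a circle, this sequence starts at an arbitrary leg. -/
structure DiagramData (Γ : Skeleton) (H : Type) where
  rot : Equiv.Perm H
  opp : Equiv.Perm H
  pos : Γ.Edge → List H

namespace DiagramData

variable {Γ : Skeleton} {H : Type}

/-- The number of vertices of the dashed graph: a leg is a fixed point of `rot`, and an internal
vertex is a cycle of length three. -/
noncomputable def numVertices (c : DiagramData Γ H) : ℕ :=
  Nat.card {h : H // c.rot h = h} + Nat.card {h : H // c.rot h ≠ h} / 3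

/-- The data describe a chord diagram of degree `i` with support `Γ`, without self-loops and
without univalent vertices (that is, all legs are glued to distinct interior points of edges of
`Γ`). The degree is half the number of the vertices of the dashed graph. -/
structure IsDiagram (c : DiagramData Γ H) (i : ℕ) : Prop where
  rot_rot_rot : ∀ h, c.rot (c.rot (c.rot h)) = h
  opp_opp : ∀ h, c.opp (c.opp h) = h
  opp_ne : ∀ h, c.opp h ≠ h
  no_loop : ∀ h, c.opp h ≠ c.rot h
  leg_iff : ∀ h, c.rot h = h ↔ ∃ e, h ∈ c.pos e
  edge_unique : ∀ h e e', h ∈ c.pos e → h ∈ c.pos e' → e = e'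
  nodup : ∀ e, (c.pos e).Nodup
  degree : c.numVertices = 2 * i

/-- Reattach the half-edges to the vertices of the dashed graph: the half-edge `s h` takes the
place of `h`. The edges of the dashed graph and the legs are kept. -/
def reattach (c : DiagramData Γ H) (s : Equiv.Perm H) : DiagramData Γ H :=
  { c with rot := s * c.rot * s⁻¹ }

/-- The same dashed graph, glued differently to the skeleton. -/
def withPos (c : DiagramData Γ H) (p : Γ.Edge → List H) : DiagramData Γ H :=
  { c with pos := p }

/-- For two legs `a`, `b`: join their edges at a new internal vertex `inr false`, and join this
vertex by a new edge to a new leg `inr true`. The cyclic order at the new vertex is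
(new edge, edge of `b`, edge of `a`). The new leg is glued to the skeleton as prescribed by `p`. -/
noncomputable def joinLegs (c : DiagramData Γ H) (a b : H) (p : Γ.Edge → List (H ⊕ Bool)) :
    DiagramData Γ (H ⊕ Bool) where
  rot := Equiv.Perm.sumCongr c.rot 1 * cyc (Sum.inr false) (Sum.inl b) (Sum.inl a)
  opp := Equiv.Perm.sumCongr c.opp Equiv.boolNot
  pos := p

/-- A homeomorphism of chord diagrams, which on `Γ` is isotopic to the identity. -/
structure Iso {H' : Type} (c : DiagramData Γ H) (c' : DiagramData Γ H') where
  toEquiv : H ≃ H'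
  rot_comm : ∀ h, toEquiv (c.rot h) = c'.rot (toEquiv h)
  opp_comm : ∀ h, toEquiv (c.opp h) = c'.opp (toEquiv h)
  pos_arc : ∀ a : Γ.Arc, c'.pos (Sum.inl a) = (c.pos (Sum.inl a)).map toEquiv
  pos_circ : ∀ o : Γ.Circ, ((c.pos (Sum.inr o)).map toEquiv).IsRotated (c'.pos (Sum.inr o))

/-- The identity. -/
def Iso.refl (c : DiagramData Γ H) : Iso c c where
  toEquiv := Equiv.refl H
  rot_comm _ := rfl
  opp_comm _ := rfl
  pos_arc a := by simp
  pos_circ o := by simpa using List.IsRotated.refl _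

/-- The inverse. -/
def Iso.symm {H' : Type} {c : DiagramData Γ H} {c' : DiagramData Γ H'} (f : Iso c c') :
    Iso c' c where
  toEquiv := f.toEquiv.symm
  rot_comm h := by rw [Equiv.symm_apply_eq, f.rot_comm, Equiv.apply_symm_apply]
  opp_comm h := by rw [Equiv.symm_apply_eq, f.opp_comm, Equiv.apply_symm_apply]
  pos_arc a := by rw [f.pos_arc]; simp
  pos_circ o := by
    have h := ((f.pos_circ o).symm).map f.toEquiv.symm
    simpa using h

/-- The composition. -/
def Iso.trans {H' H'' : Type} {c : DiagramData Γ H} {c' : DiagramData Γ H'}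
    {c'' : DiagramData Γ H''} (f : Iso c c') (g : Iso c' c'') : Iso c c'' where
  toEquiv := f.toEquiv.trans g.toEquiv
  rot_comm h := by simp [f.rot_comm, g.rot_comm]
  opp_comm h := by simp [f.opp_comm, g.opp_comm]
  pos_arc a := by rw [g.pos_arc, f.pos_arc]; simp
  pos_circ o := by
    have h := ((f.pos_circ o).map g.toEquiv).trans (g.pos_circ o)
    simpa using h

end DiagramData

/-- Chord diagrams of degree `i` with support `Γ`. -/
structure ChordDiagram (Γ : Skeleton) (i : ℕ) where
  H : Type
  finite : Finite H
  data : DiagramData Γ H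
  isDiagram : data.IsDiagram i

/-- Two chord diagrams are equivalent if they are homeomorphic. -/
instance ChordDiagram.setoid (Γ : Skeleton) (i : ℕ) : Setoid (ChordDiagram Γ i) where
  r D D' := Nonempty (DiagramData.Iso D.data D'.data)
  iseqv :=
    { refl := fun D => ⟨DiagramData.Iso.refl D.data⟩
      symm := fun ⟨f⟩ => ⟨f.symm⟩
      trans := fun ⟨f⟩ ⟨g⟩ => ⟨f.trans g⟩ }

/-- Homeomorphism classes of chord diagrams of degree `i` with support `Γ`. -/
def DiagramClass (Γ : Skeleton) (i : ℕ) : Type 1 := Quotient (ChordDiagram.setoid Γ i)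

/-- The `ℚ`-vector space freely generated by the homeomorphism classes of chord diagrams of degree
`i` with support `Γ`. -/
abbrev FreeSpace (Γ : Skeleton) (i : ℕ) : Type 1 := DiagramClass Γ i →₀ ℚ

/-- The generator given by a chord diagram. -/
noncomputable def gen {Γ : Skeleton} {i : ℕ} {H : Type} [hH : Finite H] (c : DiagramData Γ H)
    (hc : c.IsDiagram i) : FreeSpace Γ i :=
  Finsupp.single (Quotient.mk (ChordDiagram.setoid Γ i) ⟨H, hH, c, hc⟩) 1

/-! ### Relations -/

open Classical in
/-- Glue one more leg `l` to the skeleton, at the extreme point of an arc next to a given end. -/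
noncomputable def attachAt {Γ : Skeleton} {H : Type} (p : Γ.Edge → List H) (l : H) :
    Γ.Arc × Side → Γ.Edge → List H
  | (a, Side.start) => Function.update p (Sum.inl a) (l :: p (Sum.inl a))
  | (a, Side.finish) => Function.update p (Sum.inl a) (p (Sum.inl a) ++ [l])

/-- The sign of an arc at one of its end points: `1` if the arc leaves it, `-1` if the arc
arrives there. -/
def Side.sign : Side → ℚ
  | Side.start => 1
  | Side.finish => -1

open Classical in
/-- The AS, IHX, STU and branching relations between chord diagrams of degree `i`. -/
inductive IsRelation (Γ : Skeleton) (i : ℕ) : FreeSpace Γ i → Prop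
  /-- AS: reversing the cyclic order at the internal vertex of `h` changes the sign. -/
  | as {H : Type} [Finite H] (c : DiagramData Γ H) (h : H) (hh : c.rot h ≠ h)
      (h₀ : c.IsDiagram i)
      (h₁ : (c.reattach (Equiv.swap h (c.rot h))).IsDiagram i) :
      IsRelation Γ i (gen c h₀ + gen _ h₁)
  /-- IHX: the edge with halves `h`, `k` joins two different internal vertices, where the cyclic
  orders are `(h, a, b)` and `(k, d, e)`. The other two diagrams have `(h, b, d)`, `(k, a, e)` and
  `(h, d, a)`, `(k, b, e)` instead. -/
  | ihx {H : Type} [Finite H] (c : DiagramData Γ H) (h k a b d : H)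
      (hk : c.opp h = k) (hh : c.rot h ≠ h) (hkk : c.rot k ≠ k)
      (ha : c.rot h = a) (hb : c.rot a = b) (hd : c.rot k = d) (hka : k ≠ a) (hkb : k ≠ b)
      (h₀ : c.IsDiagram i)
      (h₁ : (c.reattach (cyc a b d)).IsDiagram i)
      (h₂ : (c.reattach (cyc a b d * cyc a b d)).IsDiagram i) :
      IsRelation Γ i (gen c h₀ + gen _ h₁ + gen _ h₂)
  /-- STU: the legs `a`, `b` are neighbours on the edge `e` of the skeleton. -/
  | stu {H : Type} [Finite H] (c : DiagramData Γ H) (p : Γ.Edge → List H) (e : Γ.Edge)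
      (l₁ l₂ : List H) (a b : H)
      (hT : (c.withPos (Function.update p e (l₁ ++ a :: b :: l₂))).IsDiagram i)
      (hU : (c.withPos (Function.update p e (l₁ ++ b :: a :: l₂))).IsDiagram i)
      (hS : (c.joinLegs a b (Function.update (fun e' => (p e').map Sum.inl) e
        (l₁.map Sum.inl ++ Sum.inr true :: l₂.map Sum.inl))).IsDiagram i) :
      IsRelation Γ i (gen _ hS - (gen _ hT - gen _ hU))
  /-- Branching: the leg `l` is glued next to the trivalent vertex `v` of the skeleton, on each of
  the three edge ends in turn. -/
  | branching {H : Type} [Finite H] (c : DiagramData Γ H) (p : Γ.Edge → List H) (l : H)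
      (v : Γ.Vert)
      (h : ∀ k : Fin 3, (c.withPos (attachAt p l (Γ.half v k))).IsDiagram i) :
      IsRelation Γ i (∑ k : Fin 3, (Γ.half v k).2.sign • gen _ (h k))

/-- The subspace generated by the relations in degree `i`. -/
noncomputable def relations (Γ : Skeleton) (i : ℕ) : Submodule ℚ (FreeSpace Γ i) :=
  Submodule.span ℚ {x | IsRelation Γ i x}

/-- The degree `i` part of the space of chord diagrams with support `Γ`. -/
abbrev GradedA (Γ : Skeleton) (i : ℕ) : Type 1 := FreeSpace Γ i ⧸ relations Γ i

/-- The space `𝒜(Γ)` of formal series of chord diagrams modulo relations, that is, the completion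
of the sum of the spaces `GradedA Γ i` with respect to the degree. -/
abbrev SpaceA (Γ : Skeleton) : Type 1 := ∀ i : ℕ, GradedA Γ i

/-- The element of `𝒜(Γ)` represented by a formal series of chord diagrams. -/
noncomputable def toSpaceA {Γ : Skeleton} (x : ∀ i : ℕ, FreeSpace Γ i) : SpaceA Γ :=
  fun i => (relations Γ i).mkQ (x i)

/-! ### The skeletons of the theorem -/

/-- The disjoint union of oriented intervals labelled by the elements of `X`. -/
def arrows (X : Type) : Skeleton where
  Arc := X
  Circ := Empty
  Vert := Empty
  half v := v.elim
  half_injective := fun p => p.1.elim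

/-- The edges of the chain graph with `n + 2` circles. The first and the last circle have one
vertex, and each is one edge; the other circles consist of an upper and a lower half-circle. The
horizontal segment `bridge j` runs from the `j`-th circle to the next one. -/
inductive ChainArc (n : ℕ)
  | first
  | last
  | upper (i : Fin n)
  | lower (i : Fin n)
  | bridge (j : Fin (n + 1))

/-- The edge that contains the upper half of the `i`-th circle. -/
def ChainArc.up {n : ℕ} : Fin (n + 2) → ChainArc n :=
  Fin.cases ChainArc.first (Fin.lastCases ChainArc.last ChainArc.upper)

/-- The edge that contains the lower half of the `i`-th circle. -/
def ChainArc.down {n : ℕ} : Fin (n + 2) → ChainArc n :=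
  Fin.cases ChainArc.first (Fin.lastCases ChainArc.last ChainArc.lower)

/-- The edge ends at the trivalent vertices of the chain graph with `n + 2` circles, counter-
clockwise. The vertex `(j, Side.start)` is the left end of `bridge j`, which is the rightmost point
of the `j`-th circle, and `(j, Side.finish)` is the right end of `bridge j`, which is the leftmost
point of the next circle. All circles are oriented counterclockwise (upper half-circles from right
to left, lower ones from left to right), and the horizontal segments from left to right. -/
def ChainArc.half {n : ℕ} : Fin (n + 1) × Side → Fin 3 → ChainArc n × Side
  | (j, Side.start) =>
      ![(bridge j, Side.start), (up j.castSucc, Side.start), (down j.castSucc, Side.finish)]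
  | (j, Side.finish) =>
      ![(bridge j, Side.finish), (down j.succ, Side.start), (up j.succ, Side.finish)]

theorem ChainArc.up_injective {n : ℕ} : Function.Injective (ChainArc.up (n := n)) := by
  intro x y
  refine Fin.cases ?_ (fun x => Fin.lastCases ?_ (fun x => ?_) x) x <;>
  refine Fin.cases ?_ (fun y => Fin.lastCases ?_ (fun y => ?_) y) y <;>
  simp [ChainArc.up, -Fin.succ_last]

theorem ChainArc.down_injective {n : ℕ} : Function.Injective (ChainArc.down (n := n)) := by
  intro x y
  refine Fin.cases ?_ (fun x => Fin.lastCases ?_ (fun x => ?_) x) x <;>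
  refine Fin.cases ?_ (fun y => Fin.lastCases ?_ (fun y => ?_) y) y <;>
  simp [ChainArc.down, -Fin.succ_last]

theorem ChainArc.up_ne_bridge {n : ℕ} (x : Fin (n + 2)) (j : Fin (n + 1)) :
    ChainArc.up x ≠ ChainArc.bridge j := by
  refine Fin.cases ?_ (fun x => Fin.lastCases ?_ (fun x => ?_) x) x <;>
  simp [ChainArc.up, -Fin.succ_last]

theorem ChainArc.down_ne_bridge {n : ℕ} (x : Fin (n + 2)) (j : Fin (n + 1)) :
    ChainArc.down x ≠ ChainArc.bridge j := by
  refine Fin.cases ?_ (fun x => Fin.lastCases ?_ (fun x => ?_) x) x <;>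
  simp [ChainArc.down, -Fin.succ_last]

theorem ChainArc.up_ne_down {n : ℕ} (x y : Fin (n + 1)) :
    ChainArc.up x.castSucc ≠ ChainArc.down y.succ := by
  refine Fin.cases ?_ (fun x => ?_) x <;> refine Fin.lastCases ?_ (fun y => ?_) y <;>
  simp [ChainArc.up, ChainArc.down, -Fin.succ_last]

theorem ChainArc.down_ne_up {n : ℕ} (x y : Fin (n + 1)) :
    ChainArc.down x.castSucc ≠ ChainArc.up y.succ := by
  refine Fin.cases ?_ (fun x => ?_) x <;> refine Fin.lastCases ?_ (fun y => ?_) y <;>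
  simp [ChainArc.up, ChainArc.down, -Fin.succ_last]

theorem ChainArc.half_injective {n : ℕ} :
    Function.Injective (fun p : (Fin (n + 1) × Side) × Fin 3 => ChainArc.half p.1 p.2) := by
  rintro ⟨⟨j, s⟩, k⟩ ⟨⟨j', s'⟩, k'⟩ h
  have b1 := fun x j => (ChainArc.up_ne_bridge (n := n) x j).symm
  have b2 := fun x j => (ChainArc.down_ne_bridge (n := n) x j).symm
  have b3 := fun x y => (ChainArc.up_ne_down (n := n) x y).symm
  have b4 := fun x y => (ChainArc.down_ne_up (n := n) x y).symm
  cases s <;> cases s' <;> fin_cases k <;> fin_cases k' <;>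
  simp_all [ChainArc.half, ChainArc.up_ne_bridge, ChainArc.down_ne_bridge, ChainArc.up_ne_down,
    ChainArc.down_ne_up, ChainArc.up_injective.eq_iff, ChainArc.down_injective.eq_iff]

/-- The chain graph `Γ^g`: a chain of `g` circles, joined by `g - 1` horizontal segments. For
`g = 1` it is one circle without vertices. For `g = 0` it is a point: there is no edge to which a
leg could be glued, and the isolated point itself is not recorded. -/
def chainGraph : ℕ → Skeleton
  | 0 =>
    { Arc := Empty, Circ := Empty, Vert := Empty, half := fun v => v.elim
      half_injective := fun p => p.1.elim }
  | 1 =>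
    { Arc := Empty, Circ := Unit, Vert := Empty, half := fun v => v.elim
      half_injective := fun p => p.1.elim }
  | n + 2 =>
    { Arc := ChainArc n, Circ := Empty, Vert := Fin (n + 1) × Side, half := ChainArc.half
      half_injective := ChainArc.half_injective }

/-- The embedding of `g` arrows onto the upper half-circles of the chain graph, recorded by the edge
that contains the image of each arrow. It preserves orientations. -/
def upperHalf : (g : ℕ) → (arrows (Fin g)).Arc ↪ (chainGraph g).Edge
  | 0 => ⟨fun x => Fin.elim0 x, fun x => Fin.elim0 x⟩
  | 1 => ⟨fun _ => Sum.inr (), fun x y _ => Subsingleton.elim (α := Fin 1) x y⟩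
  | n + 2 => ⟨fun x => Sum.inl (ChainArc.up (n := n) x),
      fun _ _ h => ChainArc.up_injective (Sum.inl_injective h)⟩

/-! ### The action of an embedding of arrows on chord diagrams -/

section push

variable {X : Type} {Γ : Skeleton}

/-- The image of a chord diagram under an orientation preserving embedding of the arrows into `Γ`,
the arrow `x` being sent into the edge `f x`. -/
noncomputable def DiagramData.push {H : Type} (f : (arrows X).Arc ↪ Γ.Edge)
    (c : DiagramData (arrows X) H) : DiagramData Γ H where
  rot := c.rot
  opp := c.opp
  pos := Function.extend f (fun x => c.pos (Sum.inl x)) (fun _ => [])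

theorem DiagramData.push_pos_eq_nil {H : Type} (f : (arrows X).Arc ↪ Γ.Edge)
    (c : DiagramData (arrows X) H) (e : Γ.Edge) (he : ¬ ∃ x, f x = e) :
    (c.push f).pos e = [] := by
  exact Function.extend_apply' (fun x => c.pos (Sum.inl x)) (fun _ => []) e he

theorem DiagramData.mem_push {H : Type} (f : (arrows X).Arc ↪ Γ.Edge)
    (c : DiagramData (arrows X) H) (h : H) (e : Γ.Edge) :
    h ∈ (c.push f).pos e ↔ ∃ x, f x = e ∧ h ∈ c.pos (Sum.inl x) := by
  by_cases he : ∃ x, f x = e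
  · obtain ⟨x, rfl⟩ := he
    simp [DiagramData.push, f.injective.extend_apply]
  · have : (c.push f).pos e = [] := c.push_pos_eq_nil f e he
    rw [this]
    simp only [List.not_mem_nil, false_iff]
    rintro ⟨x, hx, -⟩
    exact he ⟨x, hx⟩

theorem DiagramData.IsDiagram.push {H : Type} (f : (arrows X).Arc ↪ Γ.Edge)
    {c : DiagramData (arrows X) H} {i : ℕ} (hc : c.IsDiagram i) : (c.push f).IsDiagram i where
  rot_rot_rot := hc.rot_rot_rot
  opp_opp := hc.opp_opp
  opp_ne := hc.opp_ne
  no_loop := hc.no_loop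
  leg_iff h := by
    refine (hc.leg_iff h).trans ⟨?_, ?_⟩
    · rintro ⟨x | x, hx⟩
      · exact ⟨f x, (c.mem_push f h _).2 ⟨x, rfl, hx⟩⟩
      · exact x.elim
    · rintro ⟨e, he⟩
      obtain ⟨x, -, hx⟩ := (c.mem_push f h e).1 he
      exact ⟨_, hx⟩
  edge_unique h e e' he he' := by
    obtain ⟨x, rfl, hx⟩ := (c.mem_push f h e).1 he
    obtain ⟨x', rfl, hx'⟩ := (c.mem_push f h e').1 he'
    exact congrArg f (Sum.inl_injective (hc.edge_unique h _ _ hx hx'))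
  nodup e := by
    by_cases he : ∃ x, f x = e
    · obtain ⟨x, rfl⟩ := he
      simpa [DiagramData.push, f.injective.extend_apply] using hc.nodup (Sum.inl x)
    · have : (c.push f).pos e = [] := c.push_pos_eq_nil f e he
      rw [this]
      exact List.nodup_nil
  degree := hc.degree

theorem DiagramData.push_iso {H H' : Type} (f : (arrows X).Arc ↪ Γ.Edge)
    {c : DiagramData (arrows X) H} {c' : DiagramData (arrows X) H'}
    (s : DiagramData.Iso c c') : Nonempty (DiagramData.Iso (c.push f) (c'.push f)) := by
  have key : ∀ e, (c'.push f).pos e = ((c.push f).pos e).map s.toEquiv := by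
    intro e
    by_cases he : ∃ x, f x = e
    · obtain ⟨x, rfl⟩ := he
      simpa [DiagramData.push, f.injective.extend_apply] using s.pos_arc x
    · have h₁ : (c.push f).pos e = [] := c.push_pos_eq_nil f e he
      have h₂ : (c'.push f).pos e = [] := c'.push_pos_eq_nil f e he
      rw [h₁, h₂, List.map_nil]
  refine ⟨⟨s.toEquiv, s.rot_comm, s.opp_comm, fun a => key _, fun o => ?_⟩⟩
  rw [key]

/-- The image of a homeomorphism class of chord diagrams. -/
noncomputable def pushClass (f : (arrows X).Arc ↪ Γ.Edge) (i : ℕ) :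
    DiagramClass (arrows X) i → DiagramClass Γ i :=
  Quotient.map (fun D => ⟨D.H, D.finite, D.data.push f, D.isDiagram.push f⟩)
    (fun _ _ ⟨s⟩ => DiagramData.push_iso f s)

/-- The map induced on formal linear combinations of chord diagrams. -/
noncomputable def pushFree (f : (arrows X).Arc ↪ Γ.Edge) (i : ℕ) :
    FreeSpace (arrows X) i →ₗ[ℚ] FreeSpace Γ i :=
  Finsupp.lmapDomain ℚ ℚ (pushClass f i)

end push

end ChordDiagrams

/-!
The map `φ` is inverted by a pullback. For `g ≥ 2`, every upper half-circle is extended to a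
closed path at the vertex on the first circle: from this vertex along the *stem* of horizontal
segments and lower half-circles to the circle, through the edge that contains the upper
half-circle, and back along the stem. The pullback of a diagram is the sum of all its lifts to
these paths: every leg on an edge `e` is lifted to one of the passages of the paths through `e`,
with a sign if the passage runs against the orientation of `e` (`PathSystem.pullback`).

The pullback respects the relations. AS and IHX hold for each lift separately. In the STU
relation, lifts of the two legs to different passages cancel, and lifts to the same passage form
an STU relation of arrows (`PathSystem.pullback_stu`). In the branching relation at `v`, the end
of one passage at `v` cancels against the start of the next one, so that only the starts and the
ends of the paths remain (`PathSystem.pullback_branching`). At the base vertex these add up to the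
difference between a leg at the start and a leg at the end of the arrows, summed over all arrows,
and this difference is zero (`DiagramData.sum_cls_start_sub_finish`): by STU it is the sum of the
diagrams in which the edge of the leg is joined to the ends of the dashed edges on the skeleton.
The sum over *all* half-edges vanishes, since the two halves of an edge contribute opposite
diagrams by AS, and the sum over the half-edges at an internal vertex vanishes by IHX. Where the
edge of the leg itself ends at the vertex, the IHX relation would contain a self-loop, and the two
remaining terms are opposite by AS.

The edge of an upper half-circle is passed exactly once, so the image under `φ` of a diagram has
one lift, the diagram itself (`PathSystem.pullback_push`), and `φ` is injective modulo relations.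
It is surjective since branching pushes the legs on the stem to the right, and finally onto the
edges of the upper half-circles (`cls_mem_range_pushA`). For `g = 1` there is no vertex. The
pullback cuts the circle open, and it is well defined because moving a leg from the start to the
end of a single arrow does not change the class of a diagram.
-/

namespace ChordDiagrams

open scoped Classical

/-! ### Diagrams with floating legs -/

namespace DiagramData

variable {Γ : Skeleton} {H : Type} {i : ℕ}

/-- A chord diagram of degree `i` in which the legs belonging to `F` are not glued to the
skeleton, while all other legs are. -/
structure IsPartial (c : DiagramData Γ H) (i : ℕ) (F : Set H) : Prop where
  rot_rot_rot : ∀ h, c.rot (c.rot (c.rot h)) = h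
  opp_opp : ∀ h, c.opp (c.opp h) = h
  opp_ne : ∀ h, c.opp h ≠ h
  no_loop : ∀ h, c.opp h ≠ c.rot h
  leg_iff : ∀ h, c.rot h = h ↔ h ∈ F ∨ ∃ e, h ∈ c.pos e
  notMem : ∀ h ∈ F, ∀ e, h ∉ c.pos e
  edge_unique : ∀ h e e', h ∈ c.pos e → h ∈ c.pos e' → e = e'
  nodup : ∀ e, (c.pos e).Nodup
  degree : c.numVertices = 2 * i

theorem isPartial_empty {c : DiagramData Γ H} : c.IsPartial i ∅ ↔ c.IsDiagram i :=
  ⟨fun h => ⟨h.rot_rot_rot, h.opp_opp, h.opp_ne, h.no_loop, by simpa using h.leg_iff,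
    h.edge_unique, h.nodup, h.degree⟩,
   fun h => ⟨h.rot_rot_rot, h.opp_opp, h.opp_ne, h.no_loop, by simpa using h.leg_iff,
    by simp, h.edge_unique, h.nodup, h.degree⟩⟩

theorem IsDiagram.of_perm {c : DiagramData Γ H} (hc : c.IsDiagram i) {p : Γ.Edge → List H}
    (hp : ∀ e, (p e).Perm (c.pos e)) : (c.withPos p).IsDiagram i where
  rot_rot_rot := hc.rot_rot_rot
  opp_opp := hc.opp_opp
  opp_ne := hc.opp_ne
  no_loop := hc.no_loop
  leg_iff h := by simpa only [withPos, (hp _).mem_iff] using hc.leg_iff h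
  edge_unique h e e' := by simpa only [withPos, (hp _).mem_iff] using hc.edge_unique h e e'
  nodup e := (hp e).nodup_iff.2 (hc.nodup e)
  degree := hc.degree

/-- Gluing the floating leg anywhere on the skeleton gives a chord diagram. -/
theorem IsPartial.isDiagram_insert {c : DiagramData Γ H} {l : H} (hc : c.IsPartial i {l})
    {p : Γ.Edge → List H} (e : Γ.Edge) (he : (p e).Perm (l :: c.pos e))
    (hp : ∀ e', e' ≠ e → p e' = c.pos e') : (c.withPos p).IsDiagram i := by
  have hm : ∀ h e', h ∈ p e' ↔ (h = l ∧ e' = e) ∨ h ∈ c.pos e' := by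
    intro h e'
    by_cases h' : e' = e
    · subst h'; simp [he.mem_iff]
    · simp [hp e' h', h']
  have hl : ∀ e', l ∉ c.pos e' := hc.notMem l rfl
  exact
  { rot_rot_rot := hc.rot_rot_rot
    opp_opp := hc.opp_opp
    opp_ne := hc.opp_ne
    no_loop := hc.no_loop
    leg_iff := fun h => by
      change c.rot h = h ↔ ∃ e, h ∈ p e
      simp only [hm, hc.leg_iff h, Set.mem_singleton_iff, exists_or, exists_and_left, exists_eq,
        and_true]
    edge_unique := fun h e₁ e₂ h₁ h₂ => by
      change h ∈ p e₁ at h₁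
      change h ∈ p e₂ at h₂
      rw [hm] at h₁ h₂
      rcases h₁ with ⟨rfl, rfl⟩ | h₁ <;> rcases h₂ with ⟨h₂, rfl⟩ | h₂
      · rfl
      · exact (hl _ h₂).elim
      · subst h₂; exact (hl _ h₁).elim
      · exact hc.edge_unique h _ _ h₁ h₂
    nodup := fun e' => by
      change (p e').Nodup
      by_cases h' : e' = e
      · subst h'
        rw [he.nodup_iff, List.nodup_cons]
        exact ⟨hl _, hc.nodup _⟩
      · rw [hp e' h']; exact hc.nodup e'
    degree := hc.degree }

theorem IsPartial.isDiagram_update {c : DiagramData Γ H} {l : H} (hc : c.IsPartial i {l})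
    (e : Γ.Edge) {L : List H} (hL : L.Perm (l :: c.pos e)) :
    (c.withPos (Function.update c.pos e L)).IsDiagram i :=
  hc.isDiagram_insert e (by rwa [Function.update_self]) fun e' h' => by
    rw [Function.update_of_ne h']

/-- Detaching a leg from the skeleton. -/
theorem IsDiagram.isPartial_erase {c : DiagramData Γ H} (hc : c.IsDiagram i) {l : H}
    {p : Γ.Edge → List H} (e : Γ.Edge) (he : (c.pos e).Perm (l :: p e))
    (hp : ∀ e', e' ≠ e → c.pos e' = p e') : (c.withPos p).IsPartial i {l} := by
  have hm : ∀ h e', h ∈ c.pos e' ↔ (h = l ∧ e' = e) ∨ h ∈ p e' := by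
    intro h e'
    by_cases h' : e' = e
    · subst h'; simp [he.mem_iff]
    · simp [hp e' h', h']
  have hle : l ∈ c.pos e := (hm _ _).2 (Or.inl ⟨rfl, rfl⟩)
  have hn := he.nodup_iff.1 (hc.nodup e)
  rw [List.nodup_cons] at hn
  exact
  { rot_rot_rot := hc.rot_rot_rot
    opp_opp := hc.opp_opp
    opp_ne := hc.opp_ne
    no_loop := hc.no_loop
    leg_iff := fun h => by
      change c.rot h = h ↔ _ ∨ ∃ e, h ∈ p e
      simp only [hm, hc.leg_iff h, Set.mem_singleton_iff, exists_or, exists_and_left, exists_eq,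
        and_true]
    notMem := by
      rintro h rfl e' h'
      change h ∈ p e' at h'
      have : e' = e := hc.edge_unique h _ _ ((hm _ _).2 (Or.inr h')) hle
      subst this
      exact hn.1 h'
    edge_unique := fun h e₁ e₂ h₁ h₂ =>
      hc.edge_unique h _ _ ((hm _ _).2 (Or.inr h₁)) ((hm _ _).2 (Or.inr h₂))
    nodup := fun e' => by
      change (p e').Nodup
      by_cases h' : e' = e
      · subst h'; exact hn.2
      · rw [← hp e' h']; exact hc.nodup e'
    degree := hc.degree }

theorem Iso.isDiagram {H' : Type} {c : DiagramData Γ H} {c' : DiagramData Γ H'} (f : Iso c c')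
    (hc : c.IsDiagram i) : c'.IsDiagram i := by
  have hmem : ∀ h e, f.toEquiv h ∈ c'.pos e ↔ h ∈ c.pos e := by
    rintro h (a | o)
    · rw [f.pos_arc, List.mem_map_of_injective f.toEquiv.injective]
    · rw [← (f.pos_circ o).mem_iff, List.mem_map_of_injective f.toEquiv.injective]
  have hs : ∀ P : H' → Prop, (∀ h, P (f.toEquiv h)) → ∀ h, P h := fun P hP h => by
    simpa using hP (f.toEquiv.symm h)
  refine ⟨hs _ fun h => ?_, hs _ fun h => ?_, hs _ fun h => ?_, hs _ fun h => ?_, hs _ fun h => ?_,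
    hs _ fun h => ?_, ?_, ?_⟩
  · rw [← f.rot_comm, ← f.rot_comm, ← f.rot_comm, hc.rot_rot_rot]
  · rw [← f.opp_comm, ← f.opp_comm, hc.opp_opp]
  · rw [← f.opp_comm, f.toEquiv.injective.ne_iff]; exact hc.opp_ne h
  · rw [← f.opp_comm, ← f.rot_comm, f.toEquiv.injective.ne_iff]; exact hc.no_loop h
  · rw [← f.rot_comm, f.toEquiv.injective.eq_iff]; simpa only [hmem] using hc.leg_iff h
  · simpa only [hmem] using hc.edge_unique h
  · rintro (a | o)
    · rw [f.pos_arc]; exact (hc.nodup _).map f.toEquiv.injective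
    · rw [← (f.pos_circ o).nodup_iff]; exact (hc.nodup _).map f.toEquiv.injective
  · rw [← hc.degree, numVertices, numVertices]
    have e₁ : {h // c.rot h = h} ≃ {h // c'.rot h = h} :=
      f.toEquiv.subtypeEquiv fun h => by rw [← f.rot_comm, f.toEquiv.injective.eq_iff]
    have e₂ : {h // c.rot h ≠ h} ≃ {h // c'.rot h ≠ h} :=
      f.toEquiv.subtypeEquiv fun h => by rw [← f.rot_comm, f.toEquiv.injective.ne_iff]
    rw [Nat.card_congr e₁, Nat.card_congr e₂]

end DiagramData

theorem cyc_apply_left {H : Type} {x y z : H} (h₁ : x ≠ y) (h₂ : x ≠ z) : cyc x y z x = y := by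
  simp [cyc, Equiv.swap_apply_of_ne_of_ne h₁ h₂]

theorem cyc_apply_mid {H : Type} {x y z : H} (h₁ : x ≠ z) (h₂ : y ≠ z) : cyc x y z y = z := by
  simp [cyc, Equiv.swap_apply_of_ne_of_ne h₁.symm h₂.symm]

theorem cyc_apply_right {H : Type} {x y z : H} : cyc x y z z = x := by
  simp [cyc]

theorem cyc_apply_of_ne {H : Type} {x y z w : H} (h₁ : w ≠ x) (h₂ : w ≠ y) (h₃ : w ≠ z) :
    cyc x y z w = w := by
  simp [cyc, Equiv.swap_apply_of_ne_of_ne h₂ h₃, Equiv.swap_apply_of_ne_of_ne h₁ h₂]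

/-! ### Classes of diagrams modulo relations -/

section cls

variable {Γ : Skeleton} {H : Type} [Finite H] {i : ℕ}

/-- The class modulo relations of a chord diagram of degree `i`; it is `0` if the data do not
describe such a diagram. -/
noncomputable def cls (i : ℕ) (c : DiagramData Γ H) : GradedA Γ i :=
  if h : c.IsDiagram i then (relations Γ i).mkQ (gen c h) else 0

theorem cls_eq {c : DiagramData Γ H} (h : c.IsDiagram i) :
    cls i c = (relations Γ i).mkQ (gen c h) := dif_pos h

theorem mkQ_eq_zero_of_isRelation {x : FreeSpace Γ i} (h : IsRelation Γ i x) :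
    (relations Γ i).mkQ x = 0 := by
  rw [Submodule.mkQ_apply, Submodule.Quotient.mk_eq_zero]
  exact Submodule.subset_span h

theorem gen_eq_of_iso {H' : Type} [Finite H'] {c : DiagramData Γ H} {c' : DiagramData Γ H'}
    (f : DiagramData.Iso c c') (hc : c.IsDiagram i) (hc' : c'.IsDiagram i) :
    gen c hc = gen c' hc' := by
  rw [gen, gen]
  congr 1
  exact Quotient.sound ⟨f⟩

theorem cls_iso {H' : Type} [Finite H'] {c : DiagramData Γ H} {c' : DiagramData Γ H'}
    (f : DiagramData.Iso c c') : cls i c = cls i c' := by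
  by_cases h : c.IsDiagram i
  · rw [cls_eq h, cls_eq (f.isDiagram h), gen_eq_of_iso f]
  · rw [cls, cls, dif_neg h, dif_neg fun h' => h (f.symm.isDiagram h')]

/-- The AS relation, for a diagram `c'` that arises from `c` by reversing the vertex of `h`. -/
theorem cls_as {c c' : DiagramData Γ H} (hc : c.IsDiagram i) (hc' : c'.IsDiagram i) (h : H)
    (hh : c.rot h ≠ h) (hopp : c'.opp = c.opp) (hpos : c'.pos = c.pos)
    (h₀ : c'.rot h = c.rot (c.rot h)) (h₁ : c'.rot (c.rot h) = h)
    (h₂ : c'.rot (c.rot (c.rot h)) = c.rot h)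
    (h₃ : ∀ y, y ≠ h → y ≠ c.rot h → y ≠ c.rot (c.rot h) → c'.rot y = c.rot y) :
    cls i c + cls i c' = 0 := by
  have h3 := hc.rot_rot_rot h
  have n1 : c.rot (c.rot h) ≠ h := fun hn => hh (by rw [hn] at h3; exact h3)
  have n2 : c.rot (c.rot h) ≠ c.rot h := fun hn => hh (c.rot.injective hn)
  have key : c' = c.reattach (Equiv.swap h (c.rot h)) := by
    have hr : c'.rot = Equiv.swap h (c.rot h) * c.rot * (Equiv.swap h (c.rot h))⁻¹ := by
      rw [eq_mul_inv_iff_mul_eq]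
      ext y
      simp only [Equiv.Perm.coe_mul, Function.comp_apply]
      by_cases y0 : y = h
      · subst y0; rw [Equiv.swap_apply_left, Equiv.swap_apply_right, h₁]
      by_cases y1 : y = c.rot h
      · subst y1
        rw [Equiv.swap_apply_right, h₀, Equiv.swap_apply_of_ne_of_ne n1 n2]
      by_cases y2 : y = c.rot (c.rot h)
      · subst y2
        rw [Equiv.swap_apply_of_ne_of_ne n1 n2, h₂, h3, Equiv.swap_apply_left]
      · rw [Equiv.swap_apply_of_ne_of_ne y0 y1, h₃ y y0 y1 y2, Equiv.swap_apply_of_ne_of_ne]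
        · intro hy; apply y2; rw [hy.symm, hc.rot_rot_rot]
        · intro hy; exact y0 (c.rot.injective hy)
    cases c'
    simp only at hopp hpos hr
    subst hopp hpos hr
    rfl
  subst key
  rw [cls_eq hc, cls_eq hc', ← map_add]
  exact mkQ_eq_zero_of_isRelation (.as c h hh hc hc')

theorem cls_stu (c : DiagramData Γ H) (p : Γ.Edge → List H) (e : Γ.Edge) (l₁ l₂ : List H) (a b : H)
    (hT : (c.withPos (Function.update p e (l₁ ++ a :: b :: l₂))).IsDiagram i)
    (hU : (c.withPos (Function.update p e (l₁ ++ b :: a :: l₂))).IsDiagram i)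
    (hS : (c.joinLegs a b (Function.update (fun e' => (p e').map Sum.inl) e
      (l₁.map Sum.inl ++ Sum.inr true :: l₂.map Sum.inl))).IsDiagram i) :
    cls i (c.withPos (Function.update p e (l₁ ++ a :: b :: l₂))) -
      cls i (c.withPos (Function.update p e (l₁ ++ b :: a :: l₂))) =
    cls i (c.joinLegs a b (Function.update (fun e' => (p e').map Sum.inl) e
      (l₁.map Sum.inl ++ Sum.inr true :: l₂.map Sum.inl))) := by
  have h := mkQ_eq_zero_of_isRelation (.stu c p e l₁ l₂ a b hT hU hS)
  rw [map_sub, map_sub, sub_eq_zero] at h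
  rw [cls_eq hT, cls_eq hU, cls_eq hS, h]

end cls

/-! ### Joining a floating leg to an edge of the dashed graph -/

namespace DiagramData

variable {Γ : Skeleton} {H : Type} {i : ℕ}

/-- The inclusion of half-edges that puts the new half-edge `inr true` in the place of `x`. -/
noncomputable def relocate (x h : H) : H ⊕ Bool := if h = x then Sum.inr true else Sum.inl h

theorem relocate_self (x : H) : relocate x x = Sum.inr true := if_pos rfl

theorem relocate_of_ne {x h : H} (hx : h ≠ x) : relocate x h = Sum.inl h := if_neg hx

theorem relocate_injective (x : H) : Function.Injective (relocate x) := by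
  intro h h'
  unfold relocate
  split_ifs <;> simp_all

theorem relocate_eq_inl {x h y : H} : relocate x h = Sum.inl y ↔ h = y ∧ y ≠ x := by
  unfold relocate
  split_ifs with hx <;> simp_all
  rintro rfl; exact hx

theorem relocate_ne_false (x h : H) : relocate x h ≠ Sum.inr false := by
  unfold relocate
  split_ifs <;> simp

/-- Join the edge of the floating leg `l` to the edge of the half-edge `x`: the edge is cut next to
the vertex of `x`, where the new half-edge `inr true` takes the place of `x`, and `x`, `l` and the
other new half-edge `inr false` form a new internal vertex with cyclic order `(inr false, x, l)`. -/
noncomputable def attachTo (c : DiagramData Γ H) (l x : H) : DiagramData Γ (H ⊕ Bool) where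
  rot := Equiv.swap (Sum.inl x) (Sum.inr true) * Equiv.Perm.sumCongr c.rot 1 *
    Equiv.swap (Sum.inl x) (Sum.inr true) * cyc (Sum.inr false) (Sum.inl x) (Sum.inl l)
  opp := Equiv.Perm.sumCongr c.opp Equiv.boolNot
  pos e := (c.pos e).map (relocate x)

section

variable {c : DiagramData Γ H} {l x : H}

theorem attachTo_rot_false : (c.attachTo l x).rot (Sum.inr false) = Sum.inl x := by
  simp [attachTo, cyc_apply_left]

theorem attachTo_rot_self (hx : x ≠ l) (hl : c.rot l = l) :
    (c.attachTo l x).rot (Sum.inl x) = Sum.inl l := by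
  have h1 : (Sum.inl l : H ⊕ Bool) ≠ Sum.inl x := by simpa using hx.symm
  have h2 : (Sum.inl l : H ⊕ Bool) ≠ Sum.inr true := by simp
  simp [attachTo, cyc_apply_mid, hx, hl, Equiv.swap_apply_of_ne_of_ne h1 h2]

theorem attachTo_rot_leg : (c.attachTo l x).rot (Sum.inl l) = Sum.inr false := by
  have h1 : (Sum.inr false : H ⊕ Bool) ≠ Sum.inl x := by simp
  have h2 : (Sum.inr false : H ⊕ Bool) ≠ Sum.inr true := by simp
  simp [attachTo, cyc_apply_right, Equiv.swap_apply_of_ne_of_ne h1 h2]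

theorem attachTo_rot_relocate {h : H} (hh : h ≠ l) :
    (c.attachTo l x).rot (relocate x h) = relocate x (c.rot h) := by
  have key : ∀ y : H, Equiv.swap (Sum.inl x) (Sum.inr true) (Sum.inl y : H ⊕ Bool) =
      relocate x y := by
    intro y
    by_cases hy : y = x
    · subst hy; simp [relocate_self]
    · rw [relocate_of_ne hy, Equiv.swap_apply_of_ne_of_ne] <;> simp [hy]
  have h1 : cyc (Sum.inr false) (Sum.inl x) (Sum.inl l) (relocate x h) = relocate x h := by
    apply cyc_apply_of_ne
    · exact relocate_ne_false x h
    · rw [Ne, relocate_eq_inl]; simp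
    · rw [Ne, relocate_eq_inl]; exact fun h' => hh h'.1
  have h2 : Equiv.swap (Sum.inl x) (Sum.inr true) (relocate x h) = Sum.inl h := by
    rw [← key, Equiv.swap_apply_self]
  simp only [attachTo, Equiv.Perm.coe_mul, Function.comp_apply, h1, h2]
  simp [key]

/-- The half-edges at the new vertex, and those that are inherited from the given diagram. -/
theorem attachTo_cases (hx : x ≠ l) (z : H ⊕ Bool) :
    z = Sum.inr false ∨ z = Sum.inl x ∨ z = Sum.inl l ∨ ∃ h, h ≠ l ∧ z = relocate x h := by
  rcases z with h | (_ | _)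
  · by_cases hx : h = x
    · subst hx; simp
    by_cases hl : h = l
    · subst hl; simp
    · exact Or.inr (Or.inr (Or.inr ⟨h, hl, (relocate_of_ne hx).symm⟩))
  · simp
  · exact Or.inr (Or.inr (Or.inr ⟨x, hx, (relocate_self x).symm⟩))

end

theorem IsPartial.rot_leg {c : DiagramData Γ H} {l : H} (hc : c.IsPartial i {l}) :
    c.rot l = l := (hc.leg_iff l).2 (Or.inl rfl)

theorem IsPartial.rot_ne {c : DiagramData Γ H} {l h : H} (hc : c.IsPartial i {l}) (hh : h ≠ l) :
    c.rot h ≠ l := fun h' => hh (c.rot.injective (h'.trans hc.rot_leg.symm))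

theorem IsPartial.isDiagram_attachTo [Finite H] {c : DiagramData Γ H} {l x : H}
    (hc : c.IsPartial i {l}) (hx : x ≠ l) (hx' : x ≠ c.opp l) : (c.attachTo l x).IsDiagram i := by
  have hl := hc.rot_leg
  have r0 := attachTo_rot_false (c := c) (l := l) (x := x)
  have r1 := attachTo_rot_self hx hl
  have r2 := attachTo_rot_leg (c := c) (l := l) (x := x)
  have r3 := fun h (hh : h ≠ l) => attachTo_rot_relocate (c := c) (x := x) hh
  have hfix : ∀ z, (c.attachTo l x).rot z = z ↔ ∃ h, (h ≠ l ∧ c.rot h = h) ∧ relocate x h = z := by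
    intro z
    rcases attachTo_cases hx z with rfl | rfl | rfl | ⟨h, hh, rfl⟩
    · simp [r0, relocate_ne_false]
    · simp [r1, relocate_eq_inl, hx.symm]
    · simp [r2, relocate_eq_inl]
    · simp only [r3 h hh, (relocate_injective x).eq_iff]
      simp [hh]
  refine ⟨?_, ?_, ?_, ?_, ?_, ?_, ?_, ?_⟩
  · intro z
    rcases attachTo_cases hx z with rfl | rfl | rfl | ⟨h, hh, rfl⟩
    · rw [r0, r1, r2]
    · rw [r1, r2, r0]
    · rw [r2, r0, r1]
    · rw [r3 _ hh, r3 _ (hc.rot_ne hh), r3 _ (hc.rot_ne (hc.rot_ne hh)), hc.rot_rot_rot]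
  · rintro (h | b) <;> simp [attachTo, hc.opp_opp]
  · rintro (h | b) <;> simp [attachTo, hc.opp_ne]
  · intro z
    rcases attachTo_cases hx z with rfl | rfl | rfl | ⟨h, hh, rfl⟩
    · rw [r0]; simp [attachTo]
    · rw [r1]
      simp only [attachTo, Equiv.Perm.sumCongr_apply, Sum.map_inl, ne_eq, Sum.inl.injEq]
      intro h; apply hx'; rw [← h, hc.opp_opp]
    · rw [r2]; simp [attachTo]
    · rw [r3 _ hh]
      by_cases hhx : h = x
      · subst hhx
        rw [relocate_self]
        simpa [attachTo] using (relocate_ne_false h (c.rot h)).symm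
      · rw [relocate_of_ne hhx]
        simp only [attachTo, Equiv.Perm.sumCongr_apply, Sum.map_inl]
        intro h'
        exact hc.no_loop h (relocate_eq_inl.1 h'.symm).1.symm
  · intro z
    rw [hfix]
    simp only [attachTo, List.mem_map, hc.leg_iff, Set.mem_singleton_iff]
    constructor
    · rintro ⟨h, ⟨h1, h2 | ⟨e, he⟩⟩, h3⟩
      · exact (h1 h2).elim
      · exact ⟨e, h, he, h3⟩
    · rintro ⟨e, h, he, h3⟩
      refine ⟨h, ⟨?_, Or.inr ⟨e, he⟩⟩, h3⟩
      rintro rfl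
      exact hc.notMem h rfl e he
  · intro z e e' h h'
    obtain ⟨h, he, rfl⟩ := List.mem_map.1 h
    obtain ⟨h₂, he', h₃⟩ := List.mem_map.1 h'
    obtain rfl := relocate_injective x h₃
    exact hc.edge_unique _ _ _ he he'
  · intro e
    exact (hc.nodup e).map (relocate_injective x)
  · rw [← hc.degree]
    have e1 : {z // (c.attachTo l x).rot z = z} =
        {z // z ∈ relocate x '' ({h | c.rot h = h} \ {l})} := by
      congr 1
      ext z
      rw [hfix]
      simp [and_comm]
    have c1 : Nat.card {z // (c.attachTo l x).rot z = z} + 1 = Nat.card {h // c.rot h = h} := by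
      rw [e1]
      change Set.ncard _ + 1 = Set.ncard {h | c.rot h = h}
      rw [Set.ncard_image_of_injective _ (relocate_injective x)]
      exact Set.ncard_sdiff_singleton_add_one (s := {h | c.rot h = h}) hl
    have c2 : ∀ (K : Type) [Finite K] (r : Equiv.Perm K), Nat.card {z // r z = z} +
        Nat.card {z // r z ≠ z} = Nat.card K := by
      intro K _ r
      rw [← Nat.card_sum]
      exact Nat.card_congr (Equiv.sumCompl fun z => r z = z)
    have c3 := c2 _ c.rot
    have c4 := c2 _ (c.attachTo l x).rot
    rw [Nat.card_sum, Nat.card_eq_fintype_card (α := Bool), Fintype.card_bool] at c4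
    unfold numVertices
    omega

/-- The transport of the data of a diagram along a bijection of half-edges. -/
def map {H' : Type} (c : DiagramData Γ H) (s : H ≃ H') : DiagramData Γ H' where
  rot := s.permCongr c.rot
  opp := s.permCongr c.opp
  pos e := (c.pos e).map s

theorem map_rot {H' : Type} (c : DiagramData Γ H) (s : H ≃ H') (h : H) :
    (c.map s).rot (s h) = s (c.rot h) := by simp [map]

theorem map_opp {H' : Type} (c : DiagramData Γ H) (s : H ≃ H') (h : H) :
    (c.map s).opp (s h) = s (c.opp h) := by simp [map]

/-- Transport is a homeomorphism. -/
def isoMap {H' : Type} (c : DiagramData Γ H) (s : H ≃ H') : Iso c (c.map s) where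
  toEquiv := s
  rot_comm h := (map_rot c s h).symm
  opp_comm h := (map_opp c s h).symm
  pos_arc _ := rfl
  pos_circ _ := List.IsRotated.refl _

/-- The two half-edges of an edge of the dashed graph give opposite diagrams. -/
theorem cls_attachTo_opp [Finite H] {c : DiagramData Γ H} {l x : H}
    (hc : c.IsPartial i {l}) (hx : x ≠ l) (hx' : x ≠ c.opp l) :
    cls i (c.attachTo l x) + cls i (c.attachTo l (c.opp x)) = 0 := by
  set o := c.opp x with ho
  have hox : c.opp o = x := hc.opp_opp x
  have hne : o ≠ x := hc.opp_ne x
  have hol : o ≠ l := fun h => hx' (by rw [← h, hox])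
  have hol' : o ≠ c.opp l := fun h => hx (c.opp.injective h)
  have hl := hc.rot_leg
  -- both sides are the edge `{x, o}` with one new vertex; the 4-cycle `s` on the four halves of its two
  -- parts carries the first diagram to the second one with the new vertex reversed
  let s : Equiv.Perm (H ⊕ Bool) := Equiv.swap (Sum.inr true) (Sum.inl x) *
    Equiv.swap (Sum.inl x) (Sum.inr false) * Equiv.swap (Sum.inr false) (Sum.inl o)
  have s1 : s (Sum.inr false) = Sum.inl o := by
    simp [s, Equiv.swap_apply_def, hne]
  have s2 : s (Sum.inl x) = Sum.inr false := by
    simp [s, Equiv.swap_apply_def, hne.symm]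
  have s3 : ∀ h, s (relocate x h) = relocate o h := by
    intro h
    by_cases h1 : h = x
    · rw [h1, relocate_self, relocate_of_ne hne.symm]
      simp [s, Equiv.swap_apply_def]
    by_cases h2 : h = o
    · rw [h2, relocate_self, relocate_of_ne hne]
      simp [s]
    · rw [relocate_of_ne h1, relocate_of_ne h2]
      simp [s, Equiv.swap_apply_def, h1, h2]
  have s4 : s (Sum.inl l) = Sum.inl l := by
    rw [← relocate_of_ne hx.symm, s3, relocate_of_ne hol.symm]
    simp [relocate, hx.symm]
  have hD := hc.isDiagram_attachTo hx hx'
  have hD' := hc.isDiagram_attachTo hol hol'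
  rw [cls_iso (isoMap (c.attachTo l x) s), add_comm]
  have hrot := map_rot (c.attachTo l x) s
  have r0 := attachTo_rot_false (c := c) (l := l) (x := o)
  have r1 := attachTo_rot_self hol hl
  have t1 : ((c.attachTo l x).map s).rot (Sum.inl o) = Sum.inr false := by
    have := hrot (Sum.inr false)
    rwa [s1, attachTo_rot_false, s2] at this
  have t2 : ((c.attachTo l x).map s).rot (Sum.inr false) = Sum.inl l := by
    have := hrot (Sum.inl x)
    rwa [s2, attachTo_rot_self hx hl, s4] at this
  have t3 : ((c.attachTo l x).map s).rot (Sum.inl l) = Sum.inl o := by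
    have := hrot (Sum.inl l)
    rwa [s4, attachTo_rot_leg, s1] at this
  refine cls_as hD' ((isoMap _ s).isDiagram hD) (Sum.inr false) ?_ ?_ ?_ ?_ ?_ ?_ ?_
  · rw [r0]; simp
  · ext z
    obtain ⟨z, rfl⟩ := s.surjective z
    rw [map_opp]
    rcases attachTo_cases hx z with rfl | rfl | rfl | ⟨h, hh, rfl⟩
    · have e1 : (c.attachTo l x).opp (Sum.inr false) = relocate x x := by
        simp [attachTo, relocate_self]
      rw [e1, s1, s3, relocate_of_ne hne.symm]
      simp [attachTo, hox]
    · have e1 : (c.attachTo l x).opp (Sum.inl x) = relocate x o := by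
        simp [attachTo, ← ho, relocate_of_ne hne]
      rw [e1, s2, s3, relocate_self]
      simp [attachTo]
    · have e1 : (c.attachTo l x).opp (Sum.inl l) = relocate x (c.opp l) := by
        rw [relocate_of_ne (Ne.symm hx')]; simp [attachTo]
      rw [e1, s3, s4, relocate_of_ne (Ne.symm hol')]
      simp [attachTo]
    · by_cases h1 : h = x
      · subst h1
        rw [s3, relocate_of_ne hne.symm, relocate_self]
        simp only [attachTo, Equiv.Perm.sumCongr_apply, Sum.map_inl, Sum.map_inr,
          Equiv.boolNot_apply, Bool.not_true, s1, ho]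
      by_cases h2 : h = o
      · subst h2
        rw [s3, relocate_of_ne hne, relocate_self]
        simp only [attachTo, Equiv.Perm.sumCongr_apply, Sum.map_inl, Sum.map_inr,
          Equiv.boolNot_apply, Bool.not_true, hox, s2]
      · have h3 : c.opp h ≠ x := fun h' => h2 (by rw [← hc.opp_opp h, h'])
        have h4 : c.opp h ≠ o := fun h' => h1 (c.opp.injective h')
        have e1 : (c.attachTo l x).opp (relocate x h) = relocate x (c.opp h) := by
          rw [relocate_of_ne h1, relocate_of_ne h3]; simp [attachTo]
        rw [e1, s3, s3, relocate_of_ne h2, relocate_of_ne h4]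
        simp [attachTo]
  · funext e
    simp only [attachTo, map, List.map_map]
    congr 1
    funext h
    exact s3 h
  · rw [r0, r1, t2]
  · rw [r0, t1]
  · rw [r0, r1, t3]
  · intro y h0 h1 h2
    rw [r0] at h1 h2
    rw [r1] at h2
    rcases attachTo_cases hol y with rfl | rfl | rfl | ⟨h, hh, rfl⟩
    · exact (h0 rfl).elim
    · exact (h1 rfl).elim
    · exact (h2 rfl).elim
    · rw [attachTo_rot_relocate hh, ← s3, hrot, attachTo_rot_relocate hh, s3]

theorem IsPartial.pos_attachTo {c : DiagramData Γ H} {l x : H}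
    (hc : c.IsPartial i {l}) (hx : c.rot x ≠ x) (e : Γ.Edge) :
    (c.attachTo l x).pos e = (c.pos e).map Sum.inl := by
  refine List.map_congr_left fun h hh => relocate_of_ne ?_
  rintro rfl
  exact hx ((hc.leg_iff h).2 (Or.inr ⟨e, hh⟩))

/-- Moving the end of the floating leg from one half-edge to the next one at an internal vertex
is a move of the IHX relation. -/
theorem attachTo_rot_eq_reattach {c : DiagramData Γ H} {l y : H}
    (hc : c.IsPartial i {l}) (hy : c.rot y ≠ y) :
    c.attachTo l (c.rot y) = (c.attachTo l y).reattach
      (cyc (Sum.inl (c.rot y)) (Sum.inl (c.rot (c.rot y))) (Sum.inl y)) := by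
  have h3 := hc.rot_rot_rot y
  have n0 : c.rot y ≠ y := hy
  have n1 : c.rot (c.rot y) ≠ y := fun hn => hy (by rw [hn] at h3; exact h3)
  have n2 : c.rot (c.rot y) ≠ c.rot y := fun hn => hy (c.rot.injective hn)
  have hl := hc.rot_leg
  have l0 : y ≠ l := by rintro rfl; exact hy hl
  have l1 : c.rot y ≠ l := hc.rot_ne l0
  have l2 : c.rot (c.rot y) ≠ l := hc.rot_ne l1
  generalize hz : c.rot (c.rot y) = z at *
  generalize hx : c.rot y = x at *
  have hz' : c.rot x = z := hx ▸ hz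
  set s : Equiv.Perm (H ⊕ Bool) := cyc (Sum.inl x) (Sum.inl z) (Sum.inl y) with hs
  have s1 : s (Sum.inl x) = Sum.inl z := cyc_apply_left (by simp [n2.symm]) (by simp [n0])
  have s2 : s (Sum.inl z) = Sum.inl y := cyc_apply_mid (by simp [n0]) (by simp [n1])
  have s3 : s (Sum.inl y) = Sum.inl x := cyc_apply_right
  have s4 : ∀ b, s (Sum.inr b) = Sum.inr b := fun b => cyc_apply_of_ne (by simp) (by simp) (by simp)
  have s5 : ∀ h, h ≠ x → h ≠ y → h ≠ z → s (Sum.inl h) = Sum.inl h := fun h h1 h2 h3 =>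
    cyc_apply_of_ne (by simp [h1]) (by simp [h3]) (by simp [h2])
  have hr : (c.attachTo l x).rot = s * (c.attachTo l y).rot * s⁻¹ := by
    rw [eq_mul_inv_iff_mul_eq]
    refine Equiv.ext fun w => ?_
    simp only [Equiv.Perm.coe_mul, Function.comp_apply]
    rcases attachTo_cases l0 w with rfl | rfl | rfl | ⟨h, hh, rfl⟩
    · rw [s4, attachTo_rot_false, attachTo_rot_false, s3]
    · rw [s3, attachTo_rot_self l1 hl, attachTo_rot_self l0 hl,
        s5 l l1.symm l0.symm l2.symm]
    · rw [s5 l l1.symm l0.symm l2.symm, attachTo_rot_leg, attachTo_rot_leg, s4]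
    · rw [attachTo_rot_relocate hh]
      by_cases h1 : h = y
      · subst h1
        rw [relocate_self, s4, hx, relocate_of_ne n0, s1, ← relocate_self x,
          attachTo_rot_relocate l1, hz', relocate_of_ne n2]
      by_cases h2 : h = x
      · subst h2
        rw [relocate_of_ne n0, s1, hz', relocate_of_ne n1, s2, ← relocate_of_ne n2,
          attachTo_rot_relocate l2, h3, relocate_of_ne n0.symm]
      by_cases h4 : h = z
      · subst h4
        rw [relocate_of_ne n1, s2, h3, relocate_self, s4, ← relocate_of_ne n0.symm,
          attachTo_rot_relocate l0, hx, relocate_self]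
      · have h5 : c.rot h ≠ x := fun h' => h1 (c.rot.injective (h'.trans hx.symm))
        have h6 : c.rot h ≠ z := fun h' => h2 (c.rot.injective (h'.trans hz'.symm))
        have h7 : c.rot h ≠ y := fun h' => h4 (c.rot.injective (h'.trans h3.symm))
        rw [relocate_of_ne h1, s5 h h2 h1 h4, relocate_of_ne h7, s5 _ h5 h7 h6,
          ← relocate_of_ne h2, attachTo_rot_relocate hh, relocate_of_ne h5]
  have hp : (c.attachTo l x).pos = (c.attachTo l y).pos := by
    funext e
    rw [hc.pos_attachTo (x := x) (by rw [hz']; exact n2),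
      hc.pos_attachTo (x := y) (by rw [hx]; exact n0)]
  have ho : (c.attachTo l x).opp = (c.attachTo l y).opp := rfl
  generalize c.attachTo l x = d at *
  cases d
  simp only at hr hp ho
  subst hr hp ho
  rfl

theorem cyc_rotate {K : Type} {x y z : K} (h₁ : x ≠ y) (h₂ : y ≠ z) (h₃ : x ≠ z) :
    cyc x y z = cyc y z x := by
  ext w
  by_cases h1 : w = x
  · subst h1; rw [cyc_apply_left h₁ h₃, cyc_apply_right]
  by_cases h2 : w = y
  · subst h2; rw [cyc_apply_mid h₃ h₂, cyc_apply_left h₂ h₁.symm]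
  by_cases h3 : w = z
  · subst h3; rw [cyc_apply_right, cyc_apply_mid h₁.symm h₃.symm]
  · rw [cyc_apply_of_ne h1 h2 h3, cyc_apply_of_ne h2 h3 h1]

/-- The IHX relation: the sum over the three half-edges at an internal vertex vanishes. -/
theorem cls_attachTo_vertex [Finite H] {c : DiagramData Γ H} {l y : H}
    (hc : c.IsPartial i {l}) (hy : c.rot y ≠ y) (h₀ : y ≠ c.opp l) (h₁ : c.rot y ≠ c.opp l)
    (h₂ : c.rot (c.rot y) ≠ c.opp l) :
    cls i (c.attachTo l y) + cls i (c.attachTo l (c.rot y)) +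
      cls i (c.attachTo l (c.rot (c.rot y))) = 0 := by
  have h3 := hc.rot_rot_rot y
  have n1 : c.rot (c.rot y) ≠ y := fun hn => hy (by rw [hn] at h3; exact h3)
  have n2 : c.rot (c.rot y) ≠ c.rot y := fun hn => hy (c.rot.injective hn)
  have hl := hc.rot_leg
  have l0 : y ≠ l := by rintro rfl; exact hy hl
  have l1 : c.rot y ≠ l := hc.rot_ne l0
  have l2 : c.rot (c.rot y) ≠ l := hc.rot_ne l1
  have e1 := attachTo_rot_eq_reattach hc hy
  have e2 := attachTo_rot_eq_reattach hc n2
  rw [h3, cyc_rotate (by simp [n1]) (by simp [hy.symm]) (by simp [n2]),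
    cyc_rotate (by simp [hy.symm]) (by simp [n2.symm]) (by simp [n1.symm]), e1] at e2
  have e3 : c.attachTo l (c.rot (c.rot y)) = (c.attachTo l y).reattach
      (cyc (Sum.inl (c.rot y)) (Sum.inl (c.rot (c.rot y))) (Sum.inl y) *
       cyc (Sum.inl (c.rot y)) (Sum.inl (c.rot (c.rot y))) (Sum.inl y)) := by
    rw [e2]
    simp only [reattach, mul_inv_rev, mul_assoc]
  have d0 := hc.isDiagram_attachTo l0 h₀
  have d1 := hc.isDiagram_attachTo l1 h₁
  have d2 := hc.isDiagram_attachTo l2 h₂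
  rw [e1] at d1 ⊢
  rw [e3] at d2 ⊢
  have r0 : (c.attachTo l y).rot (Sum.inr true) = Sum.inl (c.rot y) := by
    rw [← relocate_self y, attachTo_rot_relocate l0, relocate_of_ne hy]
  have r1 : (c.attachTo l y).rot (Sum.inl (c.rot y)) = Sum.inl (c.rot (c.rot y)) := by
    rw [← relocate_of_ne hy, attachTo_rot_relocate l1, relocate_of_ne n1]
  rw [cls_eq d0, cls_eq d1, cls_eq d2, ← map_add, ← map_add]
  refine mkQ_eq_zero_of_isRelation
    (.ihx _ (Sum.inr true) (Sum.inr false) _ _ _ ?_ ?_ ?_ r0 r1 ?_ ?_ ?_ d0 d1 d2)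
  · simp [attachTo]
  · rw [r0]; simp
  · rw [attachTo_rot_false]; simp
  · rw [attachTo_rot_false]
  · simp
  · simp

/-- The sum over the other two half-edges at the internal vertex at which the edge of the floating leg
ends. The IHX relation does not apply, as its third diagram would contain a self-loop. -/
theorem cls_attachTo_vertex_opp [Finite H] {c : DiagramData Γ H} {l : H}
    (hc : c.IsPartial i {l}) (hy : c.rot (c.opp l) ≠ c.opp l) :
    cls i (c.attachTo l (c.rot (c.opp l))) +
      cls i (c.attachTo l (c.rot (c.rot (c.opp l)))) = 0 := by
  have h3 := hc.rot_rot_rot (c.opp l)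
  have n0 := hy
  have n1 : c.rot (c.rot (c.opp l)) ≠ c.opp l := fun hn => hy (by rw [hn] at h3; exact h3)
  have n2 : c.rot (c.rot (c.opp l)) ≠ c.rot (c.opp l) := fun hn => hy (c.rot.injective hn)
  have hl := hc.rot_leg
  have l0 : c.opp l ≠ l := hc.opp_ne l
  have l1 : c.rot (c.opp l) ≠ l := hc.rot_ne l0
  have l2 : c.rot (c.rot (c.opp l)) ≠ l := hc.rot_ne l1
  generalize hz : c.rot (c.rot (c.opp l)) = z at *
  generalize hx : c.rot (c.opp l) = x at *
  generalize ho : c.opp l = o at *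
  have hz' : c.rot x = z := hx ▸ hz
  have ho' : c.opp o = l := by rw [← ho, hc.opp_opp]
  have hD := hc.isDiagram_attachTo l1 (by rw [ho]; exact n0)
  have hD' := hc.isDiagram_attachTo l2 (by rw [ho]; exact n1)
  -- both diagrams have a double edge between the new vertex and the vertex of `o`; `s` interchanges
  -- these two vertices, which matches the diagrams up to reversing the vertex of `o`
  let s : Equiv.Perm (H ⊕ Bool) := Equiv.sumCongr (Equiv.swap l o) Equiv.boolNot
  have s1 : s (Sum.inl l) = Sum.inl o := by simp [s]
  have s2 : s (Sum.inl o) = Sum.inl l := by simp [s]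
  have s3 : s (Sum.inr true) = Sum.inr false := by simp [s]
  have s4 : s (Sum.inr false) = Sum.inr true := by simp [s]
  have s5 : ∀ h, h ≠ l → h ≠ o → s (Sum.inl h) = Sum.inl h := fun h h1 h2 => by
    simp [s, Equiv.swap_apply_of_ne_of_ne h1 h2]
  rw [cls_iso (isoMap (c.attachTo l x) s), add_comm]
  have hrot := map_rot (c.attachTo l x) s
  have ro : (c.attachTo l z).rot (Sum.inl o) = Sum.inl x := by
    rw [← relocate_of_ne n1.symm, attachTo_rot_relocate l0, hx, relocate_of_ne n2.symm]
  have rx : (c.attachTo l z).rot (Sum.inl x) = Sum.inr true := by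
    rw [← relocate_of_ne n2.symm, attachTo_rot_relocate l1, hz', relocate_self]
  have ro' : (c.attachTo l x).rot (Sum.inl o) = Sum.inr true := by
    rw [← relocate_of_ne n0.symm, attachTo_rot_relocate l0, hx, relocate_self]
  have rt' : (c.attachTo l x).rot (Sum.inr true) = Sum.inl z := by
    rw [← relocate_self x, attachTo_rot_relocate l1, hz', relocate_of_ne n2]
  have rz' : (c.attachTo l x).rot (Sum.inl z) = Sum.inl o := by
    rw [← relocate_of_ne n2, attachTo_rot_relocate l2, h3, relocate_of_ne n0.symm]
  have q : ∀ w w', (c.attachTo l x).rot w = w' →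
      ((c.attachTo l x).map s).rot (s w) = s w' := fun w w' h => by rw [hrot, h]
  have q1 := q _ _ ro'
  have q2 := q _ _ rt'
  have q3 := q _ _ rz'
  have q4 := q _ _ attachTo_rot_false
  have q5 := q _ _ (attachTo_rot_self l1 hl)
  have q6 := q _ _ attachTo_rot_leg
  simp only [s1, s2, s3, s4, s5 x l1 n0, s5 z l2 n1] at q1 q2 q3 q4 q5 q6
  refine cls_as hD' ((isoMap _ s).isDiagram hD) (Sum.inl o) ?_ ?_ ?_ ?_ ?_ ?_ ?_
  · rw [ro]; simpa using n0
  · refine Equiv.ext fun w => ?_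
    obtain ⟨w, rfl⟩ := s.surjective w
    rw [map_opp]
    rcases w with h | b
    · by_cases h1 : h = l
      · subst h1; simp [attachTo, s1, s2, ho, ho']
      by_cases h2 : h = o
      · subst h2; simp [attachTo, s1, s2, ho, ho']
      have h3 : c.opp h ≠ l := fun h' => h2 (by rw [← ho, ← h', hc.opp_opp])
      have h4 : c.opp h ≠ o := fun h' => h1 (c.opp.injective (h'.trans ho.symm))
      simp [attachTo, s5 h h1 h2, s5 _ h3 h4]
    · cases b <;> simp [attachTo, s3, s4]
  · funext e
    change ((c.attachTo l x).pos e).map s = _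
    rw [hc.pos_attachTo (by rw [hz']; exact n2), hc.pos_attachTo (by rw [h3]; exact n1.symm),
      List.map_map]
    refine List.map_congr_left fun h hh => s5 h ?_ ?_
    · rintro rfl; exact hc.notMem _ rfl e hh
    · rintro rfl
      exact n0 (hx ▸ (hc.leg_iff h).2 (Or.inr ⟨e, hh⟩))
  · rw [ro, rx, q6]
  · rw [ro, q5]
  · rw [ro, rx, q4]
  · intro w h0 h1 h2
    rw [ro] at h1 h2
    rw [rx] at h2
    rcases attachTo_cases l2 w with rfl | rfl | rfl | ⟨h, hh, rfl⟩
    · rw [q2, attachTo_rot_false]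
    · rw [q3, attachTo_rot_self l2 hl]
    · rw [q1, attachTo_rot_leg]
    · have k0 : h ≠ z := by rintro rfl; exact h2 (relocate_self _)
      rw [relocate_of_ne k0] at h0 h1
      have k1 : h ≠ o := fun h' => h0 (by rw [h'])
      have k2 : h ≠ x := fun h' => h1 (by rw [h'])
      have m1 : c.rot h ≠ x := fun h' => k1 (c.rot.injective (h'.trans hx.symm))
      have m2 : c.rot h ≠ z := fun h' => k2 (c.rot.injective (h'.trans hz'.symm))
      have m3 : c.rot h ≠ o := fun h' => k0 (c.rot.injective (h'.trans h3.symm))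
      rw [attachTo_rot_relocate hh, relocate_of_ne k0, relocate_of_ne m2]
      have := q (Sum.inl h) (Sum.inl (c.rot h)) (by
        rw [← relocate_of_ne k2, attachTo_rot_relocate hh, relocate_of_ne m1])
      rwa [s5 h hh k1, s5 _ (hc.rot_ne hh) m3] at this

/-- The diagram `S` of the STU relation is obtained by joining one leg to the edge of the other. -/
theorem joinLegs_eq_attachTo {c : DiagramData Γ H} {l h : H} (hc : c.IsPartial i {l})
    (e : Γ.Edge) (A B : List H) (he : c.pos e = A ++ h :: B) :
    c.joinLegs l h (Function.update (fun e' => (c.pos e').map Sum.inl) e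
      (A.map Sum.inl ++ Sum.inr true :: B.map Sum.inl)) = c.attachTo l h := by
  have hmem : h ∈ c.pos e := by rw [he]; simp
  have hr : c.rot h = h := (hc.leg_iff h).2 (Or.inr ⟨e, hmem⟩)
  have hnd := hc.nodup e
  rw [he, List.nodup_middle, List.nodup_cons] at hnd
  unfold joinLegs attachTo
  congr 1
  · congr 1
    rw [mul_assoc, ← Equiv.swap_inv, eq_comm, ← mul_assoc, mul_inv_eq_iff_eq_mul]
    refine Equiv.ext fun w => ?_
    simp only [Equiv.Perm.coe_mul, Function.comp_apply]
    rcases w with w | b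
    · by_cases hw : w = h
      · subst hw; simp [hr]
      · have : c.rot w ≠ h := fun h' => hw (c.rot.injective (h'.trans hr.symm))
        rw [Equiv.swap_apply_of_ne_of_ne (a := Sum.inl h) (x := Sum.inl w) (by simp [hw]) (by simp)]
        simp only [Equiv.Perm.sumCongr_apply, Sum.map_inl]
        rw [Equiv.swap_inv, Equiv.swap_apply_of_ne_of_ne (by simp [this]) (by simp)]
    · cases b
      · simp [Equiv.swap_apply_of_ne_of_ne]
      · simp [hr]
  · funext e'
    by_cases h' : e' = e
    · subst h'
      rw [Function.update_self, he]
      simp only [List.map_append, List.map_cons, relocate_self]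
      congr 1
      · exact List.map_congr_left fun y hy => (relocate_of_ne (by
          rintro rfl; exact hnd.1 (by simp [hy]))).symm
      · congr 1
        exact List.map_congr_left fun y hy => (relocate_of_ne (by
          rintro rfl; exact hnd.1 (by simp [hy]))).symm
    · rw [Function.update_of_ne h']
      exact List.map_congr_left fun y hy => (relocate_of_ne (by
          rintro rfl; exact h' (hc.edge_unique _ _ _ hy hmem))).symm

end DiagramData

/-! ### Moving a leg across everything -/

namespace DiagramData

variable {Γ : Skeleton} {H : Type} {i : ℕ} [Finite H]

/-- The class of the diagram in which the floating leg `l` is joined to the half-edge `x`. It is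
set to `0` for the two halves of the edge of `l`, where a self-loop would arise. -/
noncomputable def clsAttach (i : ℕ) (c : DiagramData Γ H) (l x : H) : GradedA Γ i :=
  if x = l ∨ x = c.opp l then 0 else cls i (c.attachTo l x)

theorem clsAttach_eq {c : DiagramData Γ H} {l x : H} (h₁ : x ≠ l) (h₂ : x ≠ c.opp l) :
    clsAttach i c l x = cls i (c.attachTo l x) := if_neg (by simp [h₁, h₂])

theorem clsAttach_add_opp {c : DiagramData Γ H} {l : H} (hc : c.IsPartial i {l}) (x : H) :
    clsAttach i c l x + clsAttach i c l (c.opp x) = 0 := by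
  have hoo := hc.opp_opp
  by_cases h : x = l ∨ x = c.opp l
  · have h' : c.opp x = l ∨ c.opp x = c.opp l := by
      rcases h with rfl | rfl
      · exact Or.inr rfl
      · exact Or.inl (hoo l)
    rw [clsAttach, if_pos h, clsAttach, if_pos h', add_zero]
  · push Not at h
    rw [clsAttach_eq h.1 h.2, clsAttach_eq, cls_attachTo_opp hc h.1 h.2]
    · intro h'; exact h.2 (by rw [← h', hoo])
    · intro h'; exact h.1 (c.opp.injective h')

/-- The sum over the half-edges at an internal vertex vanishes, including the vertex at which the edge
of `l` ends. -/
theorem clsAttach_vertex {c : DiagramData Γ H} {l y : H} (hc : c.IsPartial i {l})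
    (hy : c.rot y ≠ y) : clsAttach i c l y + clsAttach i c l (c.rot y) +
      clsAttach i c l (c.rot (c.rot y)) = 0 := by
  have h3 := hc.rot_rot_rot y
  have n1 : c.rot (c.rot y) ≠ y := fun hn => hy (by rw [hn] at h3; exact h3)
  have n2 : c.rot (c.rot y) ≠ c.rot y := fun hn => hy (c.rot.injective hn)
  have l0 : y ≠ l := by rintro rfl; exact hy hc.rot_leg
  have l1 : c.rot y ≠ l := hc.rot_ne l0
  have l2 : c.rot (c.rot y) ≠ l := hc.rot_ne l1
  have key : ∀ o, o = c.opp l → c.rot o ≠ o → c.rot o ≠ l → c.rot (c.rot o) ≠ l →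
      clsAttach i c l o = 0 ∧
      clsAttach i c l (c.rot o) + clsAttach i c l (c.rot (c.rot o)) = 0 := by
    rintro o rfl ho m1 m2
    have h3 := hc.rot_rot_rot (c.opp l)
    have k1 : c.rot (c.rot (c.opp l)) ≠ c.opp l := fun hn => ho (by rw [hn] at h3; exact h3)
    refine ⟨if_pos (Or.inr rfl), ?_⟩
    rw [clsAttach_eq m1 ho, clsAttach_eq m2 k1, cls_attachTo_vertex_opp hc ho]
  by_cases h0 : y = c.opp l
  · obtain ⟨k1, k2⟩ := key _ h0 hy l1 l2
    rw [k1, zero_add, k2]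
  by_cases h1 : c.rot y = c.opp l
  · obtain ⟨k1, k2⟩ := key _ h1 n2 l2 (by rw [h3]; exact l0)
    rw [h3] at k2
    rw [k1, add_zero, add_comm, k2]
  by_cases h2 : c.rot (c.rot y) = c.opp l
  · obtain ⟨k1, k2⟩ := key _ h2 (by rw [h3]; exact n1.symm) (by rw [h3]; exact l0)
      (by rw [h3]; exact l1)
    rw [h3] at k2
    rw [k1, add_zero, k2]
  · rw [clsAttach_eq l0 h0, clsAttach_eq l1 h1, clsAttach_eq l2 h2,
      cls_attachTo_vertex hc hy h0 h1 h2]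

/-- The sum over all ends of the dashed edges at the skeleton vanishes: the sum over all half-edges
is zero by AS, and the sum over the half-edges at internal vertices by IHX. -/
theorem sum_clsAttach_legs [Fintype H] {c : DiagramData Γ H} {l : H} (hc : c.IsPartial i {l}) :
    ∑ h, (if c.rot h = h then clsAttach i c l h else 0) = 0 := by
  have h1 : ∑ h, clsAttach i c l h = 0 := by
    have e := Equiv.sum_comp c.opp (clsAttach i c l)
    have h2 : ∑ h, (clsAttach i c l h + clsAttach i c l (c.opp h)) = 0 :=
      Finset.sum_eq_zero fun h _ => clsAttach_add_opp hc h
    rw [Finset.sum_add_distrib, e, ← two_smul ℚ] at h2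
    exact (smul_eq_zero.1 h2).resolve_left two_ne_zero
  have h2 : ∑ h, (if c.rot h = h then 0 else clsAttach i c l h) = 0 := by
    set F : H → GradedA Γ i := fun h => if c.rot h = h then 0 else clsAttach i c l h with hF
    have e := Equiv.sum_comp c.rot F
    have e' := Equiv.sum_comp (c.rot.trans c.rot) F
    have h3 : ∑ h, (F h + F (c.rot h) + F (c.rot (c.rot h))) = 0 := by
      refine Finset.sum_eq_zero fun h _ => ?_
      by_cases hh : c.rot h = h
      · simp [hF, hh]
      · simp only [hF, c.rot.injective.eq_iff, hh, if_false]
        exact clsAttach_vertex hc hh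
    simp only [Equiv.trans_apply] at e'
    rw [Finset.sum_add_distrib, Finset.sum_add_distrib, e, e'] at h3
    have h4 : (3 : ℚ) • ∑ h, F h = 0 := by
      rw [← h3]
      module
    exact (smul_eq_zero.1 h4).resolve_left three_ne_zero
  have h3 : ∑ h, clsAttach i c l h = ∑ h, (if c.rot h = h then clsAttach i c l h else 0) +
      ∑ h, (if c.rot h = h then 0 else clsAttach i c l h) := by
    rw [← Finset.sum_add_distrib]
    refine Finset.sum_congr rfl fun h _ => ?_
    split_ifs <;> simp
  rwa [h1, h2, add_zero, eq_comm] at h3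

/-- Moving the leg `l` across a neighbouring leg `h`. -/
theorem cls_cross {c : DiagramData Γ H} {l h : H} (hc : c.IsPartial i {l})
    (e : Γ.Edge) (A B : List H) (he : c.pos e = A ++ h :: B) :
    cls i (c.withPos (Function.update c.pos e (A ++ l :: h :: B))) -
      cls i (c.withPos (Function.update c.pos e (A ++ h :: l :: B))) = clsAttach i c l h := by
  have hmem : h ∈ c.pos e := by rw [he]; simp
  have hr : c.rot h = h := (hc.leg_iff h).2 (Or.inr ⟨e, hmem⟩)
  have hl : ∀ e, l ∉ c.pos e := hc.notMem l rfl
  have hhl : h ≠ l := by rintro rfl; exact hl _ hmem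
  have hT := hc.isDiagram_update e (L := A ++ l :: h :: B) (by rw [he]; exact List.perm_middle)
  have hU := hc.isDiagram_update e (L := A ++ h :: l :: B) (by
    rw [he, List.append_cons, List.append_cons A h B]; exact List.perm_middle)
  by_cases ho : h = c.opp l
  -- the two legs are the ends of one chord, and interchanging them is a homeomorphism
  · have hnd := hc.nodup e
    rw [he, List.nodup_middle, List.nodup_cons] at hnd
    rw [clsAttach, if_pos (Or.inr ho), sub_eq_zero]
    have hoo := hc.opp_opp l
    have hs : ∀ y, y ≠ l → y ≠ h → Equiv.swap l h y = y := fun y h1 h2 =>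
      Equiv.swap_apply_of_ne_of_ne h1 h2
    have hlist : ∀ L : List H, l ∉ L → h ∉ L → L.map (Equiv.swap l h) = L := by
      intro L h1 h2
      conv_rhs => rw [← List.map_id L]
      refine List.map_congr_left fun y hy => hs y ?_ ?_
      · rintro rfl; exact h1 hy
      · rintro rfl; exact h2 hy
    have hpos : ∀ e', Function.update c.pos e (A ++ h :: l :: B) e' =
        (Function.update c.pos e (A ++ l :: h :: B) e').map (Equiv.swap l h) := by
      intro e'
      by_cases h' : e' = e
      · subst h'
        have hlA := hl e'
        rw [he] at hlA
        simp only [List.mem_append, List.mem_cons, not_or] at hlA hnd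
        simp [Function.update_self, hlist A hlA.1 hnd.1.1, hlist B hlA.2.2 hnd.1.2]
      · rw [Function.update_of_ne h', Function.update_of_ne h', hlist _ (hl _)]
        intro hh; exact h' (hc.edge_unique _ _ _ hh hmem)
    refine cls_iso ⟨Equiv.swap l h, fun y => ?_, fun y => ?_, fun a => hpos _, fun o => ?_⟩
    · change Equiv.swap l h (c.rot y) = c.rot (Equiv.swap l h y)
      by_cases h1 : y = l
      · subst h1; simp [hr, hc.rot_leg]
      by_cases h2 : y = h
      · subst h2; simp [hr, hc.rot_leg]
      rw [hs y h1 h2, hs _ (hc.rot_ne h1)]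
      intro h'; exact h2 (c.rot.injective (h'.trans hr.symm))
    · change Equiv.swap l h (c.opp y) = c.opp (Equiv.swap l h y)
      have hoh : c.opp h = l := by rw [ho, hoo]
      by_cases h1 : y = l
      · subst h1; simp [← ho, hoh]
      by_cases h2 : y = h
      · subst h2; simp [← ho, hoh]
      rw [hs y h1 h2, hs]
      · intro h'; exact h2 (c.opp.injective (h'.trans hoh.symm))
      · intro h'; exact h1 (c.opp.injective (h'.trans ho))
    · change List.IsRotated _ (Function.update c.pos e (A ++ h :: l :: B) _)
      rw [hpos]; exact List.IsRotated.refl _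
  · have hS := hc.isDiagram_attachTo hhl ho
    rw [clsAttach_eq hhl ho, ← joinLegs_eq_attachTo hc e A B he]
    rw [← joinLegs_eq_attachTo hc e A B he] at hS
    exact cls_stu c c.pos e A B l h hT hU hS

/-- Moving the leg `l` across the neighbouring legs in `B`. -/
theorem cls_move {c : DiagramData Γ H} {l : H} (hc : c.IsPartial i {l}) (e : Γ.Edge)
    (B : List H) : ∀ (A C : List H), c.pos e = A ++ B ++ C →
    cls i (c.withPos (Function.update c.pos e (A ++ l :: (B ++ C)))) -
      cls i (c.withPos (Function.update c.pos e (A ++ B ++ l :: C))) =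
      (B.map (clsAttach i c l)).sum := by
  induction B with
  | nil => intro A C _; simp
  | cons h B ih =>
    intro A C he
    have h1 := cls_cross hc e A (B ++ C) (by simpa using he)
    have h2 := ih (A ++ [h]) C (by simpa using he)
    simp only [List.append_assoc, List.cons_append, List.nil_append] at h2
    simp only [List.append_assoc, List.cons_append, List.map_cons, List.sum_cons]
    rw [← h1, ← h2]
    abel

/-- Moving a leg across all other legs on the skeleton does not change the class of a diagram: the
difference is the sum of all diagrams in which the leg ends on an end of a dashed edge. -/
theorem sum_cls_start_sub_finish [Fintype Γ.Edge] {c : DiagramData Γ H} {l : H}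
    (hc : c.IsPartial i {l}) :
    ∑ e, (cls i (c.withPos (Function.update c.pos e (l :: c.pos e))) -
      cls i (c.withPos (Function.update c.pos e (c.pos e ++ [l])))) = 0 := by
  let _ := Fintype.ofFinite H
  rw [← sum_clsAttach_legs hc]
  have h1 : ∀ e, cls i (c.withPos (Function.update c.pos e (l :: c.pos e))) -
      cls i (c.withPos (Function.update c.pos e (c.pos e ++ [l]))) =
      ∑ h, if h ∈ c.pos e then clsAttach i c l h else 0 := by
    intro e
    have := cls_move hc e (c.pos e) [] [] (by simp)
    simp only [List.nil_append, List.append_nil] at this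
    rw [this, ← List.sum_toFinset _ (hc.nodup e), ← Finset.sum_filter]
    refine Finset.sum_congr ?_ fun _ _ => rfl
    ext; simp
  rw [Finset.sum_congr rfl fun e _ => h1 e, Finset.sum_comm]
  refine Finset.sum_congr rfl fun h _ => ?_
  by_cases hh : ∃ e, h ∈ c.pos e
  · obtain ⟨e, he⟩ := hh
    rw [if_pos ((hc.leg_iff h).2 (Or.inr ⟨e, he⟩)), Finset.sum_eq_single e, if_pos he]
    · intro e' _ h'
      exact if_neg fun h'' => h' (hc.edge_unique _ _ _ h'' he)
    · simp
  · rw [Finset.sum_eq_zero]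
    · split_ifs with hr
      · rcases (hc.leg_iff h).1 hr with h' | h'
        · rw [clsAttach, if_pos (Or.inl (Set.mem_singleton_iff.1 h'))]
        · exact (hh h').elim
      · rfl
    · intro e _
      exact if_neg fun h' => hh ⟨e, h'⟩

end DiagramData

/-! ### Pulling back diagrams along a system of paths -/

/-- A family of paths in `Γ` indexed by `X`. The set `Q` consists of the passages of the paths
through edges of `Γ`: the passage `q` of the path `owner q` runs through the edge `edge q`, along its
orientation if `forward q`, and against it otherwise. That consecutive passages meet in `Γ` is not
part of the structure. -/
structure PathSystem (Γ : Skeleton) (X : Type) where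
  Q : Type
  finite : Finite Q
  edge : Q → Γ.Edge
  forward : Q → Bool
  owner : Q → X
  path : X → List Q
  mem_path : ∀ q x, q ∈ path x ↔ owner q = x
  nodup : ∀ x, (path x).Nodup

namespace PathSystem

variable {Γ : Skeleton} {X : Type} (P : PathSystem Γ X) {H : Type} {i : ℕ}

instance : Finite P.Q := P.finite

/-- The legs on the edge of the passage `q` that are lifted to `q`, in the order in which the path
meets them. -/
noncomputable def block (p : Γ.Edge → List H) (σ : H → Option P.Q) (q : P.Q) : List H :=
  if P.forward q then (p (P.edge q)).filter (fun h => σ h = some q)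
  else ((p (P.edge q)).filter (fun h => σ h = some q)).reverse

/-- The positions on the arrows of the legs that are lifted to the passages given by `σ`. -/
noncomputable def liftPos (p : Γ.Edge → List H) (σ : H → Option P.Q) :
    (arrows X).Edge → List H :=
  Sum.elim (fun x => (P.path x).flatMap (P.block p σ)) (fun _ => [])

/-- The lift of a diagram from `Γ` to the arrows. -/
noncomputable def lift (c : DiagramData Γ H) (σ : H → Option P.Q) : DiagramData (arrows X) H where
  rot := c.rot
  opp := c.opp
  pos := P.liftPos c.pos σ

/-- `σ` assigns to every leg on the skeleton a passage through its edge, and `none` to the half-edges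
that are not glued to the skeleton; nothing is required on `F`. -/
def IsLift (p : Γ.Edge → List H) (F : Set H) (σ : H → Option P.Q) : Prop :=
  ∀ h ∉ F, (σ h = none → ∀ e, h ∉ p e) ∧ ∀ q, σ h = some q → h ∈ p (P.edge q)

variable {P}

theorem mem_block {p : Γ.Edge → List H} {σ : H → Option P.Q} {q : P.Q} {h : H} :
    h ∈ P.block p σ q ↔ h ∈ p (P.edge q) ∧ σ h = some q := by
  unfold block
  split_ifs <;> simp

theorem mem_liftPos {p : Γ.Edge → List H} {σ : H → Option P.Q} {x : X} {h : H} :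
    h ∈ P.liftPos p σ (Sum.inl x) ↔
      ∃ q, P.owner q = x ∧ h ∈ p (P.edge q) ∧ σ h = some q := by
  change h ∈ (P.path x).flatMap (P.block p σ) ↔ _
  simp only [List.mem_flatMap, P.mem_path, mem_block]

theorem isPartial_lift {c : DiagramData Γ H} {F : Set H} (hc : c.IsPartial i F)
    {σ : H → Option P.Q} (hσ : P.IsLift c.pos F σ) : (P.lift c σ).IsPartial i F where
  rot_rot_rot := hc.rot_rot_rot
  opp_opp := hc.opp_opp
  opp_ne := hc.opp_ne
  no_loop := hc.no_loop
  leg_iff h := by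
    refine (hc.leg_iff h).trans ?_
    by_cases hF : h ∈ F
    · simp [hF]
    simp only [hF, false_or]
    constructor
    · rintro ⟨e, he⟩
      rcases hs : σ h with _ | q
      · exact ((hσ h hF).1 hs e he).elim
      · exact ⟨Sum.inl (P.owner q), mem_liftPos.2 ⟨q, rfl, (hσ h hF).2 q hs, hs⟩⟩
    · rintro ⟨x | o, hx⟩
      · obtain ⟨q, -, hq, -⟩ := mem_liftPos.1 hx
        exact ⟨_, hq⟩
      · exact o.elim
  notMem h hF := by
    rintro (x | o) hx
    · obtain ⟨q, -, hq, -⟩ := mem_liftPos.1 hx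
      exact hc.notMem h hF _ hq
    · exact o.elim
  edge_unique h := by
    rintro (x | o) (y | o') hx hy
    · obtain ⟨q, rfl, -, hq⟩ := mem_liftPos.1 hx
      obtain ⟨q', rfl, -, hq'⟩ := mem_liftPos.1 hy
      rw [hq, Option.some_inj] at hq'
      rw [hq']
    · exact o'.elim
    · exact o.elim
    · exact o.elim
  nodup := by
    rintro (x | o)
    · refine List.nodup_flatMap.2 ⟨fun q _ => ?_, (P.nodup x).imp fun {q q'} hqq h hq hq' => ?_⟩
      · unfold block
        split_ifs
        · exact (hc.nodup _).filter _
        · exact List.nodup_reverse.2 ((hc.nodup _).filter _)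
      · have h1 := (mem_block.1 hq).2
        rw [(mem_block.1 hq').2, Option.some_inj] at h1
        exact hqq h1.symm
    · exact o.elim
  degree := hc.degree

theorem isDiagram_lift {c : DiagramData Γ H} (hc : c.IsDiagram i)
    {σ : H → Option P.Q} (hσ : P.IsLift c.pos ∅ σ) : (P.lift c σ).IsDiagram i :=
  DiagramData.isPartial_empty.1 (isPartial_lift (DiagramData.isPartial_empty.2 hc) hσ)

variable (P)

/-- The sign of a passage: a passage against the orientation of its edge counts negatively. -/
def sign (q : P.Q) : ℚ := if P.forward q then 1 else -1

theorem sign_mul_sign (q : P.Q) : P.sign q * P.sign q = 1 := by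
  unfold sign; split_ifs <;> norm_num

/-- The sign of a lift, the product of the signs of all passages to which legs are lifted. -/
noncomputable def coeff (σ : H → Option P.Q) : ℚ := ∏ᶠ h, (σ h).elim 1 P.sign

/-- The pullback of a diagram: the signed sum of all its lifts, modulo relations. -/
noncomputable def pullback [Finite H] (i : ℕ) (c : DiagramData Γ H) : GradedA (arrows X) i :=
  ∑ᶠ σ : H → Option P.Q, if P.IsLift c.pos ∅ σ then P.coeff σ • cls i (P.lift c σ) else 0

variable {P}

theorem coeff_eq [Fintype H] (σ : H → Option P.Q) :
    P.coeff σ = ∏ h, (σ h).elim 1 P.sign := finprod_eq_prod_of_fintype _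

theorem pullback_eq [Finite H] [Fintype (H → Option P.Q)] (c : DiagramData Γ H) :
    P.pullback i c =
      ∑ σ, if P.IsLift c.pos ∅ σ then P.coeff σ • cls i (P.lift c σ) else 0 :=
  finsum_eq_sum_of_fintype _

theorem pullback_map [Finite H] {H' : Type} [Finite H'] (c : DiagramData Γ H) (s : H ≃ H') :
    P.pullback i (c.map s) = P.pullback i c := by
  unfold pullback
  rw [← finsum_comp_equiv (s.arrowCongr (Equiv.refl (Option P.Q)))]
  refine finsum_congr fun σ => ?_
  have hσ : ∀ h, s.arrowCongr (Equiv.refl (Option P.Q)) σ (s h) = σ h := by simp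
  generalize s.arrowCongr (Equiv.refl (Option P.Q)) σ = τ at hσ
  have h1 : P.IsLift (c.map s).pos ∅ τ ↔ P.IsLift c.pos ∅ σ := by
    simp only [IsLift, s.surjective.forall, hσ, DiagramData.map,
      List.mem_map_of_injective s.injective, Set.mem_empty_iff_false, not_false_eq_true]
  have h2 : P.coeff τ = P.coeff σ := by
    unfold coeff
    rw [← finprod_comp_equiv s]
    simp only [hσ]
  have h3 : P.lift (c.map s) τ = (P.lift c σ).map s := by
    have hb : ∀ q, P.block (c.map s).pos τ q = (P.block c.pos σ q).map s := by
      intro q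
      unfold block
      have : ((c.map s).pos (P.edge q)).filter (fun h => τ h = some q) =
          ((c.pos (P.edge q)).filter (fun h => σ h = some q)).map s := by
        rw [DiagramData.map, List.filter_map]
        congr 1
        exact List.filter_congr fun h _ => by simp [hσ]
      rw [this]
      split_ifs <;> simp
    unfold lift
    simp only [DiagramData.map, DiagramData.mk.injEq, true_and]
    funext x
    rcases x with x | o
    · simp only [liftPos, Sum.elim_inl, List.map_flatMap]
      exact List.flatMap_congr fun q _ => hb q
    · exact o.elim
  simp only [h1, h2, h3, ← cls_iso (DiagramData.isoMap (P.lift c σ) s)]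

/-- The pullback respects the AS relation, which holds for every lift. -/
theorem pullback_as [Finite H] {c : DiagramData Γ H} {h : H} (hh : c.rot h ≠ h)
    (h₀ : c.IsDiagram i) (h₁ : (c.reattach (Equiv.swap h (c.rot h))).IsDiagram i) :
    P.pullback i c + P.pullback i (c.reattach (Equiv.swap h (c.rot h))) = 0 := by
  let _ := Fintype.ofFinite (H → Option P.Q)
  rw [pullback_eq, pullback_eq, ← Finset.sum_add_distrib]
  refine Finset.sum_eq_zero fun σ _ => ?_
  by_cases hσ : P.IsLift c.pos ∅ σ
  · have hσ' : P.IsLift (c.reattach (Equiv.swap h (c.rot h))).pos ∅ σ := hσ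
    rw [if_pos hσ, if_pos hσ', ← smul_add, cls_eq (isDiagram_lift h₀ hσ),
      cls_eq (isDiagram_lift h₁ hσ'), ← map_add]
    refine smul_eq_zero_of_right _ (mkQ_eq_zero_of_isRelation ?_)
    exact .as (P.lift c σ) h hh (isDiagram_lift h₀ hσ) (isDiagram_lift h₁ hσ')
  · rw [if_neg hσ, if_neg (show ¬ P.IsLift (c.reattach _).pos ∅ σ from hσ), add_zero]

/-- The pullback respects the IHX relation, which holds for every lift. -/
theorem pullback_ihx [Finite H] {c : DiagramData Γ H} {h k a b d : H}
    (hk : c.opp h = k) (hh : c.rot h ≠ h) (hkk : c.rot k ≠ k)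
    (ha : c.rot h = a) (hb : c.rot a = b) (hd : c.rot k = d) (hka : k ≠ a) (hkb : k ≠ b)
    (h₀ : c.IsDiagram i) (h₁ : (c.reattach (cyc a b d)).IsDiagram i)
    (h₂ : (c.reattach (cyc a b d * cyc a b d)).IsDiagram i) :
    P.pullback i c + P.pullback i (c.reattach (cyc a b d)) +
      P.pullback i (c.reattach (cyc a b d * cyc a b d)) = 0 := by
  let _ := Fintype.ofFinite (H → Option P.Q)
  rw [pullback_eq, pullback_eq, pullback_eq, ← Finset.sum_add_distrib, ← Finset.sum_add_distrib]
  refine Finset.sum_eq_zero fun σ _ => ?_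
  by_cases hσ : P.IsLift c.pos ∅ σ
  · have hσ' : ∀ s, P.IsLift (c.reattach s).pos ∅ σ := fun _ => hσ
    rw [if_pos hσ, if_pos (hσ' _), if_pos (hσ' _), ← smul_add, ← smul_add,
      cls_eq (isDiagram_lift h₀ hσ), cls_eq (isDiagram_lift h₁ (hσ' _)),
      cls_eq (isDiagram_lift h₂ (hσ' _)), ← map_add, ← map_add]
    refine smul_eq_zero_of_right _ (mkQ_eq_zero_of_isRelation ?_)
    exact .ihx (P.lift c σ) h k a b d hk hh hkk ha hb hd hka hkb (isDiagram_lift h₀ hσ)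
      (isDiagram_lift h₁ (hσ' _)) (isDiagram_lift h₂ (hσ' _))
  · have hσ' : ∀ s, ¬ P.IsLift (c.reattach s).pos ∅ σ := fun _ => hσ
    rw [if_neg hσ, if_neg (hσ' _), if_neg (hσ' _), add_zero, add_zero]

end PathSystem

/-! ### The pullback and the STU relation -/

namespace PathSystem

variable {Γ : Skeleton} {X : Type} {P : PathSystem Γ X} {H : Type} {i : ℕ}

theorem exists_path_eq (q : P.Q) :
    ∃ A B, P.path (P.owner q) = A ++ q :: B ∧ q ∉ A ∧ q ∉ B := by
  have h : q ∈ P.path (P.owner q) := (P.mem_path _ _).2 rfl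
  obtain ⟨A, B, hAB⟩ := List.append_of_mem h
  have hn := P.nodup (P.owner q)
  rw [hAB, List.nodup_middle, List.nodup_cons, List.mem_append, not_or] at hn
  exact ⟨A, B, hAB, hn.1.1, hn.1.2⟩

theorem liftPos_eq_of_block {H' : Type} {p : Γ.Edge → List H} {p' : Γ.Edge → List H'}
    {σ : H → Option P.Q} {σ' : H' → Option P.Q} {f : List H → List H'} (x : X)
    (hf : ∀ L : List P.Q, f (L.flatMap (P.block p σ)) = L.flatMap fun q => f (P.block p σ q))
    (h : ∀ q, P.owner q = x → P.block p' σ' q = f (P.block p σ q)) :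
    P.liftPos p' σ' (Sum.inl x) = f (P.liftPos p σ (Sum.inl x)) := by
  change (P.path x).flatMap _ = f ((P.path x).flatMap _)
  rw [hf]
  exact List.flatMap_congr fun q hq => h q ((P.mem_path _ _).1 hq)

/-- The assignment of passages to the half-edges of the diagram `S` of the STU relation, given that
of the diagram `T` in which `a` and `b` are lifted to the same passage. -/
noncomputable def joinLift (a b : H) (σ : H → Option P.Q) : H ⊕ Bool → Option P.Q :=
  Sum.elim (fun h => if h = a ∨ h = b then none else σ h) (fun t => if t then σ a else none)

/-- A lift of the STU relation in which both legs are lifted to the same passage `q`. On the arrow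
their order is reversed if `q` runs against the orientation of its edge, which gives the sign. -/
theorem cls_lift_cross [Finite H] {c : DiagramData Γ H} {p : Γ.Edge → List H} {e : Γ.Edge}
    {l₁ l₂ : List H} {a b : H}
    (hT : (c.withPos (Function.update p e (l₁ ++ a :: b :: l₂))).IsDiagram i)
    (hU : (c.withPos (Function.update p e (l₁ ++ b :: a :: l₂))).IsDiagram i)
    (hS : (c.joinLegs a b (Function.update (fun e' => (p e').map Sum.inl) e
      (l₁.map Sum.inl ++ Sum.inr true :: l₂.map Sum.inl))).IsDiagram i)
    {σ : H → Option P.Q} {q : P.Q}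
    (hσT : P.IsLift (Function.update p e (l₁ ++ a :: b :: l₂)) ∅ σ)
    (hσU : P.IsLift (Function.update p e (l₁ ++ b :: a :: l₂)) ∅ σ)
    (hσS : P.IsLift (Function.update (fun e' => (p e').map Sum.inl) e
      (l₁.map Sum.inl ++ Sum.inr true :: l₂.map Sum.inl)) ∅ (joinLift a b σ))
    (ha : σ a = some q) (hb : σ b = some q) (hab : a ∉ l₁ ++ l₂ ∧ b ∉ l₁ ++ l₂)
    (habp : ∀ e', e' ≠ e → a ∉ p e' ∧ b ∉ p e') (hq : P.edge q = e) :
    cls i (P.lift (c.withPos (Function.update p e (l₁ ++ a :: b :: l₂))) σ) -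
      cls i (P.lift (c.withPos (Function.update p e (l₁ ++ b :: a :: l₂))) σ) =
    P.sign q • cls i (P.lift (c.joinLegs a b (Function.update (fun e' => (p e').map Sum.inl) e
      (l₁.map Sum.inl ++ Sum.inr true :: l₂.map Sum.inl))) (joinLift a b σ)) := by
  have hT' := isDiagram_lift hT hσT
  have hU' := isDiagram_lift hU hσU
  have hS' := isDiagram_lift hS hσS
  simp only [List.mem_append, not_or] at hab
  set pT := Function.update p e (l₁ ++ a :: b :: l₂) with hpT
  set pU := Function.update p e (l₁ ++ b :: a :: l₂) with hpU
  set pS := Function.update (fun e' => (p e').map Sum.inl) e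
      (l₁.map Sum.inl ++ Sum.inr true :: l₂.map Sum.inl) with hpS
  have hfilt : ∀ (q' : P.Q) (L : List H), a ∉ L → b ∉ L →
      (L.map Sum.inl).filter (fun z => joinLift a b σ z = some q') =
        (L.filter fun h => σ h = some q').map Sum.inl := by
    intro q' L h1 h2
    rw [List.filter_map]
    congr 1
    refine List.filter_congr fun h hh => ?_
    have k1 : h ≠ a := by rintro rfl; exact h1 hh
    have k2 : h ≠ b := by rintro rfl; exact h2 hh
    simp [joinLift, k1, k2]
  have htrue : joinLift a b σ (Sum.inr true) = some q := by simp [joinLift, ha]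
  have bU : ∀ q', q' ≠ q → P.block pU σ q' = P.block pT σ q' := by
    intro q' hq'
    have : (pU (P.edge q')).filter (fun h => σ h = some q') =
        (pT (P.edge q')).filter (fun h => σ h = some q') := by
      by_cases he : P.edge q' = e
      · rw [he, hpU, hpT, Function.update_self, Function.update_self]
        simp [ha, hb, hq'.symm]
      · rw [hpU, hpT, Function.update_of_ne he, Function.update_of_ne he]
    unfold block
    rw [this]
  have bS : ∀ q', q' ≠ q →
      P.block pS (joinLift a b σ) q' = (P.block pT σ q').map Sum.inl := by
    intro q' hq'
    have : (pS (P.edge q')).filter (fun h => joinLift a b σ h = some q') =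
        ((pT (P.edge q')).filter (fun h => σ h = some q')).map Sum.inl := by
      by_cases he : P.edge q' = e
      · rw [he, hpS, hpT, Function.update_self, Function.update_self, List.filter_append,
          List.filter_cons, hfilt _ _ hab.1.1 hab.2.1, hfilt _ _ hab.1.2 hab.2.2, htrue]
        simp [ha, hb, hq'.symm]
      · rw [hpS, hpT, Function.update_of_ne he, Function.update_of_ne he,
          hfilt _ _ (habp _ he).1 (habp _ he).2]
    unfold block
    rw [this]
    split_ifs <;> simp
  obtain ⟨A, B, hAB, hA, hB⟩ := exists_path_eq q
  -- on the arrow of `q`, the two legs are neighbours, in the order given by the direction of `q`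
  obtain ⟨f₁, f₂, u, v, kT, kU, kS, huv⟩ : ∃ (f₁ f₂ : List H) (u v : H),
      P.block pT σ q = f₁ ++ u :: v :: f₂ ∧ P.block pU σ q = f₁ ++ v :: u :: f₂ ∧
      P.block pS (joinLift a b σ) q = f₁.map Sum.inl ++ Sum.inr true :: f₂.map Sum.inl ∧
      ((P.forward q = true ∧ u = a ∧ v = b) ∨ (P.forward q = false ∧ u = b ∧ v = a)) := by
    have e1 : (pT (P.edge q)).filter (fun h => σ h = some q) =
        l₁.filter (fun h => σ h = some q) ++ a :: b :: l₂.filter (fun h => σ h = some q) := by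
      rw [hq, hpT, Function.update_self]
      simp [ha, hb]
    have e2 : (pU (P.edge q)).filter (fun h => σ h = some q) =
        l₁.filter (fun h => σ h = some q) ++ b :: a :: l₂.filter (fun h => σ h = some q) := by
      rw [hq, hpU, Function.update_self]
      simp [ha, hb]
    have e3 : (pS (P.edge q)).filter (fun h => joinLift a b σ h = some q) =
        (l₁.filter (fun h => σ h = some q)).map Sum.inl ++ Sum.inr true ::
          (l₂.filter (fun h => σ h = some q)).map Sum.inl := by
      rw [hq, hpS, Function.update_self, List.filter_append,
          List.filter_cons, hfilt _ _ hab.1.1 hab.2.1, hfilt _ _ hab.1.2 hab.2.2, htrue]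
      simp
    unfold block
    rw [e1, e2, e3]
    cases hf : P.forward q
    · exact ⟨(l₂.filter fun h => σ h = some q).reverse, (l₁.filter fun h => σ h = some q).reverse,
        b, a, by simp, by simp, by simp, by simp⟩
    · exact ⟨l₁.filter fun h => σ h = some q, l₂.filter fun h => σ h = some q,
        a, b, by simp, by simp, by simp, by simp⟩
  have hne : ∀ (L : List P.Q), q ∉ L → ∀ q' ∈ L, q' ≠ q := by
    rintro L hL q' hq' rfl; exact hL hq'
  set g₁ := A.flatMap (P.block pT σ) ++ f₁ with hg₁
  set g₂ := f₂ ++ B.flatMap (P.block pT σ) with hg₂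
  set x := P.owner q with hx
  have LT : P.liftPos pT σ = Function.update (P.liftPos pT σ) (Sum.inl x)
      (g₁ ++ u :: v :: g₂) := by
    rw [eq_comm, Function.update_eq_self_iff]
    change _ = (P.path x).flatMap _
    rw [hAB, List.flatMap_append, List.flatMap_cons, kT]
    simp [hg₁, hg₂]
  have LU : P.liftPos pU σ = Function.update (P.liftPos pT σ) (Sum.inl x)
      (g₁ ++ v :: u :: g₂) := by
    refine Function.eq_update_iff.2 ⟨?_, ?_⟩
    · change (P.path x).flatMap _ = _
      rw [hAB, List.flatMap_append, List.flatMap_cons, kU,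
        List.flatMap_congr fun q' hq' => bU q' (hne A hA q' hq'),
        List.flatMap_congr fun q' hq' => bU q' (hne B hB q' hq')]
      simp [hg₁, hg₂]
    · rintro (y | o) hy
      · refine liftPos_eq_of_block (f := id) y (fun _ => rfl) fun q' hq' => bU q' ?_
        rintro rfl; exact hy (by rw [← hq'])
      · exact o.elim
  have LS : P.liftPos pS (joinLift a b σ) =
      Function.update (fun z => (P.liftPos pT σ z).map Sum.inl) (Sum.inl x)
        (g₁.map Sum.inl ++ Sum.inr true :: g₂.map Sum.inl) := by
    refine Function.eq_update_iff.2 ⟨?_, ?_⟩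
    · change (P.path x).flatMap _ = _
      rw [hAB, List.flatMap_append, List.flatMap_cons, kS,
        List.flatMap_congr fun q' hq' => bS q' (hne A hA q' hq'),
        List.flatMap_congr fun q' hq' => bS q' (hne B hB q' hq')]
      simp [hg₁, hg₂, List.map_flatMap]
    · rintro (y | o) hy
      · refine liftPos_eq_of_block (f := List.map Sum.inl) y
          (fun _ => List.map_flatMap) fun q' hq' => bS q' ?_
        rintro rfl; exact hy (by rw [← hq'])
      · exact o.elim
  let c₀ : DiagramData (arrows X) H := ⟨c.rot, c.opp, fun _ => []⟩
  have DT : P.lift (c.withPos pT) σ = c₀.withPos (Function.update (P.liftPos pT σ) (Sum.inl x)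
      (g₁ ++ u :: v :: g₂)) := by rw [← LT]; rfl
  have DU : P.lift (c.withPos pU) σ = c₀.withPos (Function.update (P.liftPos pT σ) (Sum.inl x)
      (g₁ ++ v :: u :: g₂)) := by rw [← LU]; rfl
  have DS : P.lift (c.joinLegs a b pS) (joinLift a b σ) = c₀.joinLegs a b
      (Function.update (fun z => (P.liftPos pT σ z).map Sum.inl) (Sum.inl x)
        (g₁.map Sum.inl ++ Sum.inr true :: g₂.map Sum.inl)) := by rw [← LS]; rfl
  rw [DT] at hT' ⊢
  rw [DU] at hU' ⊢
  rw [DS] at hS' ⊢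
  rcases huv with ⟨hf, rfl, rfl⟩ | ⟨hf, rfl, rfl⟩
  · rw [sign, if_pos hf, one_smul]
    exact cls_stu c₀ _ _ g₁ g₂ _ _ hT' hU' hS'
  · rw [sign, if_neg (by simp [hf]), neg_one_smul, ← neg_sub]
    congr 1
    exact cls_stu c₀ _ _ g₁ g₂ _ _ hU' hT' hS'

/-- The pullback respects the STU relation. The diagram `S` has one leg less to lift than `T`, so that
the signs of corresponding lifts differ by the sign of the passage, as in `cls_lift_cross`. -/
theorem pullback_stu [Finite H] {c : DiagramData Γ H} {p : Γ.Edge → List H} {e : Γ.Edge}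
    {l₁ l₂ : List H} {a b : H}
    (hT : (c.withPos (Function.update p e (l₁ ++ a :: b :: l₂))).IsDiagram i)
    (hU : (c.withPos (Function.update p e (l₁ ++ b :: a :: l₂))).IsDiagram i)
    (hS : (c.joinLegs a b (Function.update (fun e' => (p e').map Sum.inl) e
      (l₁.map Sum.inl ++ Sum.inr true :: l₂.map Sum.inl))).IsDiagram i) :
    P.pullback i (c.joinLegs a b (Function.update (fun e' => (p e').map Sum.inl) e
      (l₁.map Sum.inl ++ Sum.inr true :: l₂.map Sum.inl))) =
    P.pullback i (c.withPos (Function.update p e (l₁ ++ a :: b :: l₂))) -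
      P.pullback i (c.withPos (Function.update p e (l₁ ++ b :: a :: l₂))) := by
  let _ := Fintype.ofFinite H
  let _ := Fintype.ofFinite (H → Option P.Q)
  let _ := Fintype.ofFinite (H ⊕ Bool → Option P.Q)
  have hnd := hT.nodup e
  simp only [DiagramData.withPos, Function.update_self] at hnd
  rw [List.nodup_middle, List.nodup_cons] at hnd
  have hnd' := hnd.2
  rw [List.nodup_middle, List.nodup_cons] at hnd'
  have hab : a ∉ l₁ ++ l₂ ∧ b ∉ l₁ ++ l₂ := ⟨by
    have := hnd.1; simp only [List.mem_append, List.mem_cons, not_or] at this ⊢; tauto, hnd'.1⟩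
  have hne : a ≠ b := by
    rintro rfl; exact hnd.1 (by simp)
  have hae : a ∈ Function.update p e (l₁ ++ a :: b :: l₂) e := by simp
  have hbe : b ∈ Function.update p e (l₁ ++ a :: b :: l₂) e := by simp
  have hau : ∀ e', a ∈ Function.update p e (l₁ ++ a :: b :: l₂) e' → e' = e := fun e' h =>
    hT.edge_unique a _ _ h hae
  have hbu : ∀ e', b ∈ Function.update p e (l₁ ++ a :: b :: l₂) e' → e' = e := fun e' h =>
    hT.edge_unique b _ _ h hbe
  have habp : ∀ e', e' ≠ e → a ∉ p e' ∧ b ∉ p e' := fun e' he => by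
    refine ⟨fun h => he (hau e' ?_), fun h => he (hbu e' ?_)⟩ <;> rwa [Function.update_of_ne he]
  set pT := Function.update p e (l₁ ++ a :: b :: l₂) with hpT
  set pU := Function.update p e (l₁ ++ b :: a :: l₂) with hpU
  set pS := Function.update (fun e' => (p e').map Sum.inl) e
      (l₁.map Sum.inl ++ Sum.inr true :: l₂.map Sum.inl) with hpS
  have hmU : ∀ h e', h ∈ pU e' ↔ h ∈ pT e' := by
    intro h e'
    by_cases he : e' = e
    · subst he; simp [hpU, hpT]; tauto
    · simp [hpU, hpT, he]
  have hmS : ∀ h e', Sum.inl h ∈ pS e' ↔ h ∈ pT e' ∧ h ≠ a ∧ h ≠ b := by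
    intro h e'
    by_cases he : e' = e
    · subst he
      simp only [hpS, hpT, Function.update_self, List.mem_append, List.mem_cons, reduceCtorEq,
        List.mem_map_of_injective Sum.inl_injective, false_or]
      constructor
      · intro hh
        refine ⟨by tauto, ?_, ?_⟩
        · rintro rfl; exact hab.1 (List.mem_append.2 hh)
        · rintro rfl; exact hab.2 (List.mem_append.2 hh)
      · tauto
    · simp only [hpS, hpT, Function.update_of_ne he, List.mem_map_of_injective Sum.inl_injective]
      constructor
      · intro hh
        refine ⟨hh, ?_, ?_⟩
        · rintro rfl; exact (habp e' he).1 hh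
        · rintro rfl; exact (habp e' he).2 hh
      · tauto
  have hmt : ∀ e', Sum.inr true ∈ pS e' ↔ e' = e := by
    intro e'
    by_cases he : e' = e
    · subst he; simp [hpS]
    · simp [hpS, he]
  have hmf : ∀ e', Sum.inr false ∉ pS e' := by
    intro e'
    by_cases he : e' = e
    · subst he; simp [hpS]
    · simp [hpS, he]
  have hUT : ∀ σ, P.IsLift pU ∅ σ ↔ P.IsLift pT ∅ σ := fun σ => by simp only [IsLift, hmU]
  have hST : ∀ σ, P.IsLift pT ∅ σ → P.IsLift pS ∅ (joinLift a b σ) := by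
    intro σ hσ z _
    have hσ' := fun h => hσ h (Set.notMem_empty h)
    rcases z with h | (_ | _)
    · by_cases hh : h = a ∨ h = b
      · simp only [joinLift, Sum.elim_inl, hh, if_true, hmS]
        refine ⟨fun _ e' he' => ?_, by simp⟩
        rcases hh with hh | hh
        · exact he'.2.1 hh
        · exact he'.2.2 hh
      · simp only [joinLift, Sum.elim_inl, hh, if_false, hmS]
        push Not at hh
        exact ⟨fun h1 e' he' => (hσ' h).1 h1 e' he'.1, fun q hq => ⟨(hσ' h).2 q hq, hh⟩⟩
    · simp [joinLift, hmf]
    · simp only [joinLift, Sum.elim_inr, if_true, hmt]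
      exact ⟨fun h1 => ((hσ' a).1 h1 e hae).elim, fun q hq => hau _ ((hσ' a).2 q hq)⟩
  rw [pullback_eq, pullback_eq, pullback_eq, ← Finset.sum_sub_distrib]
  -- lifts with the two legs on different passages agree in `T` and `U`
  have hdiff : ∀ σ, P.IsLift pT ∅ σ → σ a ≠ σ b →
      P.lift (c.withPos pT) σ = P.lift (c.withPos pU) σ := by
    intro σ _ hσ
    have hb : ∀ q, P.block pU σ q = P.block pT σ q := by
      intro q
      have : (pU (P.edge q)).filter (fun h => σ h = some q) =
          (pT (P.edge q)).filter (fun h => σ h = some q) := by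
        by_cases he : P.edge q = e
        · rw [he, hpU, hpT, Function.update_self, Function.update_self]
          by_cases h1 : σ a = some q
          · have h2 : σ b ≠ some q := fun h => hσ (h1.trans h.symm)
            simp [h1, h2]
          · simp [List.filter_cons, h1]
        · rw [hpU, hpT, Function.update_of_ne he, Function.update_of_ne he]
      unfold block
      rw [this]
    have : P.liftPos pT σ = P.liftPos pU σ := by
      unfold liftPos
      rw [show P.block pT σ = P.block pU σ from funext fun q => (hb q).symm]
    change (⟨c.rot, c.opp, P.liftPos pT σ⟩ : DiagramData _ _) = ⟨c.rot, c.opp, P.liftPos pU σ⟩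
    rw [this]
  have hterm : ∀ σ, ((if P.IsLift (c.withPos pT).pos ∅ σ then
        P.coeff σ • cls i (P.lift (c.withPos pT) σ) else 0) -
      if P.IsLift (c.withPos pU).pos ∅ σ then
        P.coeff σ • cls i (P.lift (c.withPos pU) σ) else 0) =
      if P.IsLift pT ∅ σ ∧ σ a = σ b then
        P.coeff (joinLift a b σ) • cls i (P.lift (c.joinLegs a b pS) (joinLift a b σ)) else 0 := by
    intro σ
    change ((if P.IsLift pT ∅ σ then _ else 0) - if P.IsLift pU ∅ σ then _ else 0) = _
    rw [if_congr (hUT σ) rfl rfl]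
    by_cases hσ : P.IsLift pT ∅ σ
    · rw [if_pos hσ, if_pos hσ, ← smul_sub]
      by_cases h1 : σ a = σ b
      · rw [if_pos ⟨hσ, h1⟩]
        rcases h2 : σ a with _ | q
        · exact ((hσ a (Set.notMem_empty a)).1 h2 e hae).elim
        rw [cls_lift_cross hT hU hS hσ ((hUT σ).2 hσ) (hST σ hσ) h2 (h1 ▸ h2) hab habp
          (hau _ ((hσ a (Set.notMem_empty a)).2 q h2)), smul_smul]
        congr 1
        have h3 : P.coeff σ * P.sign q = P.coeff (joinLift a b σ) := by
          rw [coeff_eq, coeff_eq, Fintype.prod_sum_type]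
          have k1 : ∏ h, (σ h).elim 1 P.sign = ∏ h, ((joinLift a b σ (Sum.inl h)).elim 1 P.sign *
              ((if h = a then P.sign q else 1) * (if h = b then P.sign q else 1))) := by
            refine Finset.prod_congr rfl fun h _ => ?_
            by_cases ha : h = a
            · subst ha; simp [joinLift, hne, h2]
            by_cases hb : h = b
            · subst hb; simp [joinLift, ha, ← h1, h2]
            · simp [joinLift, ha, hb]
          have k2 : ∏ t, (joinLift a b σ (Sum.inr t)).elim 1 P.sign = P.sign q := by
            simp [joinLift, h2]
          rw [k1, k2, Finset.prod_mul_distrib, Finset.prod_mul_distrib, Finset.prod_ite_eq' ,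
            Finset.prod_ite_eq', if_pos (Finset.mem_univ _), if_pos (Finset.mem_univ _)]
          have := P.sign_mul_sign q
          linear_combination (∏ h, (joinLift a b σ (Sum.inl h)).elim 1 P.sign) * P.sign q * this
        rw [h3]
      · rw [if_neg (fun h => h1 h.2), hdiff σ hσ h1, sub_self, smul_zero]
    · rw [if_neg hσ, if_neg hσ, if_neg (fun h => hσ h.1), sub_zero]
  rw [Finset.sum_congr rfl fun σ _ => hterm σ]
  change ∑ τ, (if P.IsLift pS ∅ τ then _ else 0) = _
  rw [← Finset.sum_filter, ← Finset.sum_filter, eq_comm]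
  refine Finset.sum_nbij' (joinLift a b)
    (fun τ h => if h = a ∨ h = b then τ (Sum.inr true) else τ (Sum.inl h)) ?_ ?_ ?_ ?_
    fun _ _ => rfl
  · intro σ hσ
    rw [Finset.mem_filter] at hσ ⊢
    exact ⟨Finset.mem_univ _, hST σ hσ.2.1⟩
  · intro τ hτ
    rw [Finset.mem_filter] at hτ ⊢
    have hτ' := fun h => hτ.2 h (Set.notMem_empty h)
    refine ⟨Finset.mem_univ _, fun h _ => ?_, by simp⟩
    by_cases hh : h = a ∨ h = b
    · simp only [hh, if_true]
      refine ⟨fun h1 => ((hτ' _).1 h1 e ((hmt e).2 rfl)).elim, fun q hq => ?_⟩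
      have := (hmt _).1 ((hτ' _).2 q hq)
      rw [this]
      rcases hh with rfl | rfl
      · exact hae
      · exact hbe
    · simp only [hh, if_false]
      push Not at hh
      exact ⟨fun h1 e' he' => (hτ' _).1 h1 e' ((hmS _ _).2 ⟨he', hh⟩),
        fun q hq => ((hmS _ _).1 ((hτ' _).2 q hq)).1⟩
  · intro σ hσ
    rw [Finset.mem_filter] at hσ
    funext h
    by_cases ha : h = a
    · subst ha; simp [joinLift]
    by_cases hb : h = b
    · subst hb; simp [joinLift, hσ.2.2]
    · simp [joinLift, ha, hb]
  · intro τ hτ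
    rw [Finset.mem_filter] at hτ
    have hτ' := fun h => hτ.2 h (Set.notMem_empty h)
    have hn : ∀ h, h = a ∨ h = b → τ (Sum.inl h) = none := by
      intro h hh
      rcases h1 : τ (Sum.inl h) with _ | q
      · rfl
      · have := (hmS _ _).1 ((hτ' _).2 q h1)
        rcases hh with hh | hh
        · exact (this.2.1 hh).elim
        · exact (this.2.2 hh).elim
    funext z
    rcases z with h | (_ | _)
    · by_cases hh : h = a ∨ h = b
      · simp [joinLift, hh, hn h hh]
      · simp [joinLift, hh]
    · rcases h1 : τ (Sum.inr false) with _ | q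
      · simp [joinLift]
      · exact (hmf _ ((hτ' _).2 q h1)).elim
    · simp [joinLift]

end PathSystem

/-! ### Branching and the ends of the passages -/

theorem attachAt_self_perm {Γ : Skeleton} {H : Type} (p : Γ.Edge → List H) (l : H)
    (z : Γ.Arc × Side) : (attachAt p l z (Sum.inl z.1)).Perm (l :: p (Sum.inl z.1)) := by
  obtain ⟨a, s⟩ := z
  cases s
  · simp [attachAt]
  · simp only [attachAt, Function.update_self]
    exact List.perm_append_comm

theorem attachAt_of_ne {Γ : Skeleton} {H : Type} (p : Γ.Edge → List H) (l : H)
    (z : Γ.Arc × Side) {e : Γ.Edge} (he : e ≠ Sum.inl z.1) : attachAt p l z e = p e := by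
  obtain ⟨a, s⟩ := z
  cases s <;> simp [attachAt, Function.update_of_ne he]

theorem mem_attachAt {Γ : Skeleton} {H : Type} {p : Γ.Edge → List H} {l : H}
    {z : Γ.Arc × Side} {e : Γ.Edge} {h : H} :
    h ∈ attachAt p l z e ↔ (h = l ∧ e = Sum.inl z.1) ∨ h ∈ p e := by
  by_cases he : e = Sum.inl z.1
  · subst he; simp [(attachAt_self_perm p l z).mem_iff]
  · simp [attachAt_of_ne p l z he, he]

/-- A summation over functions, in which the value at `l` is summed over separately. -/
theorem sum_update_none {H β M : Type*} [Fintype H] [Fintype β] [AddCommMonoid M] (l : H)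
    (f : (H → Option β) → M) :
    ∑ σ, f σ = ∑ τ with τ l = none, ∑ o, f (Function.update τ l o) := by
  rw [← Finset.sum_product']
  refine (Finset.sum_nbij' (fun x => Function.update x.1 l x.2)
    (fun σ => (Function.update σ l none, σ l)) ?_ ?_ ?_ ?_ ?_).symm
  · simp
  · simp
  · rintro ⟨τ, o⟩ h
    have : τ l = none := by simpa using h
    simp [← this]
  · simp
  · simp

namespace PathSystem

variable {Γ : Skeleton} {X : Type} {P : PathSystem Γ X} {H : Type} {i : ℕ}

variable (P) in
/-- The side of its edge at which a passage starts. -/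
def startSide (q : P.Q) : Side := if P.forward q then Side.start else Side.finish

variable (P) in
/-- The side of its edge at which a passage ends. -/
def endSide (q : P.Q) : Side := if P.forward q then Side.finish else Side.start

variable (P) in
/-- The passage `q` starts at the trivalent vertex `v`. -/
def StartsAt (v : Γ.Vert) (q : P.Q) : Prop :=
  ∃ k, Sum.inl (Γ.half v k).1 = P.edge q ∧ (Γ.half v k).2 = P.startSide q

variable (P) in
/-- The passage `q` ends at the trivalent vertex `v`. -/
def EndsAt (v : Γ.Vert) (q : P.Q) : Prop :=
  ∃ k, Sum.inl (Γ.half v k).1 = P.edge q ∧ (Γ.half v k).2 = P.endSide q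

variable (P) in
/-- The passages in the list are consecutive as far as the vertex `v` is concerned: the proposition
`b` says that the path starts at `v`, and `b'` says that it ends there. -/
def Follows (v : Γ.Vert) : Prop → List P.Q → Prop → Prop
  | b, [], b' => b ↔ b'
  | b, q :: L, b' => (b ↔ P.StartsAt v q) ∧ Follows v (P.EndsAt v q) L b'

/-- Telescoping along a path: `F A B` stands for a leg placed between the passages in `A` and those in
`B`, and `T q` for the contribution of the two ends of the passage `q`. -/
theorem sum_of_follows {M : Type*} [AddCommGroup M] {v : Γ.Vert} (F : List P.Q → List P.Q → M)
    (T : P.Q → M) (L : List P.Q) : ∀ (b b' : Prop) (A : List P.Q), P.Follows v b L b' →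
    (∀ A' q B', A' ++ q :: B' = A ++ L → T q = (if P.StartsAt v q then F A' (q :: B') else 0) -
      if P.EndsAt v q then F (A' ++ [q]) B' else 0) →
    (L.map T).sum = (if b then F A L else 0) - if b' then F (A ++ L) [] else 0 := by
  induction L with
  | nil =>
    intro b b' A h _
    have h : b ↔ b' := h
    simp [h]
  | cons q L ih =>
    intro b b' A h hT
    have h : (b ↔ P.StartsAt v q) ∧ P.Follows v (P.EndsAt v q) L b' := h
    have h1 := ih _ b' (A ++ [q]) h.2 fun A' q' B' h' => hT A' q' B' (by simpa using h')
    rw [List.map_cons, List.sum_cons, h1, hT A q L rfl, if_congr h.1 rfl rfl]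
    simp

/-- The sum of the lifts of the branching relation at `v`, with the lifts of all legs but `l`
fixed: the contributions of two consecutive passages cancel, and the remaining terms at the ends of
the paths form a sum that vanishes by moving `l` across all legs. -/
theorem sum_lift_branching [Finite X] [Finite H] [Fintype P.Q] {c : DiagramData Γ H}
    {p : Γ.Edge → List H} {l : H} {v : Γ.Vert} (hc : (c.withPos p).IsPartial i {l})
    {b : Prop} (hv : ∀ x, P.Follows v b (P.path x) b) {τ : H → Option P.Q}
    (hτ : P.IsLift p {l} τ) :
    ∑ q, ∑ k : Fin 3, (if P.edge q = Sum.inl (Γ.half v k).1 then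
      ((Γ.half v k).2.sign * P.sign q) •
        cls i (P.lift (c.withPos (attachAt p l (Γ.half v k)))
          (Function.update τ l (some q))) else 0) = 0 := by
  let _ := Fintype.ofFinite X
  have hl : ∀ e, l ∉ p e := hc.notMem l rfl
  set c₀ : DiagramData (arrows X) H := P.lift (c.withPos p) τ with hc₀
  have hc₀' : c₀.IsPartial i {l} := isPartial_lift hc hτ
  set T : P.Q → GradedA (arrows X) i := fun q => ∑ k : Fin 3,
    (if P.edge q = Sum.inl (Γ.half v k).1 then ((Γ.half v k).2.sign * P.sign q) •
        cls i (P.lift (c.withPos (attachAt p l (Γ.half v k)))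
          (Function.update τ l (some q))) else 0) with hT
  let F : X → List P.Q → List P.Q → GradedA (arrows X) i := fun x A B =>
    cls i (c₀.withPos (Function.update c₀.pos (Sum.inl x)
      (A.flatMap (P.block p τ) ++ l :: B.flatMap (P.block p τ))))
  have key : ∀ q A B, P.path (P.owner q) = A ++ q :: B →
      T q = (if P.StartsAt v q then F (P.owner q) A (q :: B) else 0) -
        if P.EndsAt v q then F (P.owner q) (A ++ [q]) B else 0 := by
    intro q A B hAB
    have hqA : q ∉ A ∧ q ∉ B := by
      have hn := P.nodup (P.owner q)
      rw [hAB, List.nodup_middle, List.nodup_cons, List.mem_append, not_or] at hn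
      exact hn.1
    have hne : ∀ (L : List P.Q), q ∉ L → ∀ q' ∈ L, q' ≠ q := by
      rintro L hL q' hq' rfl; exact hL hq'
    have hupd : ∀ h, h ≠ l → Function.update τ l (some q) h = τ h := fun h hh => by
      rw [Function.update_of_ne hh]
    have hfilt : ∀ (q' : P.Q) (e : Γ.Edge),
        (p e).filter (fun h => Function.update τ l (some q) h = some q') =
          (p e).filter (fun h => τ h = some q') := by
      intro q' e
      refine List.filter_congr fun h hh => ?_
      rw [hupd]
      rintro rfl; exact hl e hh
    have hb : ∀ z q', q' ≠ q → P.block (attachAt p l z) (Function.update τ l (some q)) q' =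
        P.block p τ q' := by
      rintro ⟨a, s⟩ q' hq'
      have : (attachAt p l (a, s) (P.edge q')).filter
          (fun h => Function.update τ l (some q) h = some q') =
          (p (P.edge q')).filter (fun h => τ h = some q') := by
        rw [← hfilt]
        by_cases he : P.edge q' = Sum.inl a
        · rw [he]
          cases s
          · simp only [attachAt, Function.update_self]
            simp [hq'.symm]
          · simp only [attachAt, Function.update_self]
            simp [List.filter_append, hq'.symm]
        · rw [attachAt_of_ne _ _ _ he]
      unfold block
      rw [this]
    -- the position of the leg in the lift, according to the end of the passage
    have hbq : ∀ z : Γ.Arc × Side, P.edge q = Sum.inl z.1 →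
        P.block (attachAt p l z) (Function.update τ l (some q)) q =
          if z.2 = P.startSide q then l :: P.block p τ q else P.block p τ q ++ [l] := by
      rintro ⟨a, s⟩ he
      have he : P.edge q = Sum.inl a := he
      unfold block startSide
      rw [← hfilt, he]
      cases s <;> cases P.forward q <;> simp [attachAt, List.filter_append]
    have hlift : ∀ z : Γ.Arc × Side, P.edge q = Sum.inl z.1 →
        cls i (P.lift (c.withPos (attachAt p l z)) (Function.update τ l (some q))) =
          if z.2 = P.startSide q then F (P.owner q) A (q :: B) else
            F (P.owner q) (A ++ [q]) B := by
      intro z hz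
      have hpos : P.liftPos (attachAt p l z) (Function.update τ l (some q)) =
          Function.update c₀.pos (Sum.inl (P.owner q))
            (A.flatMap (P.block p τ) ++ ((if z.2 = P.startSide q then l :: P.block p τ q
              else P.block p τ q ++ [l]) ++ B.flatMap (P.block p τ))) := by
        refine Function.eq_update_iff.2 ⟨?_, ?_⟩
        · change (P.path _).flatMap _ = _
          rw [hAB, List.flatMap_append, List.flatMap_cons, hbq z hz,
            List.flatMap_congr fun q' hq' => hb z q' (hne A hqA.1 q' hq'),
            List.flatMap_congr fun q' hq' => hb z q' (hne B hqA.2 q' hq')]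
        · rintro (y | o) hy
          · refine liftPos_eq_of_block (f := id) y (fun _ => rfl) fun q' hq' => hb z q' ?_
            rintro rfl; exact hy (by rw [← hq'])
          · exact o.elim
      have hD : P.lift (c.withPos (attachAt p l z)) (Function.update τ l (some q)) =
          c₀.withPos (P.liftPos (attachAt p l z) (Function.update τ l (some q))) := rfl
      rw [hD, hpos]
      split_ifs with hs
      · simp [F]
      · simp [F]
    -- the sign depends only on whether the leg is at the start or at the end of the passage
    have hsign : ∀ s : Side, s.sign * P.sign q = if s = P.startSide q then 1 else -1 := by
      intro s
      unfold sign startSide Side.sign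
      cases s <;> cases P.forward q <;> simp
    have hside : ∀ s : Side, s ≠ P.startSide q ↔ s = P.endSide q := by
      intro s
      unfold startSide endSide
      cases s <;> cases P.forward q <;> simp
    have hcount : ∀ (s : Side) (m : GradedA (arrows X) i) (R : Prop),
        (R ↔ ∃ k, Sum.inl (Γ.half v k).1 = P.edge q ∧ (Γ.half v k).2 = s) → (∑ k : Fin 3,
        if Sum.inl (Γ.half v k).1 = P.edge q ∧ (Γ.half v k).2 = s then m else 0) =
        if R then m else 0 := by
      intro s m R hR
      split_ifs with h
      · rw [hR] at h
        obtain ⟨k, hk, hk'⟩ := h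
        rw [Finset.sum_eq_single k, if_pos ⟨hk, hk'⟩]
        · rintro k' - hkk
          refine if_neg fun h' => hkk ?_
          have : Γ.half v k' = Γ.half v k :=
            Prod.ext (Sum.inl_injective (h'.1.trans hk.symm)) (h'.2.trans hk'.symm)
          exact (Prod.ext_iff.1 (@Γ.half_injective (v, k') (v, k) this)).2
        · simp
      · exact Finset.sum_eq_zero fun k _ => if_neg fun h' => h (hR.2 ⟨k, h'⟩)
    rw [← hcount _ _ (P.StartsAt v q) Iff.rfl, ← hcount _ _ (P.EndsAt v q) Iff.rfl,
      ← Finset.sum_sub_distrib]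
    refine Finset.sum_congr rfl fun k _ => ?_
    by_cases he : P.edge q = Sum.inl (Γ.half v k).1
    · rw [if_pos he, hlift _ he, hsign, ← hside]
      by_cases hs : (Γ.half v k).2 = P.startSide q
      · simp [hs, he]
      · simp [hs, he]
    · simp [he, Ne.symm he]
  have hfib : ∑ q, T q = ∑ x, ((P.path x).map T).sum := by
    rw [← Finset.sum_fiberwise Finset.univ P.owner T]
    refine Finset.sum_congr rfl fun x _ => ?_
    rw [← List.sum_toFinset _ (P.nodup x)]
    refine Finset.sum_congr ?_ fun _ _ => rfl
    ext q
    simp [P.mem_path]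
  rw [hfib]
  have hx : ∀ x, ((P.path x).map T).sum =
      (if b then F x [] (P.path x) else 0) - if b then F x (P.path x) [] else 0 := by
    intro x
    have := sum_of_follows (F x) T (P.path x) b b [] (hv x) fun A q B h => by
      rw [List.nil_append] at h
      have ho : P.owner q = x := (P.mem_path q x).1 (by rw [← h]; simp)
      subst ho
      exact key q A B h.symm
    simpa using this
  rw [Finset.sum_congr rfl fun x _ => hx x]
  by_cases hb : b
  · simp only [hb, if_true]
    let _ : Fintype (arrows X).Edge := inferInstanceAs (Fintype (X ⊕ Empty))
    have h0 := DiagramData.sum_cls_start_sub_finish hc₀'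
    have h1 : ∀ f : X ⊕ Empty → GradedA (arrows X) i, ∑ e, f e = ∑ x, f (Sum.inl x) := fun f => by
      rw [Fintype.sum_sum_type, Finset.univ_eq_empty (α := Empty), Finset.sum_empty, add_zero]
    exact (h1 _).symm.trans h0
  · simp [hb]

/-- The pullback of a branching relation vanishes if the paths are closed at its vertex. -/
theorem pullback_branching [Finite X] [Finite H] {c : DiagramData Γ H} {p : Γ.Edge → List H}
    {l : H} {v : Γ.Vert} (h : ∀ k : Fin 3, (c.withPos (attachAt p l (Γ.half v k))).IsDiagram i)
    {b : Prop} (hv : ∀ x, P.Follows v b (P.path x) b) :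
    ∑ k : Fin 3, (Γ.half v k).2.sign •
      P.pullback i (c.withPos (attachAt p l (Γ.half v k))) = 0 := by
  let _ := Fintype.ofFinite H
  let _ := Fintype.ofFinite P.Q
  have hc : (c.withPos p).IsPartial i {l} :=
    (h 0).isPartial_erase (Sum.inl (Γ.half v 0).1) (attachAt_self_perm p l _)
      fun e' he' => attachAt_of_ne p l _ he'
  have hl : ∀ e, l ∉ p e := hc.notMem l rfl
  have hp : ∀ k, P.pullback i (c.withPos (attachAt p l (Γ.half v k))) =
      ∑ τ : H → Option P.Q with τ l = none, ∑ q, (if P.IsLift p {l} τ then P.coeff τ •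
        (if P.edge q = Sum.inl (Γ.half v k).1 then P.sign q •
        cls i (P.lift (c.withPos (attachAt p l (Γ.half v k)))
          (Function.update τ l (some q))) else 0) else 0) := by
    intro k
    rw [pullback_eq, sum_update_none l]
    refine Finset.sum_congr rfl fun τ hτ => ?_
    have hτ : τ l = none := by simpa using hτ
    rw [Fintype.sum_option, if_neg, zero_add]
    · refine Finset.sum_congr rfl fun q _ => ?_
      have h1 : P.IsLift (c.withPos (attachAt p l (Γ.half v k))).pos ∅
          (Function.update τ l (some q)) ↔
          P.IsLift p {l} τ ∧ P.edge q = Sum.inl (Γ.half v k).1 := by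
        simp only [IsLift, DiagramData.withPos, mem_attachAt]
        constructor
        · intro hh
          constructor
          · intro y hy
            have hy : y ≠ l := hy
            have := hh y (Set.notMem_empty y)
            simpa [hy] using this
          · have := (hh l (Set.notMem_empty l)).2 q (by simp)
            simpa [hl] using this
        · rintro ⟨hh, he⟩ y -
          by_cases hy : y = l
          · subst hy
            simp [he]
          · simpa [hy] using hh y hy
      have h2 : P.coeff (Function.update τ l (some q)) = P.coeff τ * P.sign q := by
        rw [coeff_eq, coeff_eq, ← Finset.mul_prod_erase _ _ (Finset.mem_univ l),
          ← Finset.mul_prod_erase (a := l) _ (fun h => (τ h).elim 1 P.sign) (Finset.mem_univ l),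
          hτ]
        simp only [Function.update_self, Option.elim_some, Option.elim_none, one_mul]
        rw [mul_comm]
        congr 1
        refine Finset.prod_congr rfl fun y hy => ?_
        rw [Function.update_of_ne (Finset.ne_of_mem_erase hy)]
      rw [if_congr h1 rfl rfl, h2]
      by_cases h3 : P.IsLift p {l} τ
      · by_cases h4 : P.edge q = Sum.inl (Γ.half v k).1
        · simp [h3, h4, mul_smul]
        · simp [h4]
      · simp [h3]
    · intro hh
      refine (hh l (Set.notMem_empty l)).1 (by simp) (Sum.inl (Γ.half v k).1) ?_
      exact mem_attachAt.2 (Or.inl ⟨rfl, rfl⟩)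
  simp only [hp, Finset.smul_sum]
  rw [Finset.sum_comm]
  refine Finset.sum_eq_zero fun τ _ => ?_
  by_cases hτ : P.IsLift p {l} τ
  · rw [Finset.sum_comm]
    refine Eq.trans ?_ ((congrArg (P.coeff τ • ·) (sum_lift_branching hc hv hτ)).trans
      (smul_zero _))
    rw [Finset.smul_sum]
    refine Finset.sum_congr rfl fun q _ => ?_
    rw [Finset.smul_sum]
    refine Finset.sum_congr rfl fun k _ => ?_
    rw [if_pos hτ, smul_comm]
    congr 1
    split_ifs
    · rw [mul_smul]
    · rw [smul_zero]
  · simp [hτ]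

end PathSystem

/-! ### The map induced by an embedding of arrows -/

section push

variable {X : Type} {Γ : Skeleton} {i : ℕ} (f : (arrows X).Arc ↪ Γ.Edge)

theorem pushFree_gen {H : Type} [Finite H] (c : DiagramData (arrows X) H) (hc : c.IsDiagram i) :
    pushFree f i (gen c hc) = gen (c.push f) (hc.push f) :=
  Finsupp.mapDomain_single

theorem extend_update {K : Type} (p : (arrows X).Edge → List K) (x : (arrows X).Arc) (L : List K) :
    Function.extend f (fun y => Function.update p (Sum.inl x) L (Sum.inl y)) (fun _ => []) =
      Function.update (Function.extend f (fun y => p (Sum.inl y)) fun _ => []) (f x) L := by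
  refine Function.eq_update_iff.2 ⟨?_, fun e he => ?_⟩
  · rw [f.injective.extend_apply, Function.update_self]
  · by_cases h : ∃ y, f y = e
    · obtain ⟨y, rfl⟩ := h
      have hy : y ≠ x := fun h => he (by rw [h])
      rw [f.injective.extend_apply, f.injective.extend_apply, Function.update_of_ne (by simpa)]
    · rw [Function.extend_apply' _ _ _ h, Function.extend_apply' _ _ _ h]

/-- An embedding of arrows maps relations to relations of the same type; there are no branching
relations between diagrams on arrows. -/
theorem isRelation_pushFree {x : FreeSpace (arrows X) i} (hx : IsRelation (arrows X) i x) :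
    IsRelation Γ i (pushFree f i x) := by
  cases hx with
  | as c h hh h₀ h₁ =>
    rw [map_add, pushFree_gen, pushFree_gen]
    exact .as (c.push f) h hh (h₀.push f) (h₁.push f)
  | ihx c h k a b d hk hh hkk ha hb hd hka hkb h₀ h₁ h₂ =>
    rw [map_add, map_add, pushFree_gen, pushFree_gen, pushFree_gen]
    exact .ihx (c.push f) h k a b d hk hh hkk ha hb hd hka hkb (h₀.push f) (h₁.push f) (h₂.push f)
  | stu c p e l₁ l₂ a b hT hU hS =>
    rcases e with x | o
    · rw [map_sub, map_sub, pushFree_gen, pushFree_gen, pushFree_gen]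
      have h₁ : ∀ L, (c.withPos (Function.update p (Sum.inl x) L)).push f =
          (c.push f).withPos (Function.update
            (Function.extend f (fun y => p (Sum.inl y)) fun _ => []) (f x) L) := fun L => by
        rw [← extend_update]; rfl
      have h₂ : ∀ L, (c.joinLegs a b (Function.update (fun e' => (p e').map Sum.inl)
          (Sum.inl x) L)).push f = (c.push f).joinLegs a b (Function.update
            (fun e' => (Function.extend f (fun y => p (Sum.inl y)) (fun _ => []) e').map Sum.inl)
            (f x) L) := fun L => by
        have : (fun e' => (Function.extend f (fun y => p (Sum.inl y)) (fun _ => []) e').map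
            (Sum.inl : _ → _ ⊕ Bool)) =
            Function.extend f (fun y => (p (Sum.inl y)).map Sum.inl) fun _ => [] := by
          funext e'
          by_cases h : ∃ y, f y = e'
          · obtain ⟨y, rfl⟩ := h
            rw [f.injective.extend_apply, f.injective.extend_apply]
          · rw [Function.extend_apply' _ _ _ h, Function.extend_apply' _ _ _ h, List.map_nil]
        rw [this, ← extend_update f (fun e' => (p e').map Sum.inl)]
        rfl
      have hT' := hT.push f
      have hU' := hU.push f
      have hS' := hS.push f
      simp only [h₁, h₂] at hT' hU' hS' ⊢
      exact .stu (c.push f) _ (f x) l₁ l₂ a b hT' hU' hS'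
    · exact o.elim
  | branching c p l v h => exact v.elim

theorem relations_le_comap_pushFree :
    relations (arrows X) i ≤ (relations Γ i).comap (pushFree f i) :=
  Submodule.span_le.2 fun _ hx => Submodule.subset_span (isRelation_pushFree f hx)

/-- The linear map between spaces of diagrams modulo relations that is induced by an embedding of
arrows. -/
noncomputable def pushA (i : ℕ) : GradedA (arrows X) i →ₗ[ℚ] GradedA Γ i :=
  Submodule.mapQ _ _ (pushFree f i) (relations_le_comap_pushFree f)

theorem pushA_cls {H : Type} [Finite H] {c : DiagramData (arrows X) H} (hc : c.IsDiagram i) :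
    pushA f i (cls i c) = cls i (c.push f) := by
  rw [cls_eq hc, cls_eq (hc.push f), ← pushFree_gen]
  rfl

/-- Every property of elements that is preserved by linear combinations holds if it holds for the
classes of chord diagrams. -/
theorem gradedA_induction {P : GradedA Γ i → Prop} (h0 : P 0) (hadd : ∀ x y, P x → P y → P (x + y))
    (hsmul : ∀ (r : ℚ) x, P x → P (r • x))
    (hcls : ∀ (H : Type) (_ : Finite H) (c : DiagramData Γ H), c.IsDiagram i → P (cls i c))
    (x : GradedA Γ i) : P x := by
  obtain ⟨x, rfl⟩ := (relations Γ i).mkQ_surjective x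
  induction x using Finsupp.induction_linear with
  | zero => simpa using h0
  | add x y hx hy => rw [map_add]; exact hadd _ _ hx hy
  | single D r =>
    obtain ⟨D, rfl⟩ := Quotient.exists_rep D
    have := hsmul r _ (hcls D.H D.finite D.data D.isDiagram)
    have hf := D.finite
    rw [cls_eq D.isDiagram, ← map_smul] at this
    refine Eq.subst (motive := P) (congrArg (relations Γ i).mkQ ?_) this
    exact Finsupp.smul_single_one _ r

end push

/-! ### Pushing legs off the other edges -/

section surjective

variable {X : Type} {Γ : Skeleton} {i : ℕ} {f : (arrows X).Arc ↪ Γ.Edge}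

theorem cls_branching {H : Type} [Finite H] {c : DiagramData Γ H} {p : Γ.Edge → List H} {l : H}
    {v : Γ.Vert} (h : ∀ k : Fin 3, (c.withPos (attachAt p l (Γ.half v k))).IsDiagram i) :
    ∑ k : Fin 3, (Γ.half v k).2.sign • cls i (c.withPos (attachAt p l (Γ.half v k))) = 0 := by
  rw [← mkQ_eq_zero_of_isRelation (.branching c p l v h), map_sum]
  exact Finset.sum_congr rfl fun k _ => by rw [map_smul, cls_eq (h k)]

theorem exists_attachAt_eq {H : Type} (p : Γ.Edge → List H) (z : Γ.Arc × Side)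
    (h : p (Sum.inl z.1) ≠ []) : ∃ l p', attachAt p' l z = p := by
  obtain ⟨a, s⟩ := z
  cases s
  · obtain ⟨l, L, hL⟩ := List.exists_cons_of_ne_nil h
    exact ⟨l, Function.update p (Sum.inl a) L, by simp [attachAt, ← hL]⟩
  · obtain h' | ⟨L, l, hL⟩ := List.eq_nil_or_concat (p (Sum.inl a))
    · exact (h h').elim
    · exact ⟨l, Function.update p (Sum.inl a) L, by
        rw [List.concat_eq_append] at hL
        simp [attachAt, ← hL]⟩

theorem sum_length_attachAt [Fintype Γ.Edge] (ht : Γ.Edge → ℕ) {H : Type} (p : Γ.Edge → List H)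
    (l : H) (z : Γ.Arc × Side) : ∑ e, ht e * (attachAt p l z e).length =
      ∑ e, ht e * (p e).length + ht (Sum.inl z.1) := by
  rw [← Finset.add_sum_erase _ _ (Finset.mem_univ (Sum.inl z.1 : Γ.Edge)),
    ← Finset.add_sum_erase (a := Sum.inl z.1) _ (fun e => ht e * (p e).length) (Finset.mem_univ _),
    (attachAt_self_perm p l z).length_eq, List.length_cons,
    Finset.sum_congr rfl fun e he => by rw [attachAt_of_ne p l z (Finset.ne_of_mem_erase he)]]
  ring

/-- If the edges that are not met by the embedding can be removed one after the other by pushing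
the legs on them through a vertex onto lower edges, then every diagram is equivalent to a linear
combination of images of diagrams on the arrows. -/
theorem cls_mem_range_pushA [Finite Γ.Edge] (ht : Γ.Edge → ℕ)
    (hht : ∀ e, e ∉ Set.range f → ∃ v k, e = Sum.inl (Γ.half v k).1 ∧
      ∀ k', k' ≠ k → ht (Sum.inl (Γ.half v k').1) < ht e)
    {H : Type} [Finite H] (c : DiagramData Γ H) (hc : c.IsDiagram i) :
    cls i c ∈ LinearMap.range (pushA f i) := by
  let _ := Fintype.ofFinite Γ.Edge
  induction hn : ∑ e, ht e * (c.pos e).length using Nat.strong_induction_on generalizing c with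
  | _ n ih =>
  by_cases h : ∃ e, e ∉ Set.range f ∧ c.pos e ≠ []
  · obtain ⟨e, he, hne⟩ := h
    obtain ⟨v, k, rfl, hk⟩ := hht e he
    obtain ⟨l, p, hp⟩ := exists_attachAt_eq c.pos (Γ.half v k) hne
    have hcp : c.withPos (attachAt p l (Γ.half v k)) = c := by rw [hp]; rfl
    have hpart : (c.withPos p).IsPartial i {l} :=
      hc.isPartial_erase (Sum.inl (Γ.half v k).1) (by rw [← hp]; exact attachAt_self_perm p l _)
        fun e' he' => by rw [← hp]; exact attachAt_of_ne p l _ he'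
    have hd : ∀ k', (c.withPos (attachAt p l (Γ.half v k'))).IsDiagram i := fun k' =>
      hpart.isDiagram_insert _ (attachAt_self_perm p l _) fun e' he' => attachAt_of_ne p l _ he'
    have hrel := cls_branching hd
    rw [← Finset.add_sum_erase _ _ (Finset.mem_univ k), hcp, add_eq_zero_iff_eq_neg] at hrel
    have hs : (Γ.half v k).2.sign ≠ 0 := by
      cases (Γ.half v k).2 <;> simp [Side.sign]
    have hmem : (Γ.half v k).2.sign • cls i c ∈ LinearMap.range (pushA f i) := by
      rw [hrel]
      refine Submodule.neg_mem _ (Submodule.sum_mem _ fun k' hk' => Submodule.smul_mem _ _ ?_)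
      refine ih _ ?_ _ (hd k') rfl
      have h1 : ∑ e, ht e * (attachAt p l (Γ.half v k) e).length = n := by rw [hp, hn]
      rw [sum_length_attachAt] at h1
      change ∑ e, ht e * (attachAt p l (Γ.half v k') e).length < n
      rw [sum_length_attachAt, ← h1]
      exact Nat.add_lt_add_left (hk k' (Finset.ne_of_mem_erase hk')) _
    exact (Submodule.smul_mem_iff _ hs).1 hmem
  · push Not at h
    let c₀ : DiagramData (arrows X) H :=
      ⟨c.rot, c.opp, Sum.elim (fun x => c.pos (f x)) fun _ => []⟩
    have hpos : c₀.push f = c := by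
      have : Function.extend f (fun x => c.pos (f x)) (fun _ => []) = c.pos := by
        funext e
        by_cases he : ∃ x, f x = e
        · obtain ⟨x, rfl⟩ := he
          rw [f.injective.extend_apply]
        · rw [Function.extend_apply' _ _ _ he, h e he]
      change (⟨c.rot, c.opp, Function.extend f (fun x => c.pos (f x)) fun _ => []⟩ :
        DiagramData Γ H) = c
      rw [this]
    have hc₀ : c₀.IsDiagram i :=
    { rot_rot_rot := hc.rot_rot_rot
      opp_opp := hc.opp_opp
      opp_ne := hc.opp_ne
      no_loop := hc.no_loop
      leg_iff := fun h' => by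
        refine (hc.leg_iff h').trans ⟨?_, ?_⟩
        · rintro ⟨e, he⟩
          by_cases hr : e ∈ Set.range f
          · obtain ⟨x, rfl⟩ := hr
            exact ⟨Sum.inl x, he⟩
          · rw [h e hr] at he; simp at he
        · rintro ⟨x | o, hx⟩
          · exact ⟨f x, hx⟩
          · exact o.elim
      edge_unique := by
        rintro h' (x | o) (y | o') hx hy
        · rw [f.injective (hc.edge_unique h' _ _ hx hy)]
        · exact o'.elim
        · exact o.elim
        · exact o.elim
      nodup := by
        rintro (x | o)
        · exact hc.nodup (f x)
        · exact o.elim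
      degree := hc.degree }
    exact ⟨cls i c₀, by rw [pushA_cls f hc₀, hpos]⟩

end surjective

/-! ### The inverse of the induced map -/

namespace PathSystem

variable {X : Type} {Γ : Skeleton} {i : ℕ} (P : PathSystem Γ X)

/-- The pullback does not depend on the starting points of the sequences of legs on the circles. -/
def RotationInvariant (i : ℕ) : Prop :=
  ∀ {H : Type} [Finite H] (c : DiagramData Γ H) (p : Γ.Edge → List H), c.IsDiagram i →
    (∀ a, p (Sum.inl a) = c.pos (Sum.inl a)) →
    (∀ o, (c.pos (Sum.inr o)).IsRotated (p (Sum.inr o))) →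
    P.pullback i (c.withPos p) = P.pullback i c

variable {P}

theorem pullback_iso (hrot : P.RotationInvariant i) {H H' : Type} [Finite H] [Finite H']
    {c : DiagramData Γ H} {c' : DiagramData Γ H'} (hc : c.IsDiagram i)
    (s : DiagramData.Iso c c') : P.pullback i c = P.pullback i c' := by
  have h : (c.map s.toEquiv).withPos c'.pos = c' := by
    have h1 : s.toEquiv.permCongr c.rot = c'.rot := by
      ext y
      obtain ⟨y, rfl⟩ := s.toEquiv.surjective y
      simp [s.rot_comm]
    have h2 : s.toEquiv.permCongr c.opp = c'.opp := by
      ext y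
      obtain ⟨y, rfl⟩ := s.toEquiv.surjective y
      simp [s.opp_comm]
    simp only [DiagramData.withPos, DiagramData.map, h1, h2]
  rw [← pullback_map c s.toEquiv,
    ← hrot (c.map s.toEquiv) c'.pos ((DiagramData.isoMap c s.toEquiv).isDiagram hc) s.pos_arc
      s.pos_circ, h]

/-- The pullback as a linear map on formal linear combinations of diagrams. -/
noncomputable def pullbackFree (hrot : P.RotationInvariant i) :
    FreeSpace Γ i →ₗ[ℚ] GradedA (arrows X) i :=
  Finsupp.linearCombination ℚ (Quotient.lift
    (fun D : ChordDiagram Γ i => @pullback Γ X P D.H D.finite i D.data)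
    fun D D' ⟨s⟩ => @pullback_iso X Γ i P hrot D.H D'.H D.finite D'.finite D.data D'.data
      D.isDiagram s)

theorem pullbackFree_gen (hrot : P.RotationInvariant i) {H : Type} [Finite H]
    (c : DiagramData Γ H) (hc : c.IsDiagram i) :
    pullbackFree hrot (gen c hc) = P.pullback i c :=
  (Finsupp.linearCombination_single ℚ 1 _).trans (one_smul ℚ _)

/-- At every vertex of the skeleton, the paths are closed: either all of them start and end there,
or none does, and consecutive passages meet. -/
def IsClosed (P : PathSystem Γ X) : Prop :=
  ∀ v, ∃ b, ∀ x, P.Follows v b (P.path x) b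

theorem pullbackFree_relation [Finite X] (hrot : P.RotationInvariant i) (hP : P.IsClosed)
    {x : FreeSpace Γ i} (hx : IsRelation Γ i x) : pullbackFree hrot x = 0 := by
  cases hx with
  | as c h hh h₀ h₁ =>
    rw [map_add, pullbackFree_gen, pullbackFree_gen]
    exact pullback_as hh h₀ h₁
  | ihx c h k a b d hk hh hkk ha hb hd hka hkb h₀ h₁ h₂ =>
    rw [map_add, map_add, pullbackFree_gen, pullbackFree_gen, pullbackFree_gen]
    exact pullback_ihx hk hh hkk ha hb hd hka hkb h₀ h₁ h₂
  | stu c p e l₁ l₂ a b hT hU hS =>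
    rw [map_sub, map_sub, pullbackFree_gen, pullbackFree_gen, pullbackFree_gen, sub_eq_zero]
    exact pullback_stu hT hU hS
  | branching c p l v h =>
    obtain ⟨b, hb⟩ := hP v
    simp only [map_sum, map_smul, pullbackFree_gen]
    exact pullback_branching h hb

/-- The pullback on the space of diagrams modulo relations. -/
noncomputable def pullbackA [Finite X] (hrot : P.RotationInvariant i) (hP : P.IsClosed) :
    GradedA Γ i →ₗ[ℚ] GradedA (arrows X) i :=
  (relations Γ i).liftQ (pullbackFree hrot)
    (Submodule.span_le.2 fun _ hx => pullbackFree_relation hrot hP hx)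

theorem pullbackA_cls [Finite X] (hrot : P.RotationInvariant i) (hP : P.IsClosed) {H : Type}
    [Finite H] {c : DiagramData Γ H} (hc : c.IsDiagram i) :
    pullbackA hrot hP (cls i c) = P.pullback i c := by
  rw [cls_eq hc, ← pullbackFree_gen hrot c hc]
  rfl

/-- If the path `x` runs once through the edge `f x`, along its orientation, and no other path does,
then the pullback inverts the map induced by `f`: the image of a diagram has exactly one lift. -/
theorem pullback_push {f : (arrows X).Arc ↪ Γ.Edge} {m : X → P.Q}
    (hm : ∀ x, P.edge (m x) = f x) (hfwd : ∀ x, P.forward (m x) = true)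
    (hown : ∀ x, P.owner (m x) = x) (huniq : ∀ (x : X) q, P.edge q = f x → q = m x)
    {H : Type} [Finite H] {c : DiagramData (arrows X) H} (hc : c.IsDiagram i) :
    P.pullback i (c.push f) = cls i c := by
  obtain ⟨σ, hσ1, hσ2⟩ : ∃ σ : H → Option P.Q,
      (∀ h (x : X), h ∈ c.pos (Sum.inl x) → σ h = some (m x)) ∧
      (∀ h, (∀ x : X, h ∉ c.pos (Sum.inl x)) → σ h = none) := by
    refine ⟨fun h => if hx : ∃ x : X, h ∈ c.pos (Sum.inl x) then some (m hx.choose) else none,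
      fun h x hx => ?_, fun h hx => dif_neg fun ⟨x, hx'⟩ => hx x hx'⟩
    have hex : ∃ x : X, h ∈ c.pos (Sum.inl x) := ⟨x, hx⟩
    refine (dif_pos hex).trans ?_
    have := Sum.inl_injective (hc.edge_unique h _ _ hex.choose_spec hx)
    rw [this]
  have hex : ∀ q h, h ∈ (c.push f).pos (P.edge q) → ∃ x : X, q = m x ∧ h ∈ c.pos (Sum.inl x) := by
    intro q h hh
    obtain ⟨x, hx, hx'⟩ := (c.mem_push f h _).1 hh
    exact ⟨x, huniq x q hx.symm, hx'⟩
  have hlift : P.IsLift (c.push f).pos ∅ σ := by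
    intro h _
    by_cases hh : ∃ x : X, h ∈ c.pos (Sum.inl x)
    · obtain ⟨x, hx⟩ := hh
      rw [hσ1 h x hx]
      refine ⟨by simp, fun q hq => ?_⟩
      obtain rfl := Option.some_inj.1 hq
      exact (c.mem_push f h _).2 ⟨x, (hm x).symm, hx⟩
    · push Not at hh
      rw [hσ2 h hh]
      refine ⟨fun _ e he => ?_, by simp⟩
      obtain ⟨x, -, hx⟩ := (c.mem_push f h e).1 he
      exact hh x hx
  have huni : ∀ σ', P.IsLift (c.push f).pos ∅ σ' → σ' = σ := by
    intro σ' hσ'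
    funext h
    have h' := hσ' h (Set.notMem_empty h)
    rcases h1 : σ' h with _ | q
    · rw [hσ2]
      intro x hx
      exact h'.1 h1 (f x) ((c.mem_push f h _).2 ⟨x, rfl, hx⟩)
    · obtain ⟨x, rfl, hx⟩ := hex q h (h'.2 q h1)
      rw [hσ1 h x hx]
  have hcoeff : P.coeff σ = 1 := by
    refine finprod_eq_one_of_forall_eq_one fun h => ?_
    by_cases hh : ∃ x : X, h ∈ c.pos (Sum.inl x)
    · obtain ⟨x, hx⟩ := hh
      simp [hσ1 h x hx, sign, hfwd]
    · push Not at hh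
      simp [hσ2 h hh]
  have hpos : P.liftPos (c.push f).pos σ = c.pos := by
    funext e
    rcases e with x | o
    · change X at x
      obtain ⟨A, B, hAB, hA, hB⟩ := exists_path_eq (P := P) (m x)
      have hnil : ∀ q, q ∈ P.path x → q ≠ m x → P.block (c.push f).pos σ q = [] := by
        intro q hq hne
        refine List.eq_nil_iff_forall_not_mem.2 fun h hh => ?_
        obtain ⟨y, rfl, -⟩ := hex q h (mem_block.1 hh).1
        rw [P.mem_path, hown] at hq
        exact hne (by rw [hq])
      rw [hown] at hAB
      rw [hAB] at hnil
      have hself : P.block (c.push f).pos σ (m x) = c.pos (Sum.inl x) := by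
        have : (c.push f).pos (f x) = c.pos (Sum.inl x) :=
          f.injective.extend_apply (fun x => c.pos (Sum.inl x)) (fun _ => []) x
        rw [block, if_pos (hfwd x), hm, this]
        exact List.filter_eq_self.2 fun h hh => by simp [hσ1 h x hh]
      change (P.path x).flatMap _ = _
      rw [hAB, List.flatMap_append, List.flatMap_cons, hself, List.flatMap_eq_nil_iff.2,
        List.flatMap_eq_nil_iff.2, List.nil_append, List.append_nil]
      · exact fun q hq => hnil q (by simp [hq]) (by rintro rfl; exact hB hq)
      · exact fun q hq => hnil q (by simp [hq]) (by rintro rfl; exact hA hq)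
    · exact o.elim
  have hD : P.lift (c.push f) σ = c := by
    change (⟨c.rot, c.opp, P.liftPos (c.push f).pos σ⟩ : DiagramData _ _) = c
    rw [hpos]
  unfold pullback
  rw [finsum_eq_single _ σ, if_pos hlift, hcoeff, one_smul, hD]
  intro σ' hσ'
  exact if_neg fun h => hσ' (huni σ' h)

end PathSystem

/-- The general form of the theorem: an embedding of arrows into a skeleton induces an isomorphism
if there is a compatible closed system of paths, and if legs can be pushed off the other edges. -/
theorem exists_linearEquiv {X : Type} [Finite X] {Γ : Skeleton} [Finite Γ.Edge]
    (f : (arrows X).Arc ↪ Γ.Edge) (P : PathSystem Γ X) (hrot : ∀ i, P.RotationInvariant i)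
    (hP : P.IsClosed) (m : X → P.Q)
    (hm : ∀ x, P.edge (m x) = f x) (hfwd : ∀ x, P.forward (m x) = true)
    (hown : ∀ x, P.owner (m x) = x) (huniq : ∀ (x : X) q, P.edge q = f x → q = m x)
    (ht : Γ.Edge → ℕ) (hht : ∀ e, e ∉ Set.range f → ∃ v k, e = Sum.inl (Γ.half v k).1 ∧
      ∀ k', k' ≠ k → ht (Sum.inl (Γ.half v k').1) < ht e) :
    ∃ Φ : SpaceA (arrows X) ≃ₗ[ℚ] SpaceA Γ, ∀ x : (∀ i : ℕ, FreeSpace (arrows X) i),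
      Φ (toSpaceA x) = toSpaceA (fun i => pushFree f i (x i)) := by
  have hinv : ∀ i (x : GradedA (arrows X) i),
      PathSystem.pullbackA (hrot i) hP (pushA f i x) = x := by
    intro i
    refine gradedA_induction (by simp) (fun x y hx hy => by rw [map_add, map_add, hx, hy])
      (fun r x hx => by rw [map_smul, map_smul, hx]) fun H _ c hc => ?_
    rw [pushA_cls f hc, PathSystem.pullbackA_cls (hrot i) hP (hc.push f),
      PathSystem.pullback_push hm hfwd hown huniq hc]
  have hbij : ∀ i, Function.Bijective (pushA f i) := by
    refine fun i => ⟨Function.LeftInverse.injective (hinv i), ?_⟩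
    refine gradedA_induction ⟨0, map_zero _⟩ ?_ ?_ fun H _ c hc => ?_
    · rintro _ _ ⟨x, rfl⟩ ⟨y, rfl⟩
      exact ⟨x + y, map_add _ _ _⟩
    · rintro r _ ⟨x, rfl⟩
      exact ⟨r • x, map_smul _ _ _⟩
    · exact cls_mem_range_pushA ht hht c hc
  refine ⟨LinearEquiv.piCongrRight fun i => LinearEquiv.ofBijective (pushA f i) (hbij i), ?_⟩
  intro x
  rfl

namespace PathSystem

variable {X : Type} {Γ : Skeleton} {i : ℕ}

theorem rotationInvariant_of_isEmpty [IsEmpty Γ.Circ] (P : PathSystem Γ X) (i : ℕ) :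
    P.RotationInvariant i := by
  intro H _ c p _ ha _
  have : p = c.pos := funext (Sum.rec ha isEmptyElim)
  rw [this]
  rfl

/-! ### Rotating the sequence of legs on a circle -/

/-- The path system in which the path `x` runs through the single edge `f x`. -/
def ofEmbedding [Finite X] (f : X → Γ.Edge) : PathSystem Γ X where
  Q := X
  finite := inferInstance
  edge := f
  forward _ := true
  owner := id
  path x := [x]
  mem_path q x := by simp
  nodup x := by simp

/-- On a single arrow, a leg can be moved from the start to the end. -/
theorem cls_rotate_one [Finite X] [Subsingleton X] {H : Type} [Finite H]
    {c : DiagramData (arrows X) H} (hc : c.IsDiagram i) (x : (arrows X).Arc) :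
    cls i (c.withPos (Function.update c.pos (Sum.inl x) ((c.pos (Sum.inl x)).rotate 1))) =
      cls i c := by
  rcases hL : c.pos (Sum.inl x) with _ | ⟨l, L⟩
  · rw [List.rotate_nil, ← hL, Function.update_eq_self]
    rfl
  set p : (arrows X).Edge → List H := Function.update c.pos (Sum.inl x) L with hp
  have hpx : p (Sum.inl x) = L := Function.update_self ..
  have hpart : (c.withPos p).IsPartial i {l} :=
    hc.isPartial_erase (Sum.inl x) (by rw [hL, hpx]) fun e he => (Function.update_of_ne he ..).symm
  let _ := Fintype.ofFinite X
  let _ : Fintype (arrows X).Edge := inferInstanceAs (Fintype (X ⊕ Empty))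
  have h0 := DiagramData.sum_cls_start_sub_finish hpart
  rw [Finset.sum_eq_single (Sum.inl x)] at h0
  · change cls i (c.withPos (Function.update p (Sum.inl x) (l :: p (Sum.inl x)))) -
      cls i (c.withPos (Function.update p (Sum.inl x) (p (Sum.inl x) ++ [l]))) = 0 at h0
    rw [hpx, hp, Function.update_idem, Function.update_idem, ← hL, Function.update_eq_self,
      sub_eq_zero] at h0
    rw [List.rotate_cons_succ, List.rotate_zero, ← h0]
    rfl
  · rintro (y | o) _ h
    · exact (h (congrArg Sum.inl (Subsingleton.elim (α := X) y x))).elim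
    · exact o.elim
  · intro h; exact (h (Finset.mem_univ _)).elim

theorem cls_rotate [Finite X] [Subsingleton X] {H : Type} [Finite H]
    {c : DiagramData (arrows X) H} (hc : c.IsDiagram i) (x : (arrows X).Arc) (n : ℕ) :
    cls i (c.withPos (Function.update c.pos (Sum.inl x) ((c.pos (Sum.inl x)).rotate n))) =
      cls i c := by
  induction n with
  | zero => rw [List.rotate_zero, Function.update_eq_self]; rfl
  | succ n ih =>
    have hd : (c.withPos (Function.update c.pos (Sum.inl x)
        ((c.pos (Sum.inl x)).rotate n))).IsDiagram i := by
      refine hc.of_perm fun e => ?_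
      by_cases he : e = Sum.inl x
      · subst he; rw [Function.update_self]; exact List.rotate_perm _ _
      · rw [Function.update_of_ne he]
    rw [← ih, ← cls_rotate_one hd x]
    simp only [DiagramData.withPos, Function.update_self, Function.update_idem, List.rotate_rotate]

/-- For a single arrow, it does not matter where a circle is cut open. -/
theorem rotationInvariant_ofEmbedding [Finite X] [Subsingleton X] (f : X → Γ.Edge) (i : ℕ) :
    (ofEmbedding f).RotationInvariant i := by
  intro H _ c p hc ha ho
  have hr : ∀ e, (c.pos e).IsRotated (p e) := by
    rintro (a | o)
    · rw [ha]
    · exact ho o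
  unfold pullback
  refine finsum_congr fun σ => ?_
  have h1 : (ofEmbedding f).IsLift (c.withPos p).pos ∅ σ ↔ (ofEmbedding f).IsLift c.pos ∅ σ := by
    simp only [IsLift, DiagramData.withPos, (hr _).mem_iff]
  rw [if_congr h1 rfl rfl]
  split_ifs with hσ
  · congr 1
    have hpos : ∀ p' : Γ.Edge → List H, (ofEmbedding f).IsLift p' ∅ σ → ∀ x : X,
        (ofEmbedding f).liftPos p' σ (Sum.inl x) = p' (f x) := by
      intro p' hp' x
      have hb : ∀ q, (ofEmbedding f).block p' σ q = p' ((ofEmbedding f).edge q) := by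
        intro q'
        unfold block
        have hq' : (ofEmbedding f).forward q' = true := rfl
        rw [if_pos hq']
        refine List.filter_eq_self.2 fun h hh => ?_
        rcases hs : σ h with _ | q
        · exact ((hp' h (Set.notMem_empty h)).1 hs _ hh).elim
        · have : q = q' := Subsingleton.elim (α := X) q q'
          simp [this]
      exact (List.append_nil _).trans (hb x)
    rcases isEmpty_or_nonempty X with hX | ⟨⟨x⟩⟩
    · congr 1
      change (⟨c.rot, c.opp, _⟩ : DiagramData _ _) = ⟨c.rot, c.opp, _⟩
      congr 1
      funext e
      rcases e with x | o
      · exact (hX.false x).elim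
      · exact o.elim
    · obtain ⟨n, hn⟩ := hr (f x)
      rw [← cls_rotate (isDiagram_lift hc hσ) x n]
      congr 1
      change (⟨c.rot, c.opp, _⟩ : DiagramData _ _) = ⟨c.rot, c.opp, _⟩
      congr 1
      refine Function.eq_update_iff.2 ⟨?_, ?_⟩
      · refine (hpos _ (h1.2 hσ) x).trans ?_
        change _ = ((ofEmbedding f).liftPos c.pos σ (Sum.inl x)).rotate n
        rw [hpos _ hσ, hn]
        rfl
      · rintro (y | o) h
        · exact (h (congrArg Sum.inl (Subsingleton.elim (α := X) y x))).elim
        · exact o.elim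
  · rfl

/-! ### Path systems given by words -/

/-- The path system in which the path `x` first runs along the word `A x`, then through the edge
`f x`, and then along the word `B x`. A letter of a word is an edge with a direction, which is
`true` for the orientation of the edge. -/
def ofWords [Finite X] (f : X → Γ.Edge) (A B : X → List (Γ.Edge × Bool)) : PathSystem Γ X where
  Q := Σ x, Fin (A x).length ⊕ (Unit ⊕ Fin (B x).length)
  finite := inferInstance
  edge q := (Sum.elim (A q.1).get (Sum.elim (fun _ => (f q.1, true)) (B q.1).get) q.2).1
  forward q := (Sum.elim (A q.1).get (Sum.elim (fun _ => (f q.1, true)) (B q.1).get) q.2).2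
  owner := Sigma.fst
  path x := ((List.finRange _).map Sum.inl ++
    Sum.inr (Sum.inl ()) :: (List.finRange _).map fun j => Sum.inr (Sum.inr j)).map (Sigma.mk x)
  mem_path := by
    rintro ⟨y, q⟩ x
    constructor
    · intro h
      obtain ⟨q', -, hq'⟩ := List.mem_map.1 h
      rw [Sigma.mk.injEq] at hq'
      exact hq'.1.symm
    · rintro rfl
      refine List.mem_map_of_mem ?_
      rcases q with j | (_ | j) <;> simp
  nodup x := by
    refine List.Nodup.map sigma_mk_injective ?_
    rw [List.nodup_middle, List.nodup_cons, List.nodup_append]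
    refine ⟨by simp, (List.nodup_finRange _).map Sum.inl_injective,
      (List.nodup_finRange _).map (Sum.inr_injective.comp Sum.inr_injective), ?_⟩
    intro a ha b hb
    obtain ⟨j, -, rfl⟩ := List.mem_map.1 ha
    obtain ⟨j', -, rfl⟩ := List.mem_map.1 hb
    simp

/-- The oriented edge of a passage. -/
def letter (P : PathSystem Γ X) (q : P.Q) : Γ.Edge × Bool := (P.edge q, P.forward q)

theorem map_letter_path_ofWords [Finite X] (f : X → Γ.Edge) (A B : X → List (Γ.Edge × Bool))
    (x : X) : ((ofWords f A B).path x).map (ofWords f A B).letter =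
      A x ++ (f x, true) :: B x := by
  have h1 : ((ofWords f A B).path x).map (ofWords f A B).letter =
      (List.finRange _).map (A x).get ++ (f x, true) :: (List.finRange _).map (B x).get := by
    simp only [ofWords, List.map_append, List.map_cons, List.map_map]
    rfl
  rw [h1, List.map_get_finRange, List.map_get_finRange]

/-- If the words avoid the edges `f y`, then the middle of the path `x` is the only passage through
`f x`. -/
theorem eq_of_edge_ofWords [Finite X] {f : X → Γ.Edge} {A B : X → List (Γ.Edge × Bool)}
    (hf : Function.Injective f) (hA : ∀ x, ∀ w ∈ A x, w.1 ∉ Set.range f)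
    (hB : ∀ x, ∀ w ∈ B x, w.1 ∉ Set.range f) (x : X) (q : (ofWords f A B).Q)
    (hq : (ofWords f A B).edge q = f x) : q = ⟨x, Sum.inr (Sum.inl ())⟩ := by
  obtain ⟨y, j | (_ | j)⟩ := q
  · exact (hA y _ (List.get_mem (A y) j) ⟨x, hq.symm⟩).elim
  · obtain rfl := hf hq
    rfl
  · exact (hB y _ (List.get_mem (B y) j) ⟨x, hq.symm⟩).elim

end PathSystem

/-! ### Paths in the chain graph -/

namespace ChainArc

variable {n : ℕ}

/-- The vertex at which an edge end of the chain graph lies. -/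
def vertexAt : ChainArc n × Side → Fin (n + 1) × Side
  | (first, _) => (0, Side.start)
  | (last, _) => (Fin.last n, Side.finish)
  | (upper i, Side.start) => (i.succ, Side.start)
  | (upper i, Side.finish) => (i.castSucc, Side.finish)
  | (lower i, Side.start) => (i.castSucc, Side.finish)
  | (lower i, Side.finish) => (i.succ, Side.start)
  | (bridge j, s) => (j, s)

theorem up_last : up (n := n) (Fin.last (n + 1)) = last := by
  rw [← Fin.succ_last]; simp [up, -Fin.succ_last]

theorem up_castSucc_succ (i : Fin n) : up i.castSucc.succ = upper i := by
  simp [up, -Fin.succ_last]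

theorem up_succ_castSucc (i : Fin n) : up i.succ.castSucc = upper i := by
  rw [← Fin.succ_castSucc, up_castSucc_succ]

theorem down_last : down (n := n) (Fin.last (n + 1)) = last := by
  rw [← Fin.succ_last]; simp [down, -Fin.succ_last]

theorem down_castSucc_succ (i : Fin n) : down i.castSucc.succ = lower i := by
  simp [down, -Fin.succ_last]

theorem down_succ_castSucc (i : Fin n) : down i.succ.castSucc = lower i := by
  rw [← Fin.succ_castSucc, down_castSucc_succ]

theorem vertexAt_half (v : Fin (n + 1) × Side) (k : Fin 3) : vertexAt (half v k) = v := by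
  obtain ⟨j, s⟩ := v
  cases s
  · induction j using Fin.cases with
    | zero => fin_cases k <;> rfl
    | succ i =>
      fin_cases k
      · rfl
      · change vertexAt (up i.succ.castSucc, Side.start) = _
        rw [up_succ_castSucc]; rfl
      · change vertexAt (down i.succ.castSucc, Side.finish) = _
        rw [down_succ_castSucc]; rfl
  · induction j using Fin.lastCases with
    | last =>
      fin_cases k
      · rfl
      · change vertexAt (down (Fin.last n).succ, Side.start) = _
        rw [Fin.succ_last, down_last]; rfl
      · change vertexAt (up (Fin.last n).succ, Side.finish) = _
        rw [Fin.succ_last, up_last]; rfl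
    | cast i =>
      fin_cases k
      · rfl
      · change vertexAt (down i.castSucc.succ, Side.start) = _
        rw [down_castSucc_succ]; rfl
      · change vertexAt (up i.castSucc.succ, Side.finish) = _
        rw [up_castSucc_succ]; rfl

theorem exists_half_eq (z : ChainArc n × Side) : ∃ k, half (vertexAt z) k = z := by
  obtain ⟨a | a | i | i | j, s | s⟩ := z
  · exact ⟨1, rfl⟩
  · exact ⟨2, rfl⟩
  · refine ⟨1, ?_⟩
    change (down (Fin.last n).succ, Side.start) = _
    rw [Fin.succ_last, down_last]
  · refine ⟨2, ?_⟩
    change (up (Fin.last n).succ, Side.finish) = _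
    rw [Fin.succ_last, up_last]
  · refine ⟨1, ?_⟩
    change (up i.succ.castSucc, Side.start) = _
    rw [up_succ_castSucc]
  · refine ⟨2, ?_⟩
    change (up i.castSucc.succ, Side.finish) = _
    rw [up_castSucc_succ]
  · refine ⟨1, ?_⟩
    change (down i.castSucc.succ, Side.start) = _
    rw [down_castSucc_succ]
  · refine ⟨2, ?_⟩
    change (down i.succ.castSucc, Side.finish) = _
    rw [down_succ_castSucc]
  · exact ⟨0, rfl⟩
  · exact ⟨0, rfl⟩

theorem exists_half_iff (v : Fin (n + 1) × Side) (z : ChainArc n × Side) :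
    (∃ k, half v k = z) ↔ vertexAt z = v := by
  constructor
  · rintro ⟨k, rfl⟩; exact vertexAt_half v k
  · rintro rfl; exact exists_half_eq z

/-- The vertex at which an edge starts, traversed in the given direction. -/
def source (w : ChainArc n × Bool) : Fin (n + 1) × Side :=
  vertexAt (w.1, if w.2 then Side.start else Side.finish)

/-- The vertex at which an edge ends, traversed in the given direction. -/
def target (w : ChainArc n × Bool) : Fin (n + 1) × Side :=
  vertexAt (w.1, if w.2 then Side.finish else Side.start)

/-- The word describes a path between the given vertices. -/
def IsPath : Fin (n + 1) × Side → List (ChainArc n × Bool) → Fin (n + 1) × Side → Prop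
  | u, [], u' => u = u'
  | u, w :: L, u' => source w = u ∧ IsPath (target w) L u'

theorem IsPath.append {L L' : List (ChainArc n × Bool)} : ∀ {u v w}, IsPath u L v →
    IsPath v L' w → IsPath u (L ++ L') w := by
  induction L with
  | nil => rintro u v w (rfl : u = v) h; exact h
  | cons a L ih => exact fun h h' => ⟨h.1, ih h.2 h'⟩

/-- The reverse path. -/
def rev (L : List (ChainArc n × Bool)) : List (ChainArc n × Bool) :=
  (L.map fun w => (w.1, !w.2)).reverse

theorem IsPath.rev {L : List (ChainArc n × Bool)} : ∀ {u v}, IsPath u L v →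
    IsPath v (ChainArc.rev L) u := by
  induction L with
  | nil => rintro u v (rfl : u = v); exact rfl
  | cons a L ih =>
    intro u v h
    have h1 : ChainArc.rev (a :: L) = ChainArc.rev L ++ [(a.1, !a.2)] := by simp [ChainArc.rev]
    rw [h1]
    refine (ih h.2).append ⟨?_, ?_⟩
    · obtain ⟨a, (_ | _)⟩ := a <;> rfl
    · refine Eq.trans ?_ h.1
      obtain ⟨a, (_ | _)⟩ := a <;> rfl

/-- The path along the horizontal segments and the lower half-circles, from the rightmost point of
the first circle to the leftmost point of the circle to the right of `bridge j`. -/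
def stem : Fin (n + 1) → List (ChainArc n × Bool) :=
  Fin.induction [(bridge 0, true)] fun i L => L ++ [(lower i, true), (bridge i.succ, true)]

theorem isPath_stem (j : Fin (n + 1)) : IsPath (0, Side.start) (stem j) (j, Side.finish) := by
  induction j using Fin.induction with
  | zero => exact ⟨rfl, rfl⟩
  | succ i ih => exact IsPath.append (v := (i.castSucc, Side.finish)) ih ⟨rfl, rfl, rfl⟩

theorem ne_up_of_mem_stem (j : Fin (n + 1)) : ∀ w ∈ stem j, ∀ x, w.1 ≠ up x := by
  have hl : ∀ (i : Fin n) x, lower i ≠ up x := by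
    intro i x
    refine Fin.cases ?_ (fun x => Fin.lastCases ?_ (fun x => ?_) x) x <;> simp [up, -Fin.succ_last]
  induction j using Fin.induction with
  | zero =>
    intro w hw x
    obtain rfl := List.mem_singleton.1 hw
    exact (up_ne_bridge x 0).symm
  | succ i ih =>
    intro w hw x
    rcases List.mem_append.1 hw with hw | hw
    · exact ih w hw x
    · simp only [List.mem_cons, List.not_mem_nil, or_false] at hw
      rcases hw with rfl | rfl
      · exact hl i x
      · exact (up_ne_bridge x _).symm

/-- The part of the path of an arrow before the upper half-circle. -/
def before : ChainArc n → List (ChainArc n × Bool)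
  | upper i => stem i.castSucc ++ [(lower i, true)]
  | last => stem (Fin.last n)
  | _ => []

/-- The part of the path of an arrow after the upper half-circle. -/
def after : ChainArc n → List (ChainArc n × Bool)
  | upper i => rev (stem i.castSucc)
  | last => rev (stem (Fin.last n))
  | _ => []

theorem isPath_loop (x : Fin (n + 2)) :
    IsPath (0, Side.start) (before (up x) ++ (up x, true) :: after (up x)) (0, Side.start) := by
  induction x using Fin.cases with
  | zero => exact ⟨rfl, rfl⟩
  | succ x =>
    induction x using Fin.lastCases with
    | last =>
      rw [Fin.succ_last, up_last]
      exact (isPath_stem _).append ⟨rfl, (isPath_stem _).rev⟩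
    | cast i =>
      rw [up_castSucc_succ]
      have h : IsPath (0, Side.start) (before (upper i)) (i.succ, Side.start) :=
        (isPath_stem i.castSucc).append ⟨rfl, rfl⟩
      exact h.append ⟨rfl, (isPath_stem _).rev⟩

theorem ne_up_of_mem_before (a : ChainArc n) : ∀ w ∈ before a, ∀ x, w.1 ≠ up x := by
  intro w hw x
  cases a with
  | upper i =>
    rcases List.mem_append.1 hw with hw | hw
    · exact ne_up_of_mem_stem _ w hw x
    · -- the last letter of `before` also occurs in the next stem
      refine ne_up_of_mem_stem i.succ w (List.mem_append_right _ ?_) x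
      rw [List.mem_singleton] at hw
      simp [hw]
  | last => exact ne_up_of_mem_stem _ w hw x
  | _ => simp [before] at hw

theorem ne_up_of_mem_rev {L : List (ChainArc n × Bool)} (hL : ∀ w ∈ L, ∀ x, w.1 ≠ up x) :
    ∀ w ∈ rev L, ∀ x, w.1 ≠ up x := by
  intro w hw x
  rw [rev, List.mem_reverse, List.mem_map] at hw
  obtain ⟨w, hw, rfl⟩ := hw
  exact hL w hw x

theorem ne_up_of_mem_after (a : ChainArc n) : ∀ w ∈ after a, ∀ x, w.1 ≠ up x := by
  intro w hw x
  cases a with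
  | upper i => exact ne_up_of_mem_rev (ne_up_of_mem_stem _) w hw x
  | last => exact ne_up_of_mem_rev (ne_up_of_mem_stem _) w hw x
  | _ => simp [after] at hw

/-- Legs are pushed along the chain to the right; the height measures how far a leg is from the last
circle. -/
def height : ChainArc n → ℕ
  | lower i => 2 * (n - i) + 1
  | bridge j => 2 * (n + 1 - j)
  | _ => 0

theorem height_up (x : Fin (n + 2)) : height (up x) = 0 := by
  refine Fin.cases ?_ (fun x => Fin.lastCases ?_ (fun x => ?_) x) x <;>
    simp [up, height, -Fin.succ_last]

theorem exists_height_lt (a : ChainArc n) (ha : ∀ x, a ≠ up x) :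
    ∃ v k, a = (half v k).1 ∧ ∀ k', k' ≠ k → height (half v k').1 < height a := by
  cases a with
  | first => exact (ha 0 rfl).elim
  | last => exact (ha _ up_last.symm).elim
  | upper i => exact (ha _ (up_castSucc_succ i).symm).elim
  | lower i =>
    refine ⟨(i.succ, Side.start), 2, (down_succ_castSucc i).symm, fun k' hk' => ?_⟩
    fin_cases k'
    · change 2 * (n + 1 - (i.succ : ℕ)) < 2 * (n - i) + 1
      rw [Fin.val_succ]; omega
    · change height (up i.succ.castSucc) < _
      rw [height_up]; simp [height]
    · exact (hk' rfl).elim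
  | bridge j =>
    refine ⟨(j, Side.finish), 0, rfl, fun k' hk' => ?_⟩
    have hj : 0 < height (bridge j) := by
      have := j.isLt
      change 0 < 2 * (n + 1 - (j : ℕ))
      omega
    fin_cases k'
    · exact (hk' rfl).elim
    · change height (down j.succ) < _
      induction j using Fin.lastCases with
      | last => rw [Fin.succ_last, down_last]; exact hj
      | cast i =>
        have := i.isLt
        rw [down_castSucc_succ]
        change 2 * (n - (i : ℕ)) + 1 < 2 * (n + 1 - (i.castSucc : ℕ))
        rw [Fin.val_castSucc]; omega
    · change height (up j.succ) < _
      rw [height_up]; exact hj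

instance : Finite (ChainArc n) := by
  refine Finite.of_surjective (fun x : (Fin (n + 2) ⊕ Fin (n + 2)) ⊕ Fin (n + 1) =>
    Sum.elim (Sum.elim up down) bridge x) fun a => ?_
  cases a with
  | first => exact ⟨Sum.inl (Sum.inl 0), rfl⟩
  | last => exact ⟨Sum.inl (Sum.inl (Fin.last _)), up_last⟩
  | upper i => exact ⟨Sum.inl (Sum.inl i.castSucc.succ), up_castSucc_succ i⟩
  | lower i => exact ⟨Sum.inl (Sum.inr i.castSucc.succ), down_castSucc_succ i⟩
  | bridge j => exact ⟨Sum.inr j, rfl⟩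

end ChainArc

/-- A letter, as an edge of the chain graph with a direction. -/
def ChainArc.toLetter {n : ℕ} (w : ChainArc n × Bool) : (chainGraph (n + 2)).Edge × Bool :=
  (Sum.inl w.1, w.2)

/-- The paths of the arrows in the chain graph with at least two circles: from the vertex on the
first circle along the stem to the circle, once around it, and back. -/
def chainPaths (n : ℕ) : PathSystem (chainGraph (n + 2)) (Fin (n + 2)) :=
  PathSystem.ofWords (upperHalf (n + 2))
    (fun x => (ChainArc.before (ChainArc.up x)).map ChainArc.toLetter)
    (fun x => (ChainArc.after (ChainArc.up x)).map ChainArc.toLetter)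

/-- A path in the chain graph is a sequence of consecutive passages, at every vertex. -/
theorem follows_of_isPath {n : ℕ} (v : (chainGraph (n + 2)).Vert) (L : List (chainPaths n).Q) :
    ∀ (W : List (ChainArc n × Bool)) (u u' : Fin (n + 1) × Side),
      L.map (chainPaths n).letter = W.map ChainArc.toLetter →
      ChainArc.IsPath u W u' → (chainPaths n).Follows v (u = v) L (u' = v) := by
  have hs : ∀ (q : (chainPaths n).Q) (w : ChainArc n × Bool),
      (chainPaths n).letter q = ChainArc.toLetter w →
      ((chainPaths n).StartsAt v q ↔ ChainArc.source w = v) ∧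
      ((chainPaths n).EndsAt v q ↔ ChainArc.target w = v) := by
    intro q w hq
    have h2 : (chainPaths n).forward q = w.2 := congrArg Prod.snd hq
    have key : ∀ (k : Fin 3) (s : Side), (Sum.inl ((chainGraph (n + 2)).half v k).1 =
        (chainPaths n).edge q ∧ ((chainGraph (n + 2)).half v k).2 = s) ↔
        ChainArc.half v k = (w.1, s) := by
      intro k s
      have h1 : (chainPaths n).edge q = (ChainArc.toLetter w).1 := congrArg Prod.fst hq
      rw [h1]
      exact ⟨fun h => Prod.ext (Sum.inl_injective h.1) h.2,
        fun h => ⟨congrArg Sum.inl (congrArg Prod.fst h), congrArg Prod.snd h⟩⟩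
    constructor
    · refine (exists_congr fun k => key k _).trans ((ChainArc.exists_half_iff v _).trans ?_)
      rw [PathSystem.startSide, h2, ChainArc.source]
    · refine (exists_congr fun k => key k _).trans ((ChainArc.exists_half_iff v _).trans ?_)
      rw [PathSystem.endSide, h2, ChainArc.target]
  induction L with
  | nil =>
    intro W u u' hW h
    obtain rfl : W = [] := by simpa using hW.symm
    have h : u = u' := h
    change u = v ↔ u' = v
    rw [h]
  | cons q L ih =>
    intro W u u' hW h
    rcases W with _ | ⟨w, W⟩
    · simp at hW
    rw [List.map_cons, List.map_cons, List.cons.injEq] at hW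
    obtain ⟨k1, k2⟩ := hs q w hW.1
    refine ⟨?_, ?_⟩
    · rw [k1, h.1]
    · rw [propext k2]
      exact ih W _ u' hW.2 h.2

theorem isClosed_chainPaths (n : ℕ) : (chainPaths n).IsClosed := by
  intro v
  refine ⟨((0, Side.start) : Fin (n + 1) × Side) = v, fun x => ?_⟩
  refine follows_of_isPath v _ _ _ _ ?_ (ChainArc.isPath_loop x)
  refine (PathSystem.map_letter_path_ofWords _ _ _ x).trans ?_
  rw [List.map_append, List.map_cons]
  rfl

end ChordDiagrams

theorem proposition2p3 (g : ℕ) :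
    ∃ Φ : ChordDiagrams.SpaceA (ChordDiagrams.arrows (Fin g)) ≃ₗ[ℚ]
        ChordDiagrams.SpaceA (ChordDiagrams.chainGraph g),
      ∀ x : (∀ i : ℕ, ChordDiagrams.FreeSpace (ChordDiagrams.arrows (Fin g)) i),
        Φ (ChordDiagrams.toSpaceA x) =
          ChordDiagrams.toSpaceA
            (fun i => ChordDiagrams.pushFree (ChordDiagrams.upperHalf g) i (x i)) := by
  open ChordDiagrams in
  match g with
  -- without circles or with one circle, every edge is met by the embedding
  | 0 =>
    have : Finite (chainGraph 0).Edge := inferInstanceAs (Finite (Empty ⊕ Empty))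
    refine exists_linearEquiv (upperHalf 0) (PathSystem.ofEmbedding (upperHalf 0))
      (PathSystem.rotationInvariant_ofEmbedding _) (fun v => v.elim) id (fun _ => rfl)
      (fun _ => rfl) (fun _ => rfl) (fun x _ _ => x.elim0) (fun _ => 0) ?_
    rintro (a | o) -
    · exact a.elim
    · exact o.elim
  | 1 =>
    have : Finite (chainGraph 1).Edge := inferInstanceAs (Finite (Empty ⊕ Unit))
    refine exists_linearEquiv (upperHalf 1) (PathSystem.ofEmbedding (upperHalf 1))
      (PathSystem.rotationInvariant_ofEmbedding _) (fun v => v.elim) id (fun _ => rfl)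
      (fun _ => rfl) (fun _ => rfl) (fun x q _ => Subsingleton.elim (α := Fin 1) q x)
      (fun _ => 0) ?_
    rintro (a | o) h
    · exact a.elim
    · exact (h ⟨(0 : Fin 1), rfl⟩).elim
  | n + 2 =>
    have : Finite (chainGraph (n + 2)).Edge := inferInstanceAs (Finite (ChainArc n ⊕ Empty))
    have : IsEmpty (chainGraph (n + 2)).Circ := inferInstanceAs (IsEmpty Empty)
    refine exists_linearEquiv (upperHalf (n + 2)) (chainPaths n)
      (PathSystem.rotationInvariant_of_isEmpty _) (isClosed_chainPaths n)
      (fun x => ⟨x, Sum.inr (Sum.inl ())⟩) (fun _ => rfl) (fun _ => rfl) (fun _ => rfl)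
      (PathSystem.eq_of_edge_ofWords (upperHalf (n + 2)).injective ?_ ?_)
      (Sum.elim ChainArc.height fun _ => 0) ?_
    · intro x w hw
      obtain ⟨w', hw', rfl⟩ := List.mem_map.1 hw
      rintro ⟨y, hy⟩
      exact ChainArc.ne_up_of_mem_before _ w' hw' y (Sum.inl_injective hy).symm
    · intro x w hw
      obtain ⟨w', hw', rfl⟩ := List.mem_map.1 hw
      rintro ⟨y, hy⟩
      exact ChainArc.ne_up_of_mem_after _ w' hw' y (Sum.inl_injective hy).symm
    · rintro (a | o) ha
      · obtain ⟨v, k, hv, hk⟩ := ChainArc.exists_height_lt a fun x hx => ha ⟨x, by rw [hx]; rfl⟩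
        exact ⟨v, k, congrArg Sum.inl hv, hk⟩
      · exact o.elim
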